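/- Let $m\ge 1$ and let $\mathcal K_0\subseteq\mathcal K_1\subseteq\dots\subseteq\mathcal K_{m-1}$ be a filtration of a finite simplicial complex $K=\mathcal K_{m-1}$ (not necessarily simplex-wise: any number of simplices may be added at each step). Fix $k\ge 0$ and let $f=H_k(\mathcal K;\mathbb Z)$ be the persistence module $f_0\to f_1\to\dots\to f_m$ with $f_i=H_k(\mathcal K_i;\mathbb Z)$ for $i<m$, structure maps induced by the inclusions, and, by convention, $f_m=0$. Say that $f$ *splits* if it is isomorphic to a direct sum of interval modules $I^{b,d}$, $0\le b<d\le m$ (where $I^{b,d}$ is $\mathbb Z$ at the indices $b\le i<d$, with identity maps between them, and $0$ elsewhere). Let $e$ be the largest of the numbers of $(k-1)$-, $k$- and $(k+1)$-simplices of $K$, and let $d=\max_i \operatorname{rank} f_i$. The filtration is given by $m$, the boundary matrices $\partial_k,\partial_{k+1}$ of $K$ and the index at which each $(k-1)$-, $k$- and $(k+1)$-simplex enters. Time is counted as follows: programs work on data built from integers, with addition, subtraction, multiplication, integer division and sign tests (and possibly further fixed basic operations on pairs of integers, such as extended gcd) at unit cost; the time of a run is the number of steps plus the size (number of nodes) of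 the input. Fix a program that computes Smith-normal-form factorizations $SAT=D$ of integer matrices, and let $S_n$ be a bound for its time on matrices with at most $n$ rows and at most $n$ columns. Then, with an absolute implied constant, the following hold. 1. There is a program that tests, for all $0\le a\le b\le m-1$, whether $H_k(\mathcal K_b,\mathcal K_a;\mathbb Z)$ is free, in time $O(m^2 S_e)$. If $H_{k-1}(\mathcal K_a;\mathbb Z)$ and $H_k(\mathcal K_a;\mathbb Z)$ are free for all $a\le m-1$ (with $H_{-1}=0$), then $f$ splits if and only if all these relative homology groups are free, so that this decides whether $f$ splits. 2. Suppose that $H_k(\mathcal K_a;\mathbb Z)$ is free for all $a\le m-1$. There is a program that computes, in time $O(m S_e)$, the matrices of the maps $f_i\to f_{i+1}$, $0\le i<m$, with respect to some bases of the modules $f_0,\dots,f_m$; and there is a program that, given the matrices of these maps with respect to any bases, tests for all $0\le a\le b\le m$ whether the cokernel of $f_a\to f_b$ is free, in time $O(m^2 S_d)$. Moreover, $f$ splits if and only if all these cokernels are free, so that the two programs together decide whether $f$ splits. The programs depend only on the Smith-normal-form program; they and the implied constant do not depend on the filtration, on $m$, $k$ or $S$. -/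

import Mathlib

open CategoryTheory

noncomputable section

/-! ### Simplicial homology with coefficients in a ring -/

/-- Formal `R`-linear combinations of finite vertex sets. -/
def Chain (R : Type) [CommRing R] (V : Type) : Type := Finset V →₀ R

instance (R : Type) [CommRing R] (V : Type) : AddCommGroup (Chain R V) :=
  inferInstanceAs (AddCommGroup (Finset V →₀ R))

instance (R : Type) [CommRing R] (V : Type) : Module R (Chain R V) :=
  inferInstanceAs (Module R (Finset V →₀ R))

/-- The chain that consists of one simplex. -/
def Chain.single (R : Type) [CommRing R] {V : Type} (s : Finset V) : Chain R V :=
  (Finsupp.single s 1 : Finset V →₀ R)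

/-- The coefficient of a chain at a simplex. -/
def Chain.coeff {R : Type} [CommRing R] {V : Type} (x : Chain R V) (s : Finset V) : R :=
  (show Finset V →₀ R from x) s

/-- The simplicial boundary: the `i`-th vertex (in the order of `V`) is deleted with sign `(-1)^i`.
Deleting the vertex of a `0`-simplex contributes nothing, so homology is not reduced. -/
def boundary (R : Type) [CommRing R] (V : Type) [LinearOrder V] : Chain R V →ₗ[R] Chain R V :=
  Finsupp.linearCombination R fun s : Finset V =>
    ∑ v ∈ s, if (s.erase v).Nonempty then
      (-1 : R) ^ (s.filter (· < v)).card • Chain.single R (s.erase v) else 0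

/-- Chains of `K` supported on the faces with `c` vertices, that is, `C_{c-1}(K; R)`. -/
def chains (R : Type) [CommRing R] {V : Type} (K : PreAbstractSimplicialComplex V) (c : ℕ) :
    Submodule R (Chain R V) :=
  Finsupp.supported R R {s | s ∈ K.faces ∧ s.card = c}

/-- The quotient of a submodule `Z` by a submodule `B` (which is contained in `Z` in all uses). -/
abbrev Subquotient {R M : Type} [CommRing R] [AddCommGroup M] [Module R M] (Z B : Submodule R M) :
    Type :=
  ↥Z ⧸ B.submoduleOf Z

/-- The map of subquotients induced by inclusions. -/
def subquotientMap {R M : Type} [CommRing R] [AddCommGroup M] [Module R M]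
    {Z B Z' B' : Submodule R M} (hZ : Z ≤ Z') (hB : B ≤ B') :
    Subquotient Z B →ₗ[R] Subquotient Z' B' :=
  Submodule.mapQ (B.submoduleOf Z) (B'.submoduleOf Z') (Submodule.inclusion hZ) fun _ hx => hB hx

theorem chains_mono (R : Type) [CommRing R] {V : Type} {K K' : PreAbstractSimplicialComplex V}
    (h : K ≤ K') (c : ℕ) : chains R K c ≤ chains R K' c :=
  Finsupp.supported_mono fun _ hs => ⟨h hs.1, hs.2⟩

section Homology

variable (R : Type) [CommRing R] {V : Type} [LinearOrder V]

/-- Relative `k`-cycles of `(K, L)`: `k`-chains of `K` whose boundary lies in `L`. -/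
def relCycles (K L : PreAbstractSimplicialComplex V) (k : ℕ) : Submodule R (Chain R V) :=
  chains R K (k + 1) ⊓ (chains R L k).comap (boundary R V)

/-- Relative `k`-boundaries of `(K, L)`: boundaries of `(k+1)`-chains of `K`, modulo `L`. -/
def relBoundaries (K L : PreAbstractSimplicialComplex V) (k : ℕ) : Submodule R (Chain R V) :=
  (chains R K (k + 2)).map (boundary R V) ⊔ chains R L (k + 1)

/-- The relative homology group `H_k(K, L; R)` of a subcomplex `L ≤ K`. -/
abbrev relHomology (K L : PreAbstractSimplicialComplex V) (k : ℕ) : Type :=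
  Subquotient (relCycles R K L k) (relBoundaries R K L k)

/-- The homology group `H_k(K; R) = H_k(K, ∅; R)`. -/
abbrev homologyGroup (K : PreAbstractSimplicialComplex V) (k : ℕ) : Type :=
  relHomology R K ⊥ k

/-- `H_k(K, L; R)` is free. -/
def RelHomologyFree (K L : PreAbstractSimplicialComplex V) (k : ℕ) : Prop :=
  Module.Free R (relHomology R K L k)

/-- `H_k(K; R)` is free. -/
def HomologyFree (K : PreAbstractSimplicialComplex V) (k : ℕ) : Prop :=
  Module.Free R (homologyGroup R K k)

variable {K K' K'' : PreAbstractSimplicialComplex V}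

theorem relCycles_mono (h : K ≤ K') (L : PreAbstractSimplicialComplex V) (k : ℕ) :
    relCycles R K L k ≤ relCycles R K' L k :=
  inf_le_inf_right _ (chains_mono R h _)

theorem relBoundaries_mono (h : K ≤ K') (L : PreAbstractSimplicialComplex V) (k : ℕ) :
    relBoundaries R K L k ≤ relBoundaries R K' L k :=
  sup_le_sup_right (Submodule.map_mono (chains_mono R h _)) _

/-- The map `H_k(K; R) → H_k(K'; R)` induced by an inclusion `K ≤ K'`. -/
def homologyMap (h : K ≤ K') (k : ℕ) : homologyGroup R K k →ₗ[R] homologyGroup R K' k :=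
  subquotientMap (relCycles_mono R h ⊥ k) (relBoundaries_mono R h ⊥ k)

theorem homologyMap_refl (h : K ≤ K) (k : ℕ) (x : homologyGroup R K k) :
    homologyMap R h k x = x := by
  obtain ⟨y, rfl⟩ := Submodule.Quotient.mk_surjective _ x
  rfl

theorem homologyMap_trans (h : K ≤ K') (h' : K' ≤ K'') (h'' : K ≤ K'') (k : ℕ)
    (x : homologyGroup R K k) :
    homologyMap R h' k (homologyMap R h k x) = homologyMap R h'' k x := by
  obtain ⟨y, rfl⟩ := Submodule.Quotient.mk_surjective _ x
  rfl

end Homology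

/-! ### Filtrations and persistence modules -/

/-- A filtration `K_0 ≤ K_1 ≤ … ≤ K_{m-1}` of a finite simplicial complex; any number of simplices
(also none) may be added at each step. -/
structure Filtration (V : Type) (m : ℕ) where
  cx : Fin m → PreAbstractSimplicialComplex V
  mono : Monotone cx
  finite : ∀ i, (cx i).faces.Finite

/-- The simplices with `c` vertices that occur in the filtration. -/
def Filtration.simplices {V : Type} {m : ℕ} (K : Filtration V m) (c : ℕ) : Set (Finset V) :=
  {s | s.card = c ∧ ∃ i, s ∈ (K.cx i).faces}

/-- The first index at which a simplex is present. -/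
def Filtration.birth {V : Type} {m : ℕ} (K : Filtration V m) (s : Finset V) : ℕ :=
  sInf {i : ℕ | ∃ h : i < m, s ∈ (K.cx ⟨i, h⟩).faces}

/-- A persistence module over `R` with index set `{0, …, m}`. -/
abbrev PersistenceModule (R : Type) [CommRing R] (m : ℕ) := Fin (m + 1) ⥤ ModuleCat.{0} R

section Persistence

variable (R : Type) [CommRing R]

/-- The persistence module `H_k(K; R)` on `{0, …, m}`: it is `H_k(K_i; R)` at `i < m` and, by
convention, `0` at `i = m` (a product over the proofs of `i < m`). -/
def persistentHomology {V : Type} [LinearOrder V] {m : ℕ} (K : Filtration V m) (k : ℕ) :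
    PersistenceModule R m where
  obj i := ModuleCat.of R ((h : PLift (i.1 < m)) → homologyGroup R (K.cx ⟨i.1, h.down⟩) k)
  map {i j} f := ModuleCat.ofHom <| LinearMap.pi fun h : PLift (j.1 < m) =>
    homologyMap R
      (K.mono (show (⟨i.1, lt_of_le_of_lt (leOfHom f) h.down⟩ : Fin m) ≤ ⟨j.1, h.down⟩ from
        leOfHom f)) k ∘ₗ LinearMap.proj
        (φ := fun h : PLift (i.1 < m) => homologyGroup R (K.cx ⟨i.1, h.down⟩) k)
        (PLift.up (lt_of_le_of_lt (leOfHom f) h.down))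
  map_id i := by
    refine ModuleCat.hom_ext (LinearMap.ext fun x => ?_)
    funext h
    exact homologyMap_refl R le_rfl k (x h)
  map_comp {i s j} f g := by
    refine ModuleCat.hom_ext (LinearMap.ext fun x => ?_)
    funext h
    have his : i.1 ≤ s.1 := leOfHom f
    have hsj : s.1 ≤ j.1 := leOfHom g
    exact (homologyMap_trans R
      (K.mono (show (⟨i.1, by have := h.down; omega⟩ : Fin m) ≤
        ⟨s.1, by have := h.down; omega⟩ from his))
      (K.mono (show (⟨s.1, by have := h.down; omega⟩ : Fin m) ≤ ⟨j.1, h.down⟩ from hsj))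
      (K.mono (show (⟨i.1, by have := h.down; omega⟩ : Fin m) ≤ ⟨j.1, h.down⟩ from his.trans hsj))
      k (x ⟨by have := h.down; omega⟩)).symm

/-- The interval module `I^{b,d}`: `R` at the indices `b ≤ i < d` with identities between them, and
`0` at all other indices (a product over the proofs of `b ≤ i < d`). -/
def intervalModule (m b d : ℕ) : PersistenceModule R m where
  obj i := ModuleCat.of R (PLift (b ≤ i.1 ∧ i.1 < d) → R)
  map {i j} _ := ModuleCat.ofHom <| LinearMap.pi fun _ : PLift (b ≤ j.1 ∧ j.1 < d) =>
    if hi : b ≤ i.1 ∧ i.1 < d then LinearMap.proj (PLift.up hi) else 0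
  map_id i := by
    refine ModuleCat.hom_ext (LinearMap.ext fun x => ?_)
    funext h
    simp [h.down]
  map_comp {i s j} f g := by
    refine ModuleCat.hom_ext (LinearMap.ext fun x => ?_)
    funext h
    have h1 : i.1 ≤ s.1 := leOfHom f
    have h2 : s.1 ≤ j.1 := leOfHom g
    have h3 := h.down
    by_cases hi : b ≤ i.1 ∧ i.1 < d
    · have hs : b ≤ s.1 ∧ s.1 < d := by omega
      simp [hi, hs]
    · by_cases hs : b ≤ s.1 ∧ s.1 < d <;> simp [hi, hs]

variable {R}

/-- The (pointwise) direct sum of finitely many persistence modules. -/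
def finiteDirectSum {m n : ℕ} (g : Fin n → PersistenceModule R m) : PersistenceModule R m where
  obj i := ModuleCat.of R ((t : Fin n) → (g t).obj i)
  map f := ModuleCat.ofHom (LinearMap.pi fun t => ((g t).map f).hom ∘ₗ LinearMap.proj t)
  map_id i := by
    refine ModuleCat.hom_ext (LinearMap.ext fun x => ?_)
    funext t
    simp
  map_comp f f' := by
    refine ModuleCat.hom_ext (LinearMap.ext fun x => ?_)
    funext t
    simp

/-- `f` is isomorphic to a direct sum of interval modules. -/
def SplitsIntoIntervals {m : ℕ} (f : PersistenceModule R m) : Prop :=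
  ∃ (n : ℕ) (b d : Fin n → ℕ), (∀ t, b t < d t ∧ d t ≤ m) ∧
    Nonempty (f ≅ finiteDirectSum fun t => intervalModule R m (b t) (d t))

/-- The structure map `f(a ≤ b)` has a free cokernel. -/
def FreeCokernel {m : ℕ} (f : PersistenceModule R m) {a b : Fin (m + 1)} (h : a ≤ b) : Prop :=
  Module.Free R (f.obj b ⧸ LinearMap.range (f.map (homOfLE h)).hom)

/-- The largest rank of a module `f_i`. -/
def maxRank {m : ℕ} (f : PersistenceModule R m) : ℕ :=
  Finset.univ.sup fun i => Module.finrank R (f.obj i)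

/-- A basis of every module `f_i`. -/
structure Bases {m : ℕ} (f : PersistenceModule R m) where
  rank : Fin (m + 1) → ℕ
  basis : ∀ i, Module.Basis (Fin (rank i)) R (f.obj i)

/-- The matrix of `f(i ≤ i+1)` in the given bases. -/
def Bases.stepMatrix {m : ℕ} {f : PersistenceModule R m} (β : Bases f) (i : Fin m) :
    Matrix (Fin (β.rank i.succ)) (Fin (β.rank i.castSucc)) R :=
  LinearMap.toMatrix (β.basis i.castSucc) (β.basis i.succ)
    (f.map (homOfLE i.castSucc_le_succ)).hom

end Persistence

/-! ### Smith normal form -/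

/-- `U A W = D` is a Smith-normal-form factorization of `A`: `U` and `W` are unimodular, and `D` is
diagonal with each diagonal entry dividing the next (so zeros come last). -/
structure IsSmithFactorization {r c : ℕ} (A : Matrix (Fin r) (Fin c) ℤ)
    (U : Matrix (Fin r) (Fin r) ℤ) (D : Matrix (Fin r) (Fin c) ℤ) (W : Matrix (Fin c) (Fin c) ℤ) :
    Prop where
  unimodular_left : IsUnit U
  unimodular_right : IsUnit W
  eq : U * A * W = D
  diagonal : ∀ i j, i.1 ≠ j.1 → D i j = 0
  dvd : ∀ i j i' j', i.1 = j.1 → i'.1 = j'.1 → i'.1 = i.1 + 1 → D i j ∣ D i' j'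

/-! ### The machine model: programs that count arithmetic operations -/

/-- Data: binary trees with integers at the leaves. -/
inductive Val : Type
  | int (z : ℤ) : Val
  | pair (a b : Val) : Val

/-- The number of nodes of a tree. -/
def Val.size : Val → ℕ
  | .int _ => 1
  | .pair a b => a.size + b.size + 1

/-- Programs, each of which maps one value to one value. `prim i` stands for the `i`-th of the
basic integer operations that a machine may have besides `add`, `sub`, `mul`, `div`
(for instance the coefficients in Bézout's identity). -/
inductive Prog : Type
  | id : Prog
  | const (z : ℤ) : Prog
  | fst : Prog
  | snd : Prog
  | pair (p q : Prog) : Prog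
  | comp (p q : Prog) : Prog
  | isPair : Prog
  | add : Prog
  | sub : Prog
  | mul : Prog
  | div : Prog
  | prim (i : ℕ) : Prog
  | ite (c p q : Prog) : Prog
  | loop (c p : Prog) : Prog

/-- `Eval ops p x y t`: on a machine with the extra basic operations `ops`, the program `p` maps `x`
to `y` in `t` steps. Every basic operation, and every control step, counts as one step.
`comp p q` runs `q` first; `ite` and `loop` test whether the value of the condition is positive. -/
inductive Eval (ops : ℕ → ℤ → ℤ → ℤ) : Prog → Val → Val → ℕ → Prop
  | id (x : Val) : Eval ops .id x x 1
  | const (z : ℤ) (x : Val) : Eval ops (.const z) x (.int z) 1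
  | fst (a b : Val) : Eval ops .fst (.pair a b) a 1
  | snd (a b : Val) : Eval ops .snd (.pair a b) b 1
  | pair {p q : Prog} {x a b : Val} {s t : ℕ} (hp : Eval ops p x a s) (hq : Eval ops q x b t) :
      Eval ops (.pair p q) x (.pair a b) (s + t + 1)
  | comp {p q : Prog} {x y z : Val} {s t : ℕ} (hq : Eval ops q x y s) (hp : Eval ops p y z t) :
      Eval ops (.comp p q) x z (s + t + 1)
  | isPair_pair (a b : Val) : Eval ops .isPair (.pair a b) (.int 1) 1
  | isPair_int (z : ℤ) : Eval ops .isPair (.int z) (.int 0) 1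
  | add (a b : ℤ) : Eval ops .add (.pair (.int a) (.int b)) (.int (a + b)) 1
  | sub (a b : ℤ) : Eval ops .sub (.pair (.int a) (.int b)) (.int (a - b)) 1
  | mul (a b : ℤ) : Eval ops .mul (.pair (.int a) (.int b)) (.int (a * b)) 1
  | div (a b : ℤ) : Eval ops .div (.pair (.int a) (.int b)) (.int (a / b)) 1
  | prim (i : ℕ) (a b : ℤ) : Eval ops (.prim i) (.pair (.int a) (.int b)) (.int (ops i a b)) 1
  | ite_pos {c p q : Prog} {x y : Val} {z : ℤ} {s t : ℕ} (hc : Eval ops c x (.int z) s)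
      (hz : 0 < z) (hp : Eval ops p x y t) : Eval ops (.ite c p q) x y (s + t + 1)
  | ite_neg {c p q : Prog} {x y : Val} {z : ℤ} {s t : ℕ} (hc : Eval ops c x (.int z) s)
      (hz : z ≤ 0) (hq : Eval ops q x y t) : Eval ops (.ite c p q) x y (s + t + 1)
  | loop_stop {c p : Prog} {x : Val} {z : ℤ} {s : ℕ} (hc : Eval ops c x (.int z) s)
      (hz : z ≤ 0) : Eval ops (.loop c p) x x (s + 1)
  | loop_step {c p : Prog} {x y w : Val} {z : ℤ} {s t u : ℕ} (hc : Eval ops c x (.int z) s)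
      (hz : 0 < z) (hp : Eval ops p x y t) (hl : Eval ops (.loop c p) y w u) :
      Eval ops (.loop c p) x w (s + t + u + 1)

/-- `p` maps `x` to `y` in time at most `T`, where time is the number of nodes of the input (which
has to be loaded) plus the number of steps. -/
def RunsIn (ops : ℕ → ℤ → ℤ → ℤ) (p : Prog) (x y : Val) (T : ℕ) : Prop :=
  ∃ t, Eval ops p x y t ∧ x.size + t ≤ T

/-! ### Encodings -/

/-- Lists are right-nested pairs that end in `0`. -/
def encodeList : List Val → Val
  | [] => .int 0
  | a :: l => .pair a (encodeList l)

/-- A matrix is encoded by its numbers of rows and columns and the list of its rows. -/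
def encodeMatrix {r c : ℕ} (A : Matrix (Fin r) (Fin c) ℤ) : Val :=
  .pair (.int r) (.pair (.int c)
    (encodeList (List.ofFn fun i => encodeList (List.ofFn fun j => .int (A i j)))))

/-- The matrix of the boundary map in given enumerations of the simplices. -/
def boundaryMatrix {V : Type} [LinearOrder V] {m : ℕ} (K : Filtration V m) {c c' r s : ℕ}
    (lo : Fin r ≃ K.simplices c) (hi : Fin s ≃ K.simplices c') : Matrix (Fin r) (Fin s) ℤ :=
  fun i j => (boundary ℤ V (Chain.single ℤ (hi j : Finset V))).coeff (lo i : Finset V)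

/-- The list of birth indices of enumerated simplices. -/
def encodeBirths {V : Type} {m : ℕ} (K : Filtration V m) {c r : ℕ}
    (σ : Fin r ≃ K.simplices c) : Val :=
  encodeList (List.ofFn fun i => .int (K.birth (σ i : Finset V)))

/-- The filtration as an input for degree `k`: its length `m`, the birth indices of the simplices of
dimensions `k-1`, `k`, `k+1`, and the boundary matrices `∂_k` and `∂_{k+1}`. -/
def encodeFiltration {V : Type} [LinearOrder V] {m : ℕ} (K : Filtration V m) {k p q r : ℕ}
    (lo : Fin p ≃ K.simplices k) (mid : Fin q ≃ K.simplices (k + 1))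
    (hi : Fin r ≃ K.simplices (k + 2)) : Val :=
  .pair (.int m) (.pair
    (.pair (encodeBirths K lo) (.pair (encodeBirths K mid) (encodeBirths K hi)))
    (.pair (encodeMatrix (boundaryMatrix K lo mid)) (encodeMatrix (boundaryMatrix K mid hi))))

/-- A matrix representation of a persistence module: the list of the matrices of `f(i ≤ i+1)`. -/
def encodeBases {m : ℕ} {f : PersistenceModule ℤ m} (β : Bases f) : Val :=
  encodeList (List.ofFn fun i : Fin m => encodeMatrix (β.stepMatrix i))

open Classical in
/-- The truth value of a proposition as an integer. -/
def bit (P : Prop) : ℤ := if P then 1 else 0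

/-- The outcome of a test of all pairs `a ≤ b`: the verdict whether all tests are passed, and the
table of the single tests (with entry `1` where `a ≤ b` fails). -/
def encodeTests {n : ℕ} (P : ∀ a b : Fin n, a ≤ b → Prop) : Val :=
  .pair (.int (bit (∀ a b (h : a ≤ b), P a b h)))
    (encodeMatrix (fun a b : Fin n => bit (∀ h : a ≤ b, P a b h)))

/-- `snf` computes Smith-normal-form factorizations over `ℤ`, and `S n` bounds its worst-case time
on the matrices with at most `n` rows and at most `n` columns. -/
def ComputesSmith (ops : ℕ → ℤ → ℤ → ℤ) (snf : Prog) (S : ℕ → ℕ) : Prop :=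
  ∀ (r c : ℕ) (A : Matrix (Fin r) (Fin c) ℤ),
    ∃ (U : Matrix (Fin r) (Fin r) ℤ) (D : Matrix (Fin r) (Fin c) ℤ)
      (W : Matrix (Fin c) (Fin c) ℤ), IsSmithFactorization A U D W ∧
      ∀ n, r ≤ n → c ≤ n →
        RunsIn ops snf (encodeMatrix A)
          (.pair (encodeMatrix U) (.pair (encodeMatrix D) (encodeMatrix W))) (S n)

end

/-! Algebra. Over a PID, the quotient of a finitely generated module by a submodule is free exactly
when the submodule is saturated: it contains every vector of which it contains a nonzero multiple.
In a direct sum of intervals the structure maps only keep or kill coordinates, so their images are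
saturated. Conversely, suppose that all images are saturated. In the first nonzero module take a
primitive vector of the first nonzero kernel. Its orbit spans an interval with saturated terms, the
quotient inherits the hypotheses with smaller total rank, and an interval basis of the quotient
lifts (`hasIntervalBasis_of_saturated`, `hasIntervalBasis_of_quotient`). By the exact sequence of a
pair, the cokernel of H_k(L) → H_k(K) sits in H_k(K, L) with quotient a subgroup of H_{k-1}(L); if
the latter is free, cokernel and relative group are free together (`relHomologyFree_iff_coker`).

Matrices. Torsion of C_k(K) modulo boundaries and chains of L consists of relative cycles
automatically, so H_k(K, L) is free if and only if a submatrix of ∂_{k+1} has saturated range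
(`saturatedRange_bdMatrix_iff`), that is, if its Smith form has only entries 0 and ±1
(`saturatedRange_iff`). For the second method, a Smith factorization of ∂_{k+1} splits off the free
cokernel, and another one computes the kernel of the map that ∂_k induces on it. This gives
coordinates and representatives for homology (`homCoord`, `homRep`), and the matrix of f_i → f_{i+1}
is the product of coordinates at i+1 and representatives at i (`exists_bases`).

Time. Reading the input is counted, so S_n ≥ n² + 1 (`World.sq_le_S`), and quadratic work costs
nothing extra. No further lower bound on S is available, so matrices have to be multiplied in O(n²)
operations. This is possible because integers of any size have unit cost: rows are packed into
single integers (`matMul`). Inverses of unimodular matrices come from a second Smith factorization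
(`inv_mul`). Each entry of a test table then costs O(S); for the cokernels, a row of the table is
obtained in one sweep with a running product (`computes_row`). -/

/-! ### Computability in a time budget, uniformly in a family of inputs -/

/-- A machine together with a program for Smith normal forms and a bound for its time. -/
structure World where
  snf : Prog
  ops : ℕ → ℤ → ℤ → ℤ
  S : ℕ → ℕ
  smith : ComputesSmith ops snf S

/-- `T` is bounded by a constant multiple of `T' + 1`. -/
def Dom {ι : Type*} (T T' : ι → ℕ) : Prop := ∃ K, ∀ i, T i ≤ K * (T' i + 1)

theorem Dom.of_le {ι : Type*} {T T' : ι → ℕ} (h : ∀ i, T i ≤ T' i) : Dom T T' :=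
  ⟨1, fun i => by have := h i; omega⟩

theorem Dom.refl {ι : Type*} (T : ι → ℕ) : Dom T T := .of_le fun _ => le_rfl

theorem Dom.zero {ι : Type*} (T : ι → ℕ) : Dom (fun _ => 0) T := ⟨0, fun i => by simp⟩

theorem Dom.trans {ι : Type*} {T T' T'' : ι → ℕ} (h : Dom T T') (h' : Dom T' T'') :
    Dom T T'' := by
  obtain ⟨K, hK⟩ := h
  obtain ⟨K', hK'⟩ := h'
  refine ⟨K * (K' + 1), fun i => (hK i).trans ?_⟩
  rw [mul_assoc]
  refine Nat.mul_le_mul_left _ ?_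
  have := hK' i
  rw [add_mul]; omega

/-- There is one program, depending only on the program for Smith normal forms, that maps `x i` to
`y i` in time `O(T i + 1)` for all `i`. -/
def Computes {ι : Type*} (w : ι → World) (x y : ι → Val) (T : ι → ℕ) : Prop :=
  ∃ (C : ℕ) (P : Prog → Prog), ∀ i, ∃ t, t ≤ C * (T i + 1) ∧
    Eval (w i).ops (P (w i).snf) (x i) (y i) t

/-- A vector of values as a list. -/
def vec {n : ℕ} (f : Fin n → Val) : Val := encodeList (List.ofFn f)

/-- Indices together with a position. -/
abbrev Idx {ι : Type*} (N : ι → ℕ) := Σ i, Fin (N i)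

/-- The sequence of states is given in advance, so a loop is analysed by exhibiting its states.
Besides the bodies, the condition is evaluated once per round and once more at the exit, each time
with one control step. -/
theorem Eval.loop_iterate {ops : ℕ → ℤ → ℤ → ℤ} {c p : Prog} {a : ℕ} (N : ℕ) :
    ∀ (st : ℕ → Val) (d : ℕ → ℤ) (s : ℕ → ℕ),
      (∀ n ≤ N, ∃ t ≤ a, Eval ops c (st n) (.int (d n)) t) → (∀ n < N, 0 < d n) → d N ≤ 0 →
      (∀ n < N, ∃ t ≤ s n, Eval ops p (st n) (st (n + 1)) t) →
      ∃ t ≤ ∑ n ∈ Finset.range N, (s n + (a + 1)) + (a + 1),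
        Eval ops (.loop c p) (st 0) (st N) t := by
  induction N with
  | zero =>
    intro st d s hc _ hd _
    obtain ⟨t, ht, he⟩ := hc 0 le_rfl
    refine ⟨t + 1, by simp; omega, ?_⟩
    exact Eval.loop_stop he hd
  | succ N ih =>
    intro st d s hc hpos hd hb
    obtain ⟨t, ht, he⟩ := hc 0 (Nat.zero_le _)
    obtain ⟨u, hu, hu'⟩ := hb 0 (Nat.succ_pos _)
    obtain ⟨v, hv, hv'⟩ := ih (fun n => st (n + 1)) (fun n => d (n + 1)) (fun n => s (n + 1))
      (fun n hn => hc (n + 1) (by omega)) (fun n hn => hpos (n + 1) (by omega)) hd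
      (fun n hn => hb (n + 1) (by omega))
    refine ⟨t + u + v + 1, ?_, .loop_step he (hpos 0 (Nat.succ_pos _)) hu' hv'⟩
    rw [Finset.sum_range_succ']
    omega

namespace Computes

variable {ι : Type*} {w : ι → World} {x y z a b : ι → Val} {T T' : ι → ℕ}

theorem mono (h : Computes w x y T) (hT : Dom T T') : Computes w x y T' := by
  obtain ⟨C, P, h⟩ := h
  obtain ⟨K, hK⟩ := hT
  refine ⟨C * (K + 1), P, fun i => ?_⟩
  obtain ⟨t, ht, he⟩ := h i
  refine ⟨t, ht.trans ?_, he⟩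
  rw [mul_assoc]
  refine Nat.mul_le_mul_left _ ?_
  have := hK i
  rw [add_mul]; omega

theorem congr (h : Computes w x y T) {x' y' : ι → Val} (hx : ∀ i, x' i = x i)
    (hy : ∀ i, y' i = y i) : Computes w x' y' T := by
  obtain rfl : x' = x := funext hx
  obtain rfl : y' = y := funext hy
  exact h

theorem restrict {ι' : Type*} (h : Computes w x y T) (f : ι' → ι) :
    Computes (fun j => w (f j)) (fun j => x (f j)) (fun j => y (f j)) (fun j => T (f j)) := by
  obtain ⟨C, P, h⟩ := h
  exact ⟨C, P, fun j => h (f j)⟩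

theorem comp (hg : Computes w y z T') (hf : Computes w x y T) (hT : Dom T' T) :
    Computes w x z T := by
  obtain ⟨C, P, h⟩ := hg.mono hT
  obtain ⟨C', P', h'⟩ := hf
  refine ⟨C + C' + 1, fun s => .comp (P s) (P' s), fun i => ?_⟩
  obtain ⟨t, ht, he⟩ := h i
  obtain ⟨t', ht', he'⟩ := h' i
  exact ⟨t' + t + 1, by rw [add_mul, add_mul]; omega, .comp he' he⟩

theorem id (w : ι → World) (x : ι → Val) (T : ι → ℕ) : Computes w x x T :=
  ⟨1, fun _ => .id, fun i => ⟨1, by omega, .id _⟩⟩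

theorem const (w : ι → World) (x : ι → Val) (T : ι → ℕ) (n : ℤ) :
    Computes w x (fun _ => .int n) T :=
  ⟨1, fun _ => .const n, fun i => ⟨1, by omega, .const _ _⟩⟩

theorem pair (ha : Computes w x a T) (hb : Computes w x b T) :
    Computes w x (fun i => .pair (a i) (b i)) T := by
  obtain ⟨C, P, h⟩ := ha
  obtain ⟨C', P', h'⟩ := hb
  refine ⟨C + C' + 1, fun s => .pair (P s) (P' s), fun i => ?_⟩
  obtain ⟨t, ht, he⟩ := h i
  obtain ⟨t', ht', he'⟩ := h' i
  exact ⟨t + t' + 1, by rw [add_mul, add_mul]; omega, .pair he he'⟩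

theorem fst (h : Computes w x (fun i => .pair (a i) (b i)) T) : Computes w x a T :=
  comp (T' := fun _ => 0) ⟨1, fun _ => .fst, fun _ => ⟨1, by omega, .fst _ _⟩⟩ h (.zero _)

theorem snd (h : Computes w x (fun i => .pair (a i) (b i)) T) : Computes w x b T :=
  comp (T' := fun _ => 0) ⟨1, fun _ => .snd, fun _ => ⟨1, by omega, .snd _ _⟩⟩ h (.zero _)

/-- Bind the intermediate value `a` in front of the input. -/
theorem bind (ha : Computes w x a T) (h : Computes w (fun i => .pair (a i) (x i)) y T) :
    Computes w x y T :=
  h.comp (ha.pair (.id w x T)) (.refl _)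

theorem head : Computes w (fun i => .pair (a i) (x i)) a T := fst (id _ _ _)

theorem tail (h : Computes w x y T) : Computes w (fun i => .pair (a i) (x i)) y T :=
  h.comp (snd (id _ _ T)) (.refl _)

section Arithmetic

variable {m n : ι → ℤ}

theorem add (hm : Computes w x (fun i => .int (m i)) T) (hn : Computes w x (fun i => .int (n i)) T) :
    Computes w x (fun i => .int (m i + n i)) T :=
  comp (T' := fun _ => 0) ⟨1, fun _ => .add, fun _ => ⟨1, by omega, .add _ _⟩⟩ (hm.pair hn) (.zero _)

theorem sub (hm : Computes w x (fun i => .int (m i)) T) (hn : Computes w x (fun i => .int (n i)) T) :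
    Computes w x (fun i => .int (m i - n i)) T :=
  comp (T' := fun _ => 0) ⟨1, fun _ => .sub, fun _ => ⟨1, by omega, .sub _ _⟩⟩ (hm.pair hn) (.zero _)

theorem mul (hm : Computes w x (fun i => .int (m i)) T) (hn : Computes w x (fun i => .int (n i)) T) :
    Computes w x (fun i => .int (m i * n i)) T :=
  comp (T' := fun _ => 0) ⟨1, fun _ => .mul, fun _ => ⟨1, by omega, .mul _ _⟩⟩ (hm.pair hn) (.zero _)

theorem div (hm : Computes w x (fun i => .int (m i)) T) (hn : Computes w x (fun i => .int (n i)) T) :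
    Computes w x (fun i => .int (m i / n i)) T :=
  comp (T' := fun _ => 0) ⟨1, fun _ => .div, fun _ => ⟨1, by omega, .div _ _⟩⟩ (hm.pair hn) (.zero _)

/-- A branch has to be correct only on the inputs that reach it. This matters when its result is not
even meaningful for the others. -/
theorem ite (hm : Computes w x (fun i => .int (m i)) T)
    (ha : Computes (fun j : {i // 0 < m i} => w j) (fun j => x j) (fun j => y j) (fun j => T j))
    (hb : Computes (fun j : {i // m i ≤ 0} => w j) (fun j => x j) (fun j => y j) (fun j => T j)) :
    Computes w x y T := by
  obtain ⟨C, P, h⟩ := hm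
  obtain ⟨C₁, P₁, h₁⟩ := ha
  obtain ⟨C₂, P₂, h₂⟩ := hb
  refine ⟨C + C₁ + C₂ + 1, fun s => .ite (P s) (P₁ s) (P₂ s), fun i => ?_⟩
  obtain ⟨t, ht, he⟩ := h i
  rcases lt_or_ge 0 (m i) with hi | hi
  · obtain ⟨u, hu, hu'⟩ := h₁ ⟨i, hi⟩
    exact ⟨t + u + 1, by simp only at hu; rw [add_mul, add_mul, add_mul]; omega, .ite_pos he hi hu'⟩
  · obtain ⟨u, hu, hu'⟩ := h₂ ⟨i, hi⟩
    exact ⟨t + u + 1, by simp only at hu; rw [add_mul, add_mul, add_mul]; omega, .ite_neg he hi hu'⟩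

theorem ite' (hm : Computes w x (fun i => .int (m i)) T) (ha : Computes w x a T)
    (hb : Computes w x b T) : Computes w x (fun i => if 0 < m i then a i else b i) T :=
  ite hm ((ha.restrict (fun j : {i // 0 < m i} => j.1)).congr (fun _ => rfl) fun j => if_pos j.2)
    ((hb.restrict (fun j : {i // m i ≤ 0} => j.1)).congr (fun _ => rfl) fun j => if_neg j.2.not_gt)

end Arithmetic

section Loops

variable {N : ι → ℕ} {st : ι → ℕ → Val} {B : Idx N → ℕ}

theorem loop {c : ι → ℕ → ℤ}
    (hc : Computes (fun j : Idx fun i => N i + 1 => w j.1) (fun j => st j.1 j.2)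
      (fun j => .int (c j.1 j.2)) (fun _ => 0))
    (hpos : ∀ i n, n < N i → 0 < c i n) (hend : ∀ i, c i (N i) ≤ 0)
    (hb : Computes (fun j : Idx N => w j.1) (fun j => st j.1 j.2) (fun j => st j.1 (j.2 + 1)) B)
    (hB : Dom (fun i => ∑ n, (B ⟨i, n⟩ + 1)) T) :
    Computes w (fun i => st i 0) (fun i => st i (N i)) T := by
  refine mono ?_ hB
  obtain ⟨C, P, h⟩ := hc
  obtain ⟨C', P', h'⟩ := hb
  refine ⟨C + 1 + C', fun s => .loop (P s) (P' s), fun i => ?_⟩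
  obtain ⟨t, ht, he⟩ := Eval.loop_iterate (ops := (w i).ops) (c := P (w i).snf) (p := P' (w i).snf)
    (a := C) (N i) (st i) (c i) (fun n => if hn : n < N i then C' * (B ⟨i, n, hn⟩ + 1) else 0)
    (fun n hn => by
      obtain ⟨t, ht, he⟩ := h ⟨i, n, Nat.lt_succ_of_le hn⟩
      exact ⟨t, by simpa using ht, he⟩) (hpos i) (hend i)
    (fun n hn => by simpa [hn] using h' ⟨i, n, hn⟩)
  refine ⟨t, ht.trans ?_, he⟩
  rw [Finset.sum_range]
  simp only [Fin.is_lt, dite_true, Fin.eta]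
  rw [Finset.sum_add_distrib, ← Finset.mul_sum]
  simp only [Finset.sum_const, Finset.card_univ, Fintype.card_fin, smul_eq_mul]
  -- The summand 1 per round lets the total budget also pay for the conditions and the control
  -- steps.
  have h1 : N i ≤ ∑ n, (B ⟨i, n⟩ + 1) := by
    rw [Finset.sum_add_distrib]; simp
  generalize ∑ n, (B ⟨i, n⟩ + 1) = Q at *
  nlinarith [Nat.zero_le C, Nat.zero_le C', Nat.mul_le_mul_left (C + 1) h1]

/-- The loop state consists of the unread part of the list, the accumulator and the unchanged input.
As a nonempty list is a pair and the empty one an integer, `isPair` is the loop condition. -/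
theorem foldList {L : ι → List Val} {B : Idx (fun i => (L i).length) → ℕ}
    (hL : Computes w x (fun i => encodeList (L i)) T) (h0 : Computes w x (fun i => st i 0) T)
    (hb : Computes (fun j : Idx fun i => (L i).length => w j.1)
      (fun j => .pair ((L j.1).get j.2) (.pair (st j.1 j.2) (x j.1)))
      (fun j => st j.1 (j.2 + 1)) B)
    (hB : Dom (fun i => ∑ n, (B ⟨i, n⟩ + 1)) T) :
    Computes w x (fun i => st i (L i).length) T := by
  have key := loop (w := w) (T := T) (N := fun i => (L i).length) (B := B)
    (st := fun i n => .pair (encodeList ((L i).drop n)) (.pair (st i n) (x i)))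
    (c := fun i n => if n < (L i).length then 1 else 0) ?_ ?_ ?_ ?_ hB
  · exact key.snd.fst.comp (hL.pair (h0.pair (id w x T))) (.refl _)
  · refine comp (T' := fun _ => 0) ?_ (id _ _ _).fst (.zero _)
    refine ⟨1, fun _ => .isPair, fun j => ⟨1, by simp, ?_⟩⟩
    dsimp only
    split_ifs with h
    · rw [List.drop_eq_getElem_cons h]; exact .isPair_pair _ _
    · rw [List.drop_eq_nil_of_le (by omega)]; exact .isPair_int _
  · intro i n hn; simp only [if_pos hn]; norm_num
  · intro i; simp
  · have he : ∀ j : Idx fun i => (L i).length,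
        encodeList ((L j.1).drop j.2) =
          .pair ((L j.1).get j.2) (encodeList ((L j.1).drop (j.2 + 1))) := by
      intro j; rw [List.drop_eq_getElem_cons j.2.2]; rfl
    refine congr (x := fun j => .pair (.pair ((L j.1).get j.2) (encodeList ((L j.1).drop (j.2 + 1))))
      (.pair (st j.1 j.2) (x j.1))) ?_ (fun j => by simp only [he]) (fun _ => rfl)
    have hi := id (fun j : Idx fun i => (L i).length => w j.1) (fun j => .pair
      (.pair ((L j.1).get j.2) (encodeList ((L j.1).drop (j.2 + 1)))) (.pair (st j.1 j.2) (x j.1))) B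
    exact hi.fst.snd.pair ((hb.comp (hi.fst.fst.pair hi.snd) (.refl _)).pair hi.snd.snd)

theorem fold {el : ∀ i, Fin (N i) → Val}
    (hl : Computes w x (fun i => vec (el i)) T) (h0 : Computes w x (fun i => st i 0) T)
    (hb : Computes (fun j : Idx N => w j.1)
      (fun j => .pair (el j.1 j.2) (.pair (st j.1 j.2) (x j.1))) (fun j => st j.1 (j.2 + 1)) B)
    (hB : Dom (fun i => ∑ n, (B ⟨i, n⟩ + 1)) T) :
    Computes w x (fun i => st i (N i)) T := by
  have hlen : ∀ i, (List.ofFn (el i)).length = N i := fun i => List.length_ofFn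
  have := foldList (w := w) (x := x) (T := T) (st := st) (L := fun i => List.ofFn (el i))
    (B := fun j => B ⟨j.1, j.2.cast (hlen _)⟩) hl h0
    ((hb.restrict fun j : Idx fun i => (List.ofFn (el i)).length => ⟨j.1, j.2.cast (hlen _)⟩).congr
      (fun j => by simp; rfl) (fun j => by simp))
    (by
      refine (Dom.of_le fun i => le_of_eq ?_).trans hB
      exact Fintype.sum_equiv (finCongr (hlen i)) _ _ fun n => rfl)
  exact this.congr (fun _ => rfl) fun i => by simp [hlen]

/-- Lists grow only at the front, so a traversal produces its output backwards; this turns it round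
in linear time. -/
theorem reverse {L : ι → List Val} (hL : Computes w x (fun i => encodeList (L i)) T)
    (hT : Dom (fun i => (L i).length) T) :
    Computes w x (fun i => encodeList (L i).reverse) T := by
  have := foldList (w := w) (x := x) (T := T) (B := fun _ => 0) hL
    (st := fun i n => encodeList ((L i).take n).reverse) (const w x T 0) ?_ ?_
  · exact this.congr (fun _ => rfl) fun i => by simp
  · refine (head.pair (head (T := fun _ => 0)).tail).congr (fun _ => rfl) fun j => ?_
    rw [List.take_succ_eq_append_getElem j.2.2, List.reverse_append]
    rfl
  · simpa using hT

end Loops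

end Computes

/-! ### Programs on vectors: selection, maps, sums -/

/-- The positions at which a vector of integers is positive. -/
def posList {n : ℕ} (c : Fin n → ℤ) : List (Fin n) := (List.finRange n).filter fun k => 0 < c k

/-- The number of positions at which a vector of integers is positive. -/
def posCount {n : ℕ} (c : Fin n → ℤ) : ℕ := (posList c).length

/-- Enumeration of the positions at which a vector of integers is positive. -/
def posEnum {n : ℕ} (c : Fin n → ℤ) : Fin (posCount c) → Fin n := (posList c).get

theorem posEnum_injective {n : ℕ} (c : Fin n → ℤ) : Function.Injective (posEnum c) :=
  List.nodup_iff_injective_get.1 ((List.nodup_finRange n).filter _)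

theorem posEnum_pos {n : ℕ} (c : Fin n → ℤ) (k : Fin (posCount c)) : 0 < c (posEnum c k) := by
  exact of_decide_eq_true (List.mem_filter.1 ((posList c).get_mem k)).2

theorem exists_posEnum {n : ℕ} {c : Fin n → ℤ} {k : Fin n} (h : 0 < c k) : ∃ j, posEnum c j = k := by
  have : k ∈ posList c := List.mem_filter.2 ⟨List.mem_finRange k, by simpa using h⟩
  exact List.mem_iff_get.1 this

theorem posCount_le {n : ℕ} (c : Fin n → ℤ) : posCount c ≤ n := by
  simpa using Fintype.card_le_of_injective _ (posEnum_injective c)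

theorem vec_posEnum {n : ℕ} (c : Fin n → ℤ) (f : Fin n → Val) :
    vec (fun k => f (posEnum c k)) = encodeList ((posList c).map f) := by
  rw [vec]
  congr 1
  refine List.ext_get (by simp [posCount]) fun i h1 h2 => ?_
  simp [posEnum]
  rfl

namespace Dom

variable {ι : Type*} {N E : ι → ℕ}

theorem linear (hN : ∀ i, N i ≤ E i) : Dom (fun i => N i * (0 + 1)) E :=
  of_le fun i => by simpa using hN i

theorem square (hN : ∀ i, N i ≤ E i) : Dom (fun i => N i * (E i + 1)) (fun i => E i ^ 2) :=
  ⟨2, fun i => by nlinarith [hN i, sq_nonneg (E i - 1 : ℤ)]⟩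

theorem le_square (hN : ∀ i, N i ≤ E i) : Dom N (fun i => E i ^ 2) :=
  of_le fun i => (hN i).trans (Nat.le_self_pow two_ne_zero _)

theorem left_of_mul {b T : ι → ℕ} (h : Dom (fun i => N i * (b i + 1)) T) : Dom N T :=
  (of_le fun i => by nlinarith [Nat.zero_le (b i * N i)]).trans h

end Dom

namespace Computes

variable {ι : Type*} {w : ι → World} {x y z a : ι → Val} {T E : ι → ℕ} {N : ι → ℕ} {b : ι → ℕ}
  {el f g : ∀ i, Fin (N i) → Val} {st : ι → ℕ → Val}

theorem foldVec (hl : Computes w x (fun i => vec (el i)) T) (h0 : Computes w x (fun i => st i 0) T)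
    (hb : Computes (fun j : Idx N => w j.1)
      (fun j => .pair (el j.1 j.2) (.pair (st j.1 j.2) (x j.1))) (fun j => st j.1 (j.2 + 1))
      (fun j => b j.1))
    (hB : Dom (fun i => N i * (b i + 1)) T) : Computes w x (fun i => st i (N i)) T :=
  fold hl h0 hb (by simpa using hB)

/-- A traversal that emits one value per element and carries a state along. The state may also be
the rest of a second list, as in `zip`. -/
theorem mapAccum (hl : Computes w x (fun i => vec (el i)) T)
    (h0 : Computes w x (fun i => st i 0) T)
    (hb : Computes (fun j : Idx N => w j.1)
      (fun j => .pair (el j.1 j.2) (.pair (st j.1 j.2) (x j.1)))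
      (fun j => .pair (f j.1 j.2) (st j.1 (j.2 + 1))) (fun j => b j.1))
    (hB : Dom (fun i => N i * (b i + 1)) T) : Computes w x (fun i => vec (f i)) T := by
  have := foldVec (st := fun i n => .pair (st i n) (encodeList ((List.ofFn (f i)).take n).reverse))
    hl (h0.pair (const w x T 0)) ?_ hB
  · refine (this.snd.reverse ?_).congr (fun _ => rfl) fun i => ?_
    · simpa using Dom.left_of_mul hB
    · rw [List.take_of_length_le (by simp), List.reverse_reverse]; rfl
  · have h1 := hb.comp (T := fun j => b j.1) (x := fun j : Idx N => .pair (el j.1 j.2)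
      (.pair (.pair (st j.1 j.2) (encodeList ((List.ofFn (f j.1)).take j.2).reverse)) (x j.1)))
      (head.pair ((id _ _ _).snd.fst.fst.pair (id _ _ _).snd.snd)) (.refl _)
    refine (h1.snd.pair (h1.fst.pair (id _ _ _).snd.fst.snd)).congr (fun _ => rfl) fun j => ?_
    rw [List.take_succ_eq_append_getElem (by simp), List.reverse_append]
    simp [encodeList]

theorem map (hl : Computes w x (fun i => vec (el i)) T)
    (hb : Computes (fun j : Idx N => w j.1) (fun j => .pair (el j.1 j.2) (x j.1))
      (fun j => f j.1 j.2) (fun j => b j.1))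
    (hB : Dom (fun i => N i * (b i + 1)) T) : Computes w x (fun i => vec (f i)) T :=
  mapAccum (st := fun _ _ => .int 0) hl (const w x T 0)
    ((hb.comp (head.pair (id _ _ _).snd.snd) (.refl _)).pair (const _ _ _ 0)) hB

theorem zip (hf : Computes w x (fun i => vec (f i)) T) (hg : Computes w x (fun i => vec (g i)) T)
    (hN : Dom N T) : Computes w x (fun i => vec fun n => .pair (f i n) (g i n)) T := by
  refine mapAccum (st := fun i n => encodeList ((List.ofFn (g i)).drop n)) (b := fun _ => 0) hf
    (hg.congr (fun _ => rfl) fun _ => rfl) ?_ (by simpa using hN)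
  have he : ∀ j : Idx N, encodeList ((List.ofFn (g j.1)).drop j.2) =
      .pair (g j.1 j.2) (encodeList ((List.ofFn (g j.1)).drop (j.2 + 1))) := by
    intro j; rw [List.drop_eq_getElem_cons (by simp)]; simp [encodeList]
  simp only [he]
  exact (head.pair (id _ _ _).snd.fst.fst).pair (id _ _ _).snd.fst.snd

theorem sum {c : ∀ i, Fin (N i) → ℤ} (hl : Computes w x (fun i => vec (el i)) T)
    (hb : Computes (fun j : Idx N => w j.1) (fun j => .pair (el j.1 j.2) (x j.1))
      (fun j => .int (c j.1 j.2)) (fun j => b j.1))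
    (hB : Dom (fun i => N i * (b i + 1)) T) : Computes w x (fun i => .int (∑ n, c i n)) T := by
  have := foldVec (b := b)
    (st := fun i n => .int (∑ k ∈ Finset.range n, if h : k < N i then c i ⟨k, h⟩ else 0))
    hl (const w x T 0) ?_ hB
  · refine this.congr (fun _ => rfl) fun i => ?_
    simp [Finset.sum_range]
  · refine (add (id _ _ _).snd.fst (hb.comp (head.pair (id _ _ _).snd.snd) (.refl _))).congr
      (fun _ => rfl) fun j => ?_
    simp [Finset.sum_range_succ]

theorem length (hl : Computes w x (fun i => vec (el i)) T) (hN : Dom N T) :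
    Computes w x (fun i => .int (N i)) T :=
  (sum (c := fun _ _ => 1) (b := fun _ => 0) hl (const _ _ _ 1) (by simpa using hN)).congr
    (fun _ => rfl) fun i => by simp

theorem filter {c : ∀ i, Fin (N i) → ℤ} (hl : Computes w x (fun i => vec (el i)) T)
    (hb : Computes (fun j : Idx N => w j.1) (fun j => .pair (el j.1 j.2) (x j.1))
      (fun j => .int (c j.1 j.2)) (fun j => b j.1))
    (hB : Dom (fun i => N i * (b i + 1)) T) :
    Computes w x (fun i => vec fun k => el i (posEnum (c i) k)) T := by
  have := foldVec (b := b) (st := fun i n => encodeList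
      ((((List.finRange (N i)).take n).filter fun k => 0 < c i k).map (el i)).reverse)
    hl (const w x T 0) ?_ hB
  · refine (this.reverse (L := fun i =>
      ((((List.finRange (N i)).take (N i)).filter fun k => 0 < c i k).map (el i)).reverse) ?_).congr
      (fun _ => rfl) fun i => ?_
    · refine (Dom.of_le fun i => ?_).trans (Dom.left_of_mul hB)
      rw [List.length_reverse, List.length_map]
      exact (List.length_filter_le _ _).trans (by simp)
    · rw [List.reverse_reverse, List.take_of_length_le (by simp)]
      exact vec_posEnum _ _
  · refine (ite' (hb.comp (head.pair (id _ _ _).snd.snd) (.refl _))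
      (head.pair (id _ _ _).snd.fst) (id _ _ _).snd.fst).congr (fun _ => rfl) fun j => ?_
    rw [List.take_succ_eq_append_getElem (by simp), List.filter_append, List.map_append,
      List.reverse_append]
    by_cases h : 0 < c j.1 j.2 <;> simp [h, encodeList]

theorem range {n : ι → ℕ} (hn : Computes w x (fun i => .int (n i)) T) (hN : Dom n T) :
    Computes w x (fun i => vec fun k : Fin (n i) => .int (k : ℕ)) T := by
  -- Counting down from `n i` builds the list at its front in ascending order, without a reversal.
  have := loop (w := w) (N := n) (B := fun _ => 0) (T := T)
    (st := fun i m => .pair (.int (n i - m)) (encodeList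
      ((List.ofFn fun k : Fin (n i) => Val.int (k : ℕ)).drop (n i - m))))
    (c := fun i m => n i - m) (id _ _ _).fst (by intros; omega) (by simp) ?_ (by simpa using hN)
  · refine (this.snd.comp (x := x) (T := T) ?_ (.refl _)).congr (fun _ => rfl) fun i => ?_
    · exact (hn.pair (const w x T 0)).congr (fun _ => rfl) fun i => by
        simp [List.drop_eq_nil_of_le, encodeList]
    · simp [vec]
  · have h1 := sub (id _ _ _).fst (const (fun j : Idx n => w j.1) (fun j => Val.pair
      (.int (n j.1 - (j.2 : ℕ))) (encodeList ((List.ofFn fun k : Fin (n j.1) =>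
        Val.int (k : ℕ)).drop (n j.1 - j.2)))) (fun _ => 0) 1)
    refine (h1.pair (h1.pair (id _ _ _).snd)).congr (fun _ => rfl) fun j => ?_
    have h2 : n j.1 - (j.2 + 1 : ℕ) < n j.1 := by have := j.2.2; omega
    rw [List.drop_eq_getElem_cons (i := n j.1 - (j.2 + 1 : ℕ)) (by simpa using h2)]
    have h3 : n j.1 - (j.2 + 1 : ℕ) + 1 = n j.1 - j.2 := by have := j.2.2; omega
    have h4 : ((n j.1 - (j.2 + 1 : ℕ) : ℕ) : ℤ) = n j.1 - (j.2 : ℕ) - 1 := by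
      have := j.2.2; omega
    simp only [List.getElem_ofFn, encodeList, h3, h4]
    push_cast
    rw [sub_sub]

end Computes

/-! ### Integer matrices and their multiplication in quadratic time -/

/-- A vector of integers as a list. -/
def rowVal {n : ℕ} (v : Fin n → ℤ) : Val := vec fun j => .int (v j)

theorem encodeMatrix_eq {r c : ℕ} (A : Matrix (Fin r) (Fin c) ℤ) :
    encodeMatrix A = .pair (.int r) (.pair (.int c) (vec fun i => rowVal (A i))) := rfl

/-- The digits from position `n` on of a vector, as an integer in base `X`. -/
def packFrom {c : ℕ} (X : ℤ) (v : Fin c → ℤ) (n : ℕ) : ℤ :=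
  ∑ k ∈ Finset.range (c - n), (if h : n + k < c then v ⟨n + k, h⟩ else 0) * X ^ k

theorem packFrom_zero {c : ℕ} (X : ℤ) (v : Fin c → ℤ) : packFrom X v 0 = ∑ k, v k * X ^ (k : ℕ) := by
  simp [packFrom, Finset.sum_range]

theorem packFrom_succ {c : ℕ} (X : ℤ) (v : Fin c → ℤ) (n : Fin c) :
    packFrom X v n = v n + X * packFrom X v (n + 1) := by
  have h : c - (n : ℕ) = c - (n + 1) + 1 := by have := n.2; omega
  rw [packFrom, h, Finset.sum_range_succ', packFrom, Finset.mul_sum, add_comm]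
  congr 1
  · simp
  · refine Finset.sum_congr rfl fun k _ => ?_
    rw [add_assoc, add_comm 1 k, pow_succ]
    ring

/-- The digits lie between -H and H. Adding H moves the lowest one into the range of remainders
modulo 2H + 1, and floor division removes it exactly. -/
theorem packFrom_div {c : ℕ} {H : ℤ} {v : Fin c → ℤ} (hv : ∀ k, |v k| ≤ H) (n : Fin c) :
    (packFrom (2 * H + 1) v n + H) / (2 * H + 1) = packFrom (2 * H + 1) v (n + 1) := by
  have h := abs_le.1 (hv n)
  have hH : 0 ≤ H := (abs_nonneg _).trans (hv n)
  rw [packFrom_succ, add_right_comm, Int.add_mul_ediv_left _ _ (by omega),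
    Int.ediv_eq_zero_of_lt (by omega) (by omega), zero_add]

/-- A digit bound for packing the rows of a product that takes only quadratically many operations:
for integers |a| ≤ a², so sums of squares replace maxima of absolute values. -/
theorem abs_mul_apply_le {a b c : ℕ} (A : Matrix (Fin a) (Fin b) ℤ) (B : Matrix (Fin b) (Fin c) ℤ)
    (i : Fin a) (k : Fin c) :
    |(A * B) i k| ≤ (∑ i, ∑ j, A i j * A i j) * ∑ j, ∑ k, B j k * B j k := by
  have h1 : ∑ j, |A i j| ≤ ∑ i, ∑ j, A i j * A i j := by
    refine le_trans (Finset.sum_le_sum fun j _ => ?_) (Finset.single_le_sum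
      (f := fun i => ∑ j, A i j * A i j)
      (fun i _ => Finset.sum_nonneg fun j _ => mul_self_nonneg _) (Finset.mem_univ i))
    rw [← abs_mul_abs_self]
    rcases (abs_nonneg (A i j)).eq_or_lt with h | h
    · simp [← h]
    · nlinarith
  have h2 : ∀ j, |B j k| ≤ ∑ j, ∑ k, B j k * B j k := fun j => by
    have h3 : |B j k| ≤ B j k * B j k := by
      rw [← abs_mul_abs_self]
      rcases (abs_nonneg (B j k)).eq_or_lt with h | h
      · simp [← h]
      · nlinarith
    exact h3.trans ((Finset.single_le_sum (f := fun k => B j k * B j k)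
      (fun k _ => mul_self_nonneg _) (Finset.mem_univ k)).trans
      (Finset.single_le_sum (f := fun j => ∑ k, B j k * B j k)
      (fun j _ => Finset.sum_nonneg fun k _ => mul_self_nonneg _) (Finset.mem_univ j)))
  calc |(A * B) i k| ≤ ∑ j, |A i j * B j k| := by
        rw [Matrix.mul_apply]; exact Finset.abs_sum_le_sum_abs _ _
    _ ≤ ∑ j, |A i j| * ∑ j, ∑ k, B j k * B j k := by
        refine Finset.sum_le_sum fun j _ => ?_
        rw [abs_mul]
        exact mul_le_mul_of_nonneg_left (h2 j) (abs_nonneg _)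
    _ ≤ _ := by
        rw [← Finset.sum_mul]
        exact mul_le_mul_of_nonneg_right h1
          (Finset.sum_nonneg fun j _ => Finset.sum_nonneg fun k _ => mul_self_nonneg _)

namespace Computes

variable {ι : Type*} {w : ι → World} {x y z : ι → Val} {T E : ι → ℕ} {a b c : ι → ℕ}
  {A : ∀ i, Matrix (Fin (a i)) (Fin (b i)) ℤ} {B : ∀ i, Matrix (Fin (b i)) (Fin (c i)) ℤ}

theorem numRows (h : Computes w x (fun i => encodeMatrix (A i)) T) :
    Computes w x (fun i => .int (a i)) T := fst h

theorem numCols (h : Computes w x (fun i => encodeMatrix (A i)) T) :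
    Computes w x (fun i => .int (b i)) T := fst (snd h)

theorem rows (h : Computes w x (fun i => encodeMatrix (A i)) T) :
    Computes w x (fun i => vec fun k => rowVal (A i k)) T := snd (snd h)

theorem ofRows (ha : Computes w x (fun i => .int (a i)) T) (hb : Computes w x (fun i => .int (b i)) T)
    (h : Computes w x (fun i => vec fun k => rowVal (A i k)) T) :
    Computes w x (fun i => encodeMatrix (A i)) T := pair ha (pair hb h)

theorem dot {u v : ∀ i, Fin (a i) → ℤ} (hu : Computes w x (fun i => rowVal (u i)) T)
    (hv : Computes w x (fun i => rowVal (v i)) T) (hT : Dom a T) :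
    Computes w x (fun i => .int (∑ k, u i k * v i k)) T :=
  sum (b := fun _ => 0) (zip hu hv hT) (mul (id _ _ _).fst.fst (id _ _ _).fst.snd) (by simpa using hT)

theorem pack {v : ∀ i, Fin (a i) → ℤ} {X : ι → ℤ} (hv : Computes w x (fun i => rowVal (v i)) T)
    (hX : Computes w x (fun i => .int (X i)) T) (hT : Dom a T) :
    Computes w x (fun i => .int (∑ k, v i k * X i ^ (k : ℕ))) T := by
  have key := foldVec (w := w) (x := fun i => .pair (rowVal (v i)) (.int (X i))) (T := a)
    (b := fun _ => 0) (st := fun i n => .pair (.int (X i ^ n))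
      (.int (∑ k ∈ Finset.range n, (if h : k < a i then v i ⟨k, h⟩ else 0) * X i ^ k)))
    (id _ _ _).fst ((const _ _ _ 1).pair (const _ _ _ 0) |>.congr (fun _ => rfl) fun _ => by simp)
    ?_ (.linear fun _ => le_rfl)
  · refine (key.snd.comp (hv.pair hX) hT).congr (fun _ => rfl) fun i => ?_
    simp [Finset.sum_range]
  · refine ((mul (id _ _ _).snd.fst.fst (id _ _ _).snd.snd.snd).pair (add (id _ _ _).snd.fst.snd
      (mul (id _ _ _).fst (id _ _ _).snd.fst.fst))).congr (fun _ => rfl) fun j => ?_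
    simp [Finset.sum_range_succ, pow_succ]

theorem unpack {v : ∀ i, Fin (a i) → ℤ} {H : ι → ℤ} (hH : Computes w x (fun i => .int (H i)) T)
    (ha : Computes w x (fun i => .int (a i)) T)
    (hN : Computes w x (fun i => .int (∑ k, v i k * (2 * H i + 1) ^ (k : ℕ))) T)
    (hv : ∀ i k, |v i k| ≤ H i) (hT : Dom a T) : Computes w x (fun i => rowVal (v i)) T := by
  have key := mapAccum (w := w) (T := a) (b := fun _ => 0)
    (x := fun i => .pair (.int (∑ k, v i k * (2 * H i + 1) ^ (k : ℕ))) (.pair (.int (H i)) (.int (a i))))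
    (st := fun i n => .int (packFrom (2 * H i + 1) (v i) n)) (f := fun i k => .int (v i k))
    (range (n := a) (id _ _ _).snd.snd (.refl _))
    ((id _ _ _).fst.congr (fun _ => rfl) fun i => by rw [packFrom_zero]) ?_ (.linear fun _ => le_rfl)
  · exact key.comp (hN.pair (hH.pair ha)) hT
  -- The remaining digits are found first, by division; the current digit is what is left after
  -- subtracting them times the base.
  · refine bind (a := fun j : Idx a => .int (packFrom (2 * H j.1 + 1) (v j.1) (j.2 + 1))) ?_ ?_
    · refine (div (add (id _ _ _).snd.fst (id _ _ _).snd.snd.snd.fst) (add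
        (mul (const _ _ _ 2) (id _ _ _).snd.snd.snd.fst) (const _ _ _ 1))).congr (fun _ => rfl) ?_
      intro j
      rw [packFrom_div (hv j.1)]
    · refine (sub (id _ _ _).snd.snd.fst (mul (add (mul (const _ _ _ 2) (id _ _ _).snd.snd.snd.snd.fst)
        (const _ _ _ 1)) (id _ _ _).fst)).pair (id _ _ _).fst |>.congr (fun _ => rfl) fun j => ?_
      rw [packFrom_succ _ _ j.2]; simp

/-- The sum of an integer function of the entries of a matrix. -/
theorem sumEntries {f : ∀ i, Fin (a i) → Fin (b i) → ℤ} (ha : ∀ i, a i ≤ E i) (hb : ∀ i, b i ≤ E i)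
    (hf : Computes (fun j : Σ i, Fin (a i) × Fin (b i) => w j.1)
      (fun j => .int (A j.1 j.2.1 j.2.2)) (fun j => .int (f j.1 j.2.1 j.2.2)) (fun _ => 0)) :
    Computes w (fun i => encodeMatrix (A i)) (fun i => .int (∑ k, ∑ l, f i k l))
      (fun i => E i ^ 2) := by
  refine sum (b := E) (rows (id _ _ _)) ?_ (.square ha)
  refine sum (b := fun _ => 0) (head (a := fun j : Idx a => rowVal (A j.1 j.2))) ?_ (.linear fun j => hb _)
  exact (hf.restrict fun j : Idx fun j : Idx a => b j.1 => ⟨j.1.1, j.1.2, j.2⟩).comp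
    (id _ _ _).fst (.refl _)

theorem sumSquares (ha : ∀ i, a i ≤ E i) (hb : ∀ i, b i ≤ E i) :
    Computes w (fun i => encodeMatrix (A i)) (fun i => .int (∑ k, ∑ l, A i k l * A i k l))
      (fun i => E i ^ 2) :=
  sumEntries ha hb (mul (id _ _ _) (id _ _ _))

/-- Matrices are multiplied with quadratically many arithmetic operations: the rows of the second
factor are packed into single integers. -/
theorem matMul (ha : ∀ i, a i ≤ E i) (hb : ∀ i, b i ≤ E i) (hc : ∀ i, c i ≤ E i)
    (hA : Computes w x (fun i => encodeMatrix (A i)) T)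
    (hB : Computes w x (fun i => encodeMatrix (B i)) T) (hT : Dom (fun i => E i ^ 2) T) :
    Computes w x (fun i => encodeMatrix (A i * B i)) T := by
  refine comp (T' := fun i => E i ^ 2) ?_ (hA.pair hB) hT
  refine bind (a := fun i => .int ((∑ k, ∑ l, A i k l * A i k l) * ∑ k, ∑ l, B i k l * B i k l))
    (mul ((sumSquares ha hb).comp (id _ _ _).fst (.refl _))
      ((sumSquares hb hc).comp (id _ _ _).snd (.refl _))) ?_
  -- Each row of the second factor becomes one integer in base 2H + 1. The dot product of a row of
  -- the first factor with these integers is the packed row of the product, whose entries are at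
  -- most H in absolute value and can be read off.
  refine bind (a := fun i => rowVal fun k => ∑ l, B i k l *
    (2 * ((∑ k, ∑ l, A i k l * A i k l) * ∑ k, ∑ l, B i k l * B i k l) + 1) ^ (l : ℕ))
    (map (b := E) (el := fun i k => rowVal (B i k)) (rows (A := B) (id _ _ _).snd.snd) ?_ (.square hb)) ?_
  · exact pack (id _ _ _).fst (add (mul (const _ _ _ 2) (id _ _ _).snd.fst) (const _ _ _ 1))
      (.of_le fun j => hc _)
  refine ofRows (numRows (A := A) (id _ _ _).snd.snd.fst) (numCols (A := B) (id _ _ _).snd.snd.snd)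
    (map (b := E) (rows (A := A) (id _ _ _).snd.snd.fst) ?_ (.square ha))
  refine unpack (H := fun j => (∑ k, ∑ l, A j.1 k l * A j.1 k l) * ∑ k, ∑ l, B j.1 k l * B j.1 k l)
    (id _ _ _).snd.snd.fst (numCols (A := fun j : Idx a => B j.1) (id _ _ _).snd.snd.snd.snd) ?_
    (fun j k => abs_mul_apply_le _ _ _ _) (.of_le fun j => hc _)
  refine (dot (a := fun j : Idx a => b j.1) (id _ _ _).fst (id _ _ _).snd.fst
    (.of_le fun j => hb _)).congr (fun _ => rfl) fun j => ?_
  simp only [Matrix.mul_apply, Finset.sum_mul, Finset.mul_sum]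
  rw [Finset.sum_comm]
  simp only [mul_assoc]

end Computes

/-! ### Sizes of encodings and the quadratic lower bound for `S` -/

theorem encodeList_size_const (l : List Val) (s : ℕ) (h : ∀ v ∈ l, v.size = s) :
    (encodeList l).size = l.length * (s + 1) + 1 := by
  induction l with
  | nil => simp [encodeList, Val.size]
  | cons v l ih =>
    rw [encodeList, Val.size, ih fun u hu => h u (List.mem_cons_of_mem _ hu), h v List.mem_cons_self]
    simp; ring

theorem vec_size_const {n : ℕ} {f : Fin n → Val} {s : ℕ} (h : ∀ k, (f k).size = s) :
    (vec f).size = n * (s + 1) + 1 := by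
  rw [vec, encodeList_size_const _ s]
  · simp
  · intro v hv
    obtain ⟨k, rfl⟩ := (List.mem_ofFn' _ _).1 hv
    exact h k

theorem encodeMatrix_size {r c : ℕ} (A : Matrix (Fin r) (Fin c) ℤ) :
    (encodeMatrix A).size = r * (2 * c + 2) + 5 := by
  have h : ∀ i, (rowVal (A i)).size = 2 * c + 1 := fun i => by
    rw [rowVal, vec_size_const (s := 1) fun k => rfl]; ring
  rw [encodeMatrix_eq]
  simp only [Val.size]
  rw [vec_size_const h]
  ring

/-- Time includes the size of the input, and already the zero matrix of order n has more than n²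
nodes. -/
theorem World.sq_le_S (w : World) (n : ℕ) : n ^ 2 + 1 ≤ w.S n := by
  obtain ⟨U, D, W, -, h⟩ := w.smith n n 0
  obtain ⟨t, -, ht⟩ := h n le_rfl le_rfl
  rw [encodeMatrix_size] at ht
  nlinarith

/-! ### Saturated ranges and Smith normal form -/

/-- The range of an integer matrix is saturated: it contains every vector of which it contains a
nonzero multiple. -/
def SaturatedRange {r c : ℕ} (A : Matrix (Fin r) (Fin c) ℤ) : Prop :=
  ∀ (n : ℤ) (y : Fin r → ℤ) (x : Fin c → ℤ), n ≠ 0 → n • y = A.mulVec x → ∃ x', y = A.mulVec x'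

namespace IsSmithFactorization

open Matrix

variable {r c : ℕ} {A : Matrix (Fin r) (Fin c) ℤ} {U : Matrix (Fin r) (Fin r) ℤ}
  {D : Matrix (Fin r) (Fin c) ℤ} {W : Matrix (Fin c) (Fin c) ℤ}

theorem apply_eq_zero_of_ne (h : IsSmithFactorization A U D W) {i k : Fin r} {j : Fin c}
    (hD : D i j ≠ 0) (hk : k ≠ i) : D k j = 0 := by
  by_contra hne
  have h1 := mt (h.diagonal i j) hD
  have h2 := mt (h.diagonal k j) hne
  exact hk (Fin.ext (by omega))

theorem mul_transpose_apply (h : IsSmithFactorization A U D W) {i k : Fin r} (hk : k ≠ i) (j : Fin c) :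
    D i j * D k j = 0 := by
  by_cases hD : D i j = 0
  · rw [hD, zero_mul]
  · rw [h.apply_eq_zero_of_ne hD hk, mul_zero]

theorem sum_sq_eq (h : IsSmithFactorization A U D W) {i : Fin r} {j : Fin c} (hD : D i j ≠ 0) :
    ∑ j, D i j * D i j = D i j * D i j := by
  refine Finset.sum_eq_single j (fun k _ hk => ?_) (by simp)
  have h1 := mt (h.diagonal i j) hD
  rw [h.diagonal i k fun h2 => hk (Fin.ext (by omega)), zero_mul]

/-- If the left factor is the matrix itself, up to the other factors, its inverse can be read off. -/
theorem inv_mul {U' : Matrix (Fin r) (Fin r) ℤ} {D W A : Matrix (Fin r) (Fin r) ℤ}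
    (h : IsSmithFactorization A U' D W) (hA : IsUnit A) : W * (D * U') * A = 1 := by
  -- D is diagonal and invertible, so its diagonal entries are ±1 and D is its own inverse; hence
  -- A⁻¹ = W D⁻¹ U' = W D U'.
  have hD : IsUnit D := h.eq ▸ (h.unimodular_left.mul hA).mul h.unimodular_right
  have hd : ∀ i, D i i * D i i = 1 := by
    obtain ⟨E, hE⟩ := hD.exists_right_inv
    intro i
    have h1 : (D * E) i i = 1 := by rw [hE, one_apply_eq]
    rw [mul_apply, Finset.sum_eq_single i (fun k _ hk => by
      rw [h.diagonal i k fun h2 => hk (Fin.ext h2.symm), zero_mul]) (by simp)] at h1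
    have h2 := Int.isUnit_iff.1 (IsUnit.of_mul_eq_one _ h1)
    rcases h2 with h2 | h2 <;> simp [h2]
  have hDD : D * D = 1 := by
    ext i k
    rw [mul_apply, Finset.sum_eq_single i (fun l _ hl => by
      rw [h.diagonal i l fun h2 => hl (Fin.ext h2.symm), zero_mul]) (by simp)]
    by_cases hk : i = k
    · subst hk; rw [hd, one_apply_eq]
    · rw [h.diagonal i k fun h2 => hk (Fin.ext h2), one_apply_ne hk, mul_zero]
  have h1 : U' * (A * W * D) = 1 := by rw [← mul_assoc, ← mul_assoc, h.eq, hDD]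
  have h2 : A * (W * (D * U')) = 1 := by
    rw [← mul_assoc, ← mul_assoc]; exact mul_eq_one_comm.1 h1
  exact mul_eq_one_comm.1 h2

/-- The entries of the Smith normal form are at most `1` in absolute value if and only if the range
is saturated. -/
theorem exists_mulVec (h : IsSmithFactorization A U D W) (hD : ∀ i j, D i j * D i j ≤ 1)
    {y : Fin r → ℤ} (hy : ∀ i, (∀ j, D i j = 0) → (U *ᵥ y) i = 0) : ∃ x, y = A *ᵥ x := by
  -- With entries 0 and ±1 and orthogonal rows, D Dᵀ is the projection to the coordinates of the
  -- nonzero rows, and `U *ᵥ y` lives on these. So Dᵀ inverts D there.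
  refine ⟨W *ᵥ (Dᵀ *ᵥ (U *ᵥ y)), ?_⟩
  have h1 : D *ᵥ (Dᵀ *ᵥ (U *ᵥ y)) = U *ᵥ y := by
    rw [mulVec_mulVec]
    ext i
    rw [mulVec, dotProduct, Finset.sum_eq_single i]
    · rw [mul_apply]
      by_cases h0 : ∀ j, D i j = 0
      · rw [hy i h0, mul_zero]
      · push Not at h0
        obtain ⟨j, hj⟩ := h0
        simp only [transpose_apply]
        rw [h.sum_sq_eq hj, le_antisymm (hD i j) (Int.add_one_le_iff.2 (mul_self_pos.2 hj)), one_mul]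
    · intro k _ hk
      rw [mul_apply]
      simp only [transpose_apply]
      rw [Finset.sum_eq_zero fun j _ => h.mul_transpose_apply hk j, zero_mul]
    · simp
  have h2 : U *ᵥ y = U *ᵥ (A *ᵥ (W *ᵥ (Dᵀ *ᵥ (U *ᵥ y)))) := by
    rw [mulVec_mulVec _ A, mulVec_mulVec _ U, ← Matrix.mul_assoc, h.eq, h1]
  exact mulVec_injective_of_isUnit h.unimodular_left h2

theorem zero_row (h : IsSmithFactorization A U D W) {i : Fin r} (hi : ∀ j, D i j = 0) (j : Fin c) :
    (U * A) i j = 0 := by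
  obtain ⟨E, hE⟩ := h.unimodular_right.exists_right_inv
  have h1 : U * A = D * E := by rw [← h.eq, Matrix.mul_assoc, hE, Matrix.mul_one]
  rw [h1, mul_apply, Finset.sum_eq_zero fun k _ => by rw [hi, zero_mul]]

/-- A nonzero entry d at (i, j) gives d U⁻¹e_i = A W e_j. Saturation puts U⁻¹e_i in the range of A,
hence e_i in that of D, and d is a unit. Conversely, if a nonzero multiple of y lies in the range,
then U y vanishes at the zero rows of D, and `exists_mulVec` applies. The squared form of the
condition is a sign test. -/
theorem saturatedRange_iff (h : IsSmithFactorization A U D W) :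
    SaturatedRange A ↔ ∀ i j, D i j * D i j ≤ 1 := by
  constructor
  · intro hA i j
    by_cases hD : D i j = 0
    · simp [hD]
    obtain ⟨E, hE⟩ := h.unimodular_left.exists_right_inv
    obtain ⟨F, hF⟩ := h.unimodular_right.exists_right_inv
    have hcol : D *ᵥ Pi.single j 1 = D i j • Pi.single i 1 := by
      ext k
      by_cases hk : k = i
      · subst hk; simp
      · simp [hk, h.apply_eq_zero_of_ne hD hk]
    obtain ⟨x, hx⟩ := hA (D i j) (E *ᵥ Pi.single i 1) (W *ᵥ Pi.single j 1) hD (by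
      have h1 := mul_eq_one_comm.1 hE
      rw [← mulVec_smul, ← hcol, ← h.eq]
      simp only [mulVec_mulVec, ← Matrix.mul_assoc, h1, Matrix.one_mul])
    have h2 : Pi.single i 1 = D *ᵥ (F *ᵥ x) := by
      rw [mulVec_mulVec, ← h.eq, Matrix.mul_assoc, hF, Matrix.mul_one, ← mulVec_mulVec, ← hx, mulVec_mulVec, hE,
        one_mulVec]
    have h3 := congrFun h2 i
    rw [Pi.single_eq_same, mulVec, dotProduct, Finset.sum_eq_single j] at h3
    · rcases Int.isUnit_iff.1 (IsUnit.of_mul_eq_one _ h3.symm) with h4 | h4 <;> simp [h4]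
    · intro k _ hk
      have h1 := mt (h.diagonal i j) hD
      rw [h.diagonal i k fun h2 => hk (Fin.ext (by omega)), zero_mul]
    · simp
  · intro hD n y x hn hy
    refine h.exists_mulVec hD fun i hi => ?_
    have h1 : n * (U *ᵥ y) i = 0 := by
      have := congrFun (congrArg (U *ᵥ ·) hy) i
      simp only [mulVec_smul, mulVec_mulVec, Pi.smul_apply, smul_eq_mul] at this
      rw [this, mulVec, dotProduct, Finset.sum_eq_zero fun j _ => by rw [h.zero_row hi, zero_mul]]
    exact (mul_eq_zero.1 h1).resolve_left hn

end IsSmithFactorization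

namespace World

open Matrix

variable (w : World) {r c : ℕ} (A : Matrix (Fin r) (Fin c) ℤ)

/-- The left factor of the Smith factorization. -/
noncomputable def smithU : Matrix (Fin r) (Fin r) ℤ := (w.smith r c A).choose

/-- The diagonal matrix of the Smith factorization. -/
noncomputable def smithD : Matrix (Fin r) (Fin c) ℤ := (w.smith r c A).choose_spec.choose

/-- The right factor of the Smith factorization. -/
noncomputable def smithW : Matrix (Fin c) (Fin c) ℤ := (w.smith r c A).choose_spec.choose_spec.choose

theorem isSmithFactorization :
    IsSmithFactorization A (w.smithU A) (w.smithD A) (w.smithW A) :=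
  (w.smith r c A).choose_spec.choose_spec.choose_spec.1

theorem runsIn_snf {n : ℕ} (hr : r ≤ n) (hc : c ≤ n) :
    RunsIn w.ops w.snf (encodeMatrix A) (.pair (encodeMatrix (w.smithU A))
      (.pair (encodeMatrix (w.smithD A)) (encodeMatrix (w.smithW A)))) (w.S n) :=
  (w.smith r c A).choose_spec.choose_spec.choose_spec.2 n hr hc

/-- The inverse of the left factor, from a second Smith factorization. -/
noncomputable def smithInv : Matrix (Fin r) (Fin r) ℤ :=
  w.smithW (w.smithU A) * (w.smithD (w.smithU A) * w.smithU (w.smithU A))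

theorem smithInv_mul : w.smithInv A * w.smithU A = 1 :=
  (w.isSmithFactorization (w.smithU A)).inv_mul (w.isSmithFactorization A).unimodular_left

/-- The indicator of the zero rows of the Smith normal form (positive exactly at these). -/
noncomputable def zeroRow (i : Fin r) : ℤ := 1 - ∑ j, w.smithD A i j * w.smithD A i j

theorem zeroRow_pos_iff {i : Fin r} : 0 < w.zeroRow A i ↔ ∀ j, w.smithD A i j = 0 := by
  have h0 : 0 ≤ ∑ j, w.smithD A i j * w.smithD A i j := Finset.sum_nonneg fun j _ => mul_self_nonneg _
  have h1 : 0 < w.zeroRow A i ↔ ∑ j, w.smithD A i j * w.smithD A i j = 0 := by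
    rw [zeroRow]; omega
  rw [h1, Finset.sum_eq_zero_iff_of_nonneg fun j _ => mul_self_nonneg _]
  simp

/-- The rank of the free part of the cokernel. -/
noncomputable abbrev cokerRank : ℕ := posCount (w.zeroRow A)

/-- The projection to the free part of the cokernel. -/
noncomputable def cokerProj : Matrix (Fin (w.cokerRank A)) (Fin r) ℤ :=
  (w.smithU A).submatrix (posEnum (w.zeroRow A)) _root_.id

/-- A section of the projection to the free part of the cokernel. -/
noncomputable def cokerSec : Matrix (Fin r) (Fin (w.cokerRank A)) ℤ :=
  (w.smithInv A).submatrix _root_.id (posEnum (w.zeroRow A))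

theorem cokerRank_le : w.cokerRank A ≤ r := posCount_le _

theorem cokerProj_mul_cokerSec : w.cokerProj A * w.cokerSec A = 1 := by
  ext i j
  have h := congrArg (fun M => M (posEnum (w.zeroRow A) i) (posEnum (w.zeroRow A) j))
    (mul_eq_one_comm.1 (w.smithInv_mul A))
  simp only [mul_apply] at h ⊢
  refine Eq.trans h ?_
  rw [one_apply, one_apply]
  simp only [(posEnum_injective _).eq_iff]

theorem cokerProj_mul : w.cokerProj A * A = 0 := by
  ext i j
  exact (w.isSmithFactorization A).zero_row ((w.zeroRow_pos_iff A).1 (posEnum_pos _ i)) j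

/-- The kernel of the projection to the free part is the saturation of the range, so nothing is lost
when the range is saturated. -/
theorem exists_mulVec_of_cokerProj (hA : SaturatedRange A) {y : Fin r → ℤ}
    (hy : w.cokerProj A *ᵥ y = 0) : ∃ x, y = A *ᵥ x := by
  have h := w.isSmithFactorization A
  refine h.exists_mulVec (h.saturatedRange_iff.1 hA) fun i hi => ?_
  obtain ⟨k, rfl⟩ := exists_posEnum ((w.zeroRow_pos_iff A).2 hi)
  exact congrFun hy k

/-- The rows of `cokerProj` form a basis of the left kernel of A, with coordinates given by
`cokerSec`; no saturation is needed. From v A = 0 follows (v U⁻¹) D = 0, so v U⁻¹ is supported on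
the zero rows of D. Applied to a transpose, this computes ordinary kernels. -/
theorem eq_of_vecMul_eq_zero {v : Fin r → ℤ} (hv : v ᵥ* A = 0) :
    v = (v ᵥ* w.cokerSec A) ᵥ* w.cokerProj A := by
  have h := w.isSmithFactorization A
  have hu : ∀ i, i ∉ Set.range (posEnum (w.zeroRow A)) → (v ᵥ* w.smithInv A) i = 0 := by
    intro i hi
    have h1 : ¬ ∀ j, w.smithD A i j = 0 := fun h0 =>
      hi (exists_posEnum ((w.zeroRow_pos_iff A).2 h0))
    push Not at h1
    obtain ⟨j, hj⟩ := h1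
    have h2 : (v ᵥ* w.smithInv A) ᵥ* w.smithD A = 0 := by
      rw [← h.eq, vecMul_vecMul, ← Matrix.mul_assoc, ← Matrix.mul_assoc, smithInv_mul, Matrix.one_mul, ← vecMul_vecMul, hv,
        zero_vecMul]
    have h3 := congrFun h2 j
    rw [vecMul, dotProduct, Finset.sum_eq_single i (fun k _ hk => by
      rw [h.apply_eq_zero_of_ne hj hk, mul_zero]) (by simp)] at h3
    exact (mul_eq_zero.1 h3).resolve_right hj
  have h4 : v = (v ᵥ* w.smithInv A) ᵥ* w.smithU A := by
    rw [vecMul_vecMul, smithInv_mul, vecMul_one]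
  conv_lhs => rw [h4]
  ext j
  symm
  refine Fintype.sum_of_injective _ (posEnum_injective (w.zeroRow A)) _ _ ?_ ?_
  · intro i hi
    simp only
    rw [hu i hi, zero_mul]
  · intro k
    rfl

end World

/-! ### Programs for matrices and Smith factorizations -/

namespace Computes

variable {ι : Type*} {w : ι → World} {x y z : ι → Val} {T E : ι → ℕ} {a b : ι → ℕ}
  {A : ∀ i, Matrix (Fin (a i)) (Fin (b i)) ℤ}

/-- Selection of the rows of a matrix that carry a positive flag. -/
theorem selectRows {c : ∀ i, Fin (a i) → ℤ} (ha : ∀ i, a i ≤ E i)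
    (hc : Computes w x (fun i => rowVal (c i)) T) (hA : Computes w x (fun i => encodeMatrix (A i)) T)
    (hT : Dom E T) :
    Computes w x (fun i => encodeMatrix ((A i).submatrix (posEnum (c i)) _root_.id)) T := by
  have hN : Dom a T := (Dom.of_le ha).trans hT
  have hf := filter (c := c) (b := fun _ => 0) (zip hc hA.rows hN)
    (id _ _ _).fst.fst (by simpa using hN)
  have hs : Dom (fun i => posCount (c i)) T := (Dom.of_le fun i => posCount_le _).trans hN
  have hm := map (f := fun i k => rowVal (A i (posEnum (c i) k))) (b := fun _ => 0) hf
    (id _ _ _).fst.snd (by simpa using hs)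
  exact ofRows (hm.length hs) hA.numCols hm

/-- All columns are accumulated at once as reversed lists: each row that is read pushes one entry
onto each of them. -/
theorem transpose (ha : ∀ i, a i ≤ E i) (hb : ∀ i, b i ≤ E i)
    (hA : Computes w x (fun i => encodeMatrix (A i)) T) (hT : Dom (fun i => E i ^ 2) T) :
    Computes w x (fun i => encodeMatrix (A i).transpose) T := by
  refine comp (T' := fun i => E i ^ 2) ?_ hA hT
  have h0 : Computes w (fun i => encodeMatrix (A i)) (fun i => vec fun l : Fin (b i) => encodeList
      ((List.ofFn fun k => Val.int (A i k l)).take 0).reverse) (fun i => E i ^ 2) :=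
    map (b := fun _ => 0) (range (n := b) (numCols (A := A) (id _ _ _)) (.le_square hb))
      (const _ _ _ 0) (by simpa using Dom.le_square hb)
  have h1 := foldVec (b := E) (st := fun i n => vec fun l : Fin (b i) => encodeList
      ((List.ofFn fun k => Val.int (A i k l)).take n).reverse) (rows (A := A) (id _ _ _)) h0 ?_
      (.square ha)
  · refine ofRows (A := fun i => (A i).transpose) (numCols (A := A) (id _ _ _))
      (numRows (A := A) (id _ _ _)) ?_
    refine map (b := E) h1 ?_ (.square hb)
    refine ((head.reverse ?_).congr (fun _ => rfl) fun j => ?_)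
    · exact .of_le fun j => by simpa using ha j.1
    · rw [List.reverse_reverse, List.take_of_length_le (by simp)]; rfl
  · refine (zip (N := fun j : Idx a => b j.1) (id _ _ _).fst (id _ _ _).snd.fst
      (.of_le fun j => hb _)).congr (fun _ => rfl) fun j => ?_
    congr 1
    funext l
    rw [List.take_succ_eq_append_getElem (by simp), List.reverse_append]
    simp [encodeList]

theorem identity {n : ι → ℕ} (hn : ∀ i, n i ≤ E i) (h : Computes w x (fun i => .int (n i)) T)
    (hT : Dom (fun i => E i ^ 2) T) :
    Computes w x (fun i => encodeMatrix (1 : Matrix (Fin (n i)) (Fin (n i)) ℤ)) T := by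
  refine comp (T' := fun i => E i ^ 2) ?_ h hT
  refine ofRows (A := fun i => (1 : Matrix (Fin (n i)) (Fin (n i)) ℤ)) (id _ _ _) (id _ _ _)
    (map (b := E) (range (id _ _ _) (.le_square hn)) ?_ (.square hn))
  refine map (b := fun _ => 0) (range (n := fun j : Idx n => n j.1) (id _ _ _).snd (.of_le fun j => hn _))
    ?_ (.linear fun j => hn j.1)
  have hd := sub (id (fun j : Idx fun j : Idx n => n j.1 => w j.1.1)
    (fun j => .pair (.int (j.2 : ℕ)) (.pair (.int (j.1.2 : ℕ)) (.int (n j.1.1)))) fun _ => 0).fst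
    (id _ _ _).snd.fst
  -- Equality of indices by a sign test: 1 - (l - k)² is positive only for l = k.
  refine (ite' (sub (const _ _ _ 1) (mul hd hd)) (const _ _ _ 1) (const _ _ _ 0)).congr
    (fun _ => rfl) fun j => ?_
  rw [Matrix.one_apply]
  by_cases h : j.1.2 = j.2
  · rw [if_pos h, if_pos (by rw [h]; simp)]
  · have h1 : ((j.2 : ℕ) : ℤ) - (j.1.2 : ℕ) ≠ 0 := fun h2 => h (Fin.ext (by omega))
    rw [if_neg h, if_neg]
    have := mul_self_pos.2 h1
    omega

/-- The test whether all entries of a matrix satisfy a condition. -/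
theorem allEntries {p : ∀ i, Fin (a i) → Fin (b i) → Prop} {f : ∀ i, Fin (a i) → Fin (b i) → ℤ}
    (ha : ∀ i, a i ≤ E i) (hb : ∀ i, b i ≤ E i)
    (hf : Computes (fun j : Σ i, Fin (a i) × Fin (b i) => w j.1)
      (fun j => .int (A j.1 j.2.1 j.2.2)) (fun j => .int (f j.1 j.2.1 j.2.2)) (fun _ => 0))
    (hp : ∀ i k l, f i k l ≤ 0 ↔ p i k l)
    (hA : Computes w x (fun i => encodeMatrix (A i)) T) (hT : Dom (fun i => E i ^ 2) T) :
    Computes w x (fun i => .int (bit (∀ k l, p i k l))) T := by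
  have h := sumEntries (w := w) (A := A) (f := fun i k l => if 0 < f i k l then 1 else 0) ha hb
    ((ite' hf (const _ _ _ 1) (const _ _ _ 0)).congr (fun _ => rfl) fun j => by split_ifs <;> rfl)
  refine ((ite' h (const _ _ _ 0) (const _ _ _ 1)).comp hA hT).congr (fun _ => rfl) fun i => ?_
  have h1 : ∀ k l, (0 : ℤ) ≤ if 0 < f i k l then 1 else 0 := fun k l => by split_ifs <;> norm_num
  have h2 : (0 < ∑ k, ∑ l, if 0 < f i k l then (1 : ℤ) else 0) ↔ ¬ ∀ k l, p i k l := by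
    rw [(Finset.sum_nonneg fun k _ => Finset.sum_nonneg fun l _ => h1 k l).lt_iff_ne', not_iff_not,
      Finset.sum_eq_zero_iff_of_nonneg fun k _ => Finset.sum_nonneg fun l _ => h1 k l]
    simp only [Finset.mem_univ, true_imp_iff]
    refine forall_congr' fun k => ?_
    rw [Finset.sum_eq_zero_iff_of_nonneg fun l _ => h1 k l]
    simp only [Finset.mem_univ, true_imp_iff]
    refine forall_congr' fun l => ?_
    rw [← hp i k l]
    simp
  rw [bit]
  by_cases hq : ∀ k l, p i k l
  · rw [if_pos hq, if_neg (by rw [h2]; exact not_not.2 hq)]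
  · rw [if_neg hq, if_pos (h2.2 hq)]

/-- The only place where the given program is called. Its cost enters with constant 1, so no implied
constant depends on it. -/
theorem snf (ha : ∀ i, a i ≤ E i) (hb : ∀ i, b i ≤ E i)
    (hA : Computes w x (fun i => encodeMatrix (A i)) T) (hT : Dom (fun i => (w i).S (E i)) T) :
    Computes w x (fun i => .pair (encodeMatrix ((w i).smithU (A i)))
      (.pair (encodeMatrix ((w i).smithD (A i))) (encodeMatrix ((w i).smithW (A i))))) T := by
  refine comp (T' := fun i => (w i).S (E i)) ⟨1, fun s => s, fun i => ?_⟩ hA hT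
  obtain ⟨t, ht, hs⟩ := (w i).runsIn_snf (A i) (ha i) (hb i)
  exact ⟨t, by change t ≤ 1 * ((w i).S (E i) + 1); omega, ht⟩

theorem _root_.Dom.sq_S (w : ι → World) (E : ι → ℕ) :
    Dom (fun i => E i ^ 2) (fun i => (w i).S (E i)) :=
  .of_le fun i => by have := (w i).sq_le_S (E i); omega

theorem saturated (ha : ∀ i, a i ≤ E i) (hb : ∀ i, b i ≤ E i)
    (hA : Computes w x (fun i => encodeMatrix (A i)) T) (hT : Dom (fun i => (w i).S (E i)) T) :
    Computes w x (fun i => .int (bit (SaturatedRange (A i)))) T := by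
  simp only [fun i => ((w i).isSmithFactorization (A i)).saturatedRange_iff]
  refine allEntries ha hb (A := fun i => (w i).smithD (A i))
    (f := fun i k l => (w i).smithD (A i) k l * (w i).smithD (A i) k l - 1)
    (sub (mul (id _ _ _) (id _ _ _)) (const _ _ _ 1)) (fun i k l => by omega)
    (snf ha hb hA hT).snd.fst ((Dom.sq_S w E).trans hT)

/-- Two Smith runs, the second on the left factor of the first to invert it, and a bounded number of
quadratic operations. -/
theorem cokerSplitting (ha : ∀ i, a i ≤ E i) (hb : ∀ i, b i ≤ E i)
    (hA : Computes w x (fun i => encodeMatrix (A i)) T) (hT : Dom (fun i => (w i).S (E i)) T) :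
    Computes w x (fun i => .pair (encodeMatrix ((w i).cokerProj (A i)))
      (encodeMatrix ((w i).cokerSec (A i)))) T := by
  refine comp (T' := fun i => (w i).S (E i)) ?_ hA hT
  have hsq := Dom.sq_S w E
  have hE : Dom E (fun i => (w i).S (E i)) := (Dom.le_square fun _ => le_rfl).trans hsq
  refine bind (snf ha hb (id _ _ _) (.refl _)) ?_
  refine bind (snf (A := fun i => (w i).smithU (A i)) ha ha (id _ _ _).fst.fst (.refl _)) ?_
  have hflag := map (w := w) (f := fun i k => .int ((w i).zeroRow (A i) k)) (b := E)
    (T := fun i => E i ^ 2) (rows (A := fun i => (w i).smithD (A i)) (id _ _ _))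
    (sub (const _ _ _ 1) (dot (id _ _ _).fst (id _ _ _).fst (.of_le fun j => hb _))) (.square ha)
  refine bind (a := fun i => rowVal ((w i).zeroRow (A i)))
    (hflag.comp (id _ _ _).snd.fst.snd.fst hsq) ?_
  have hinv := matMul (A := fun i => (w i).smithW ((w i).smithU (A i))) ha ha ha
    (id (fun i => w i) (fun i => .pair (rowVal ((w i).zeroRow (A i)))
      (.pair (.pair (encodeMatrix ((w i).smithU ((w i).smithU (A i))))
        (.pair (encodeMatrix ((w i).smithD ((w i).smithU (A i))))
          (encodeMatrix ((w i).smithW ((w i).smithU (A i))))))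
        (.pair (.pair (encodeMatrix ((w i).smithU (A i)))
          (.pair (encodeMatrix ((w i).smithD (A i))) (encodeMatrix ((w i).smithW (A i)))))
          (encodeMatrix (A i))))) fun i => (w i).S (E i)).snd.fst.snd.snd
    (matMul ha ha ha (A := fun i => (w i).smithD ((w i).smithU (A i)))
      (B := fun i => (w i).smithU ((w i).smithU (A i)))
      (id _ _ _).snd.fst.snd.fst (id _ _ _).snd.fst.fst hsq) hsq
  have h1 := selectRows (A := fun i => (w i).smithU (A i)) ha (id (fun i => w i) (fun i =>
      .pair (rowVal ((w i).zeroRow (A i)))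
      (.pair (.pair (encodeMatrix ((w i).smithU ((w i).smithU (A i))))
        (.pair (encodeMatrix ((w i).smithD ((w i).smithU (A i))))
          (encodeMatrix ((w i).smithW ((w i).smithU (A i))))))
        (.pair (.pair (encodeMatrix ((w i).smithU (A i)))
          (.pair (encodeMatrix ((w i).smithD (A i))) (encodeMatrix ((w i).smithW (A i)))))
          (encodeMatrix (A i))))) fun i => (w i).S (E i)).fst
      (id _ _ _).snd.snd.fst.fst hE
  have h2 := transpose (fun i => (posCount_le _).trans (ha i)) ha
    (selectRows ha (id _ _ _).fst (transpose ha ha hinv hsq) hE) hsq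
  exact h1.pair h2

end Computes

/-! ### Interval bases from saturated images -/

section Intervals

variable {R : Type} [CommRing R]

/-- A submodule contains every vector of which it contains a nonzero multiple. -/
def IsSaturated {M : Type} [AddCommGroup M] [Module R M] (N : Submodule R M) : Prop :=
  ∀ (n : R) (y : M), n ≠ 0 → n • y ∈ N → y ∈ N

theorem free_quotient_iff [IsDomain R] [IsPrincipalIdealRing R] {M : Type} [AddCommGroup M]
    [Module R M] [Module.Finite R M] (N : Submodule R M) :
    Module.Free R (M ⧸ N) ↔ IsSaturated N := by
  constructor
  · intro h n y hn hy
    rw [← Submodule.Quotient.mk_eq_zero, Submodule.Quotient.mk_smul] at hy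
    exact (Submodule.Quotient.mk_eq_zero N).1 ((smul_eq_zero_iff_right hn).1 hy)
  · intro h
    have : Module.IsTorsionFree R (M ⧸ N) := by
      refine Module.isTorsionFree_iff_smul_eq_zero.2 fun n y hy => ?_
      obtain ⟨y, rfl⟩ := Submodule.Quotient.mk_surjective _ y
      by_cases hn : n = 0
      · exact .inl hn
      · rw [← Submodule.Quotient.mk_smul, Submodule.Quotient.mk_eq_zero] at hy
        exact .inr ((Submodule.Quotient.mk_eq_zero N).2 (h n y hn hy))
    exact Module.free_of_finite_type_torsion_free'

/-- A member of a basis of `K` is primitive in `K`, and saturation of `K` makes it primitive in `M`.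
-/
theorem exists_primitive [IsDomain R] [IsPrincipalIdealRing R] {M : Type} [AddCommGroup M]
    [Module R M] [Module.Finite R M] [Module.IsTorsionFree R M] {K : Submodule R M} (hK : K ≠ ⊥)
    (hs : IsSaturated K) : ∃ x ∈ K, x ≠ 0 ∧ IsSaturated (R ∙ x) := by
  have : Module.Free R K := Module.free_of_finite_type_torsion_free'
  have : Nontrivial K := Submodule.nontrivial_iff_ne_bot.2 hK
  let β := Module.Free.chooseBasis R K
  obtain ⟨k⟩ := β.index_nonempty
  refine ⟨β k, (β k).2, fun h => β.ne_zero k (Subtype.ext h), fun n y hn hy => ?_⟩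
  obtain ⟨c, hc⟩ := Submodule.mem_span_singleton.1 hy
  have hyK : y ∈ K := hs n y hn (hc ▸ K.smul_mem c (β k).2)
  have h1 : n • (⟨y, hyK⟩ : K) = c • β k := Subtype.ext hc.symm
  refine Submodule.mem_span_singleton.2 ⟨β.repr ⟨y, hyK⟩ k, ?_⟩
  have h2 : β.repr ⟨y, hyK⟩ k • β k = (⟨y, hyK⟩ : K) := by
    refine β.ext_elem fun j => ?_
    by_cases hj : j = k
    · subst hj; simp
    · have h3 := congrArg (fun z => β.repr z j) h1
      simp only [map_smul, Finsupp.smul_apply, Module.Basis.repr_self, smul_eq_mul,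
        Finsupp.single_eq_of_ne hj, mul_zero] at h3
      rw [(mul_eq_zero.1 h3).resolve_left hn, map_smul]
      simp [Finsupp.single_eq_of_ne hj]
  exact congrArg Subtype.val h2

variable {m : ℕ} (F : PersistenceModule R m)

/-- The structure map of a persistence module. -/
abbrev structureMap {a b : Fin (m + 1)} (h : a ≤ b) : F.obj a →ₗ[R] F.obj b := (F.map (homOfLE h)).hom

theorem structureMap_comp {a b c : Fin (m + 1)} (h : a ≤ b) (h' : b ≤ c) (x : F.obj a) :
    structureMap F h' (structureMap F h x) = structureMap F (h.trans h') x := by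
  have : F.map (homOfLE (h.trans h')) = F.map (homOfLE h) ≫ F.map (homOfLE h') := by
    rw [← F.map_comp]; rfl
  simp only [structureMap, this]
  rfl

theorem structureMap_self {a : Fin (m + 1)} (h : a ≤ a) (x : F.obj a) : structureMap F h x = x := by
  have : F.map (homOfLE h) = 𝟙 _ := F.map_id a
  simp only [structureMap, this]
  rfl

/-- Generators `v t` of intervals `[b t, d t)` which form bases of all modules `F_j`. -/
def HasIntervalBasis : Prop :=
  ∃ (κ : Type) (_ : Fintype κ) (b d : κ → ℕ) (v : κ → ∀ j, F.obj j),
    (∀ t, b t < d t ∧ d t ≤ m) ∧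
    (∀ t (j : Fin (m + 1)), ¬ (b t ≤ j.1 ∧ j.1 < d t) → v t j = 0) ∧
    (∀ t (i j : Fin (m + 1)) (h : i ≤ j), b t ≤ i.1 → structureMap F h (v t i) = v t j) ∧
    (∀ j (y : F.obj j), ∃ c : κ → R, y = ∑ t, c t • v t j) ∧
    ∀ j (c : κ → R), ∑ t, c t • v t j = 0 → ∀ t, b t ≤ j.1 → j.1 < d t → c t = 0

/-- The quotient of a persistence module. -/
def quotientModule (L : ∀ j, Submodule R (F.obj j))
    (hL : ∀ i j (f : i ⟶ j), L i ≤ (L j).comap (F.map f).hom) : PersistenceModule R m where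
  obj j := ModuleCat.of R (F.obj j ⧸ L j)
  map {i j} f := ModuleCat.ofHom ((L i).mapQ (L j) (F.map f).hom (hL i j f))
  map_id i := by
    refine ModuleCat.hom_ext (LinearMap.ext fun x => ?_)
    obtain ⟨x, rfl⟩ := Submodule.Quotient.mk_surjective _ x
    simp
  map_comp f g := by
    refine ModuleCat.hom_ext (LinearMap.ext fun x => ?_)
    obtain ⟨x, rfl⟩ := Submodule.Quotient.mk_surjective _ x
    simp

/-- The elements `u j` generate an interval born at the first nonzero index. Any interval of the
quotient born at b ≥ s lifts: a lift of its generator may at its death be a multiple of u instead of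
0, but this multiple is the image of the same multiple of u at b and can be subtracted there. -/
theorem hasIntervalBasis_of_quotient [IsDomain R] [∀ j, Module.IsTorsionFree R (F.obj j)]
    {s i : Fin (m + 1)} (hsi : s < i) (hs : ∀ j < s, Subsingleton (F.obj j))
    {x : F.obj s} (hx0 : x ≠ 0)
    (hxi : structureMap F hsi.le x = 0)
    (hinj : ∀ j (h : s ≤ j), j < i → Function.Injective (structureMap F h))
    (u : ∀ j, F.obj j) (hu : ∀ j (h : s ≤ j), u j = structureMap F h x)
    (hu' : ∀ j, ¬ s ≤ j → u j = 0)
    (hL : ∀ i j (f : i ⟶ j), (R ∙ u i) ≤ (R ∙ u j).comap (F.map f).hom)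
    (hF : HasIntervalBasis (quotientModule F (fun j => R ∙ u j) hL)) : HasIntervalBasis F := by
  obtain ⟨κ, _, b, d, v, hbd, hv0, hv, hspan, hind⟩ := hF
  have hdm := i.2
  have huij : ∀ (j k : Fin (m + 1)) (h : j ≤ k), s ≤ j → structureMap F h (u j) = u k := by
    intro j k h hj
    rw [hu j hj, hu k (hj.trans h), structureMap_comp]
  have hui : ∀ j, i ≤ j → u j = 0 := by
    intro j hj
    have hui : u i = 0 := by rw [hu i hsi.le, hxi]
    rw [← huij i j hj hsi.le, hui, map_zero]
  have hlift : ∀ t, ∃ y : F.obj ⟨b t, by have := hbd t; omega⟩,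
      Submodule.Quotient.mk y = v t ⟨b t, by have := hbd t; omega⟩ ∧
      structureMap F (show (⟨b t, by have := hbd t; omega⟩ : Fin (m + 1)) ≤
        ⟨d t, by have := hbd t; omega⟩ from (hbd t).1.le) y = 0 := by
    intro t
    have hb : b t < m + 1 := by have := hbd t; omega
    have hd : d t < m + 1 := by have := hbd t; omega
    have hle : (⟨b t, hb⟩ : Fin (m + 1)) ≤ ⟨d t, hd⟩ := (hbd t).1.le
    obtain ⟨y, hy⟩ := Submodule.Quotient.mk_surjective _ (v t ⟨b t, hb⟩)
    have h1 : (Submodule.Quotient.mk (structureMap F hle y) : F.obj ⟨d t, hd⟩ ⧸ (R ∙ u ⟨d t, hd⟩)) =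
        0 := by
      have h2 := hv t ⟨b t, hb⟩ ⟨d t, hd⟩ hle le_rfl
      rw [hv0 t ⟨d t, hd⟩ (by simp), ← hy] at h2
      exact h2
    obtain ⟨c, hc⟩ := Submodule.mem_span_singleton.1 ((Submodule.Quotient.mk_eq_zero _).1 h1)
    -- The correction by `c • u` does not change the class and kills the image at `d t`.
    refine ⟨y - c • u ⟨b t, hb⟩, ?_, ?_⟩
    · refine Eq.trans ((Submodule.Quotient.eq _).2 ?_) hy
      rw [sub_sub_cancel_left]
      exact neg_mem (Submodule.smul_mem _ _ (Submodule.mem_span_singleton_self _))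
    · rw [map_sub, map_smul]
      by_cases hsb : s ≤ ⟨b t, hb⟩
      · rw [huij _ _ _ hsb, hc, sub_self]
      -- Before index s the module is zero, so the lift is zero as well.
      · have := hs ⟨b t, hb⟩ (not_le.1 hsb)
        rw [Subsingleton.elim y 0, Subsingleton.elim (u ⟨b t, hb⟩) 0]
        simp
  choose y hy hyd using hlift
  have hb : ∀ t, b t < m + 1 := fun t => by have := hbd t; omega
  have hd : ∀ t, d t < m + 1 := fun t => by have := hbd t; omega
  let v' : κ → ∀ j, F.obj j := fun t j =>
    if h : (⟨b t, hb t⟩ : Fin (m + 1)) ≤ j then structureMap F h (y t) else 0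
  have hv'0 : ∀ t (j : Fin (m + 1)), ¬ (b t ≤ j.1 ∧ j.1 < d t) → v' t j = 0 := by
    intro t j hj
    by_cases h : (⟨b t, hb t⟩ : Fin (m + 1)) ≤ j
    · have h2 : (⟨d t, hd t⟩ : Fin (m + 1)) ≤ j := by
        have h3 : b t ≤ j.1 := h
        change d t ≤ j.1
        omega
      simp only [v', dif_pos h]
      rw [← structureMap_comp F (show (⟨b t, hb t⟩ : Fin (m + 1)) ≤ ⟨d t, hd t⟩ from (hbd t).1.le) h2,
        hyd, map_zero]
    · simp only [v', dif_neg h]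
  have hv' : ∀ t (i j : Fin (m + 1)) (h : i ≤ j), b t ≤ i.1 →
      structureMap F h (v' t i) = v' t j := by
    intro t i j h hbi
    have h1 : (⟨b t, hb t⟩ : Fin (m + 1)) ≤ i := hbi
    simp only [v', dif_pos h1, dif_pos (h1.trans h)]
    rw [structureMap_comp]
  have hmk : ∀ t j, (Submodule.Quotient.mk (v' t j) : F.obj j ⧸ (R ∙ u j)) = v t j := by
    intro t j
    by_cases h : (⟨b t, hb t⟩ : Fin (m + 1)) ≤ j
    · simp only [v', dif_pos h]
      have h2 := hv t ⟨b t, hb t⟩ j h le_rfl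
      rw [← hy] at h2
      exact h2
    · rw [hv'0 t j fun h2 => h h2.1, hv0 t j fun h2 => h h2.1]
      rfl
  have hsum : ∀ j (c : κ → R), (Submodule.Quotient.mk (∑ t, c t • v' t j) : F.obj j ⧸ (R ∙ u j)) =
      ∑ t, c t • v t j := by
    intro j c
    rw [← Submodule.mkQ_apply, map_sum]
    refine Finset.sum_congr rfl fun t _ => ?_
    rw [map_smul, Submodule.mkQ_apply, hmk]
    rfl
  refine ⟨Option κ, inferInstance, fun o => o.elim s b, fun o => o.elim i d,
    fun o => o.elim u v', ?_, ?_, ?_, ?_, ?_⟩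
  · rintro (_ | t)
    · exact ⟨hsi, by simp only [Option.elim]; omega⟩
    · exact hbd t
  · rintro (_ | t) j hj
    · simp only [Option.elim] at hj ⊢
      by_cases h : s ≤ j
      · exact hui j (not_lt.1 fun h2 => hj ⟨h, h2⟩)
      · exact hu' j h
    · exact hv'0 t j hj
  · rintro (_ | t) j k h hj
    · exact huij j k h hj
    · exact hv' t j k h hj
  · intro j z
    obtain ⟨c, hc⟩ := hspan j (Submodule.Quotient.mk z)
    have h1 : z - ∑ t, c t • v' t j ∈ (R ∙ u j) := by
      rw [← Submodule.Quotient.mk_eq_zero, Submodule.Quotient.mk_sub, hsum]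
      exact sub_eq_zero.2 hc
    obtain ⟨a, ha⟩ := Submodule.mem_span_singleton.1 h1
    refine ⟨fun o => o.elim a c, ?_⟩
    simp only [Fintype.sum_option, Option.elim]
    rw [ha, sub_add_cancel]
  · intro j c hc
    simp only [Fintype.sum_option, Option.elim] at hc
    -- Modulo u the relation involves only the old generators; once these are gone, injectivity up
    -- to i and torsion-freeness settle the coefficient of u.
    have h1 : ∑ t, c (some t) • v t j = 0 := by
      rw [← hsum j fun t => c (some t)]
      refine (Submodule.Quotient.mk_eq_zero _).2 ?_
      rw [← neg_eq_of_add_eq_zero_right hc]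
      exact neg_mem (Submodule.smul_mem _ _ (Submodule.mem_span_singleton_self _))
    have h2 := hind j _ h1
    rintro (_ | t) hb hd
    · simp only [Option.elim] at hb hd
      have h3 : ∑ t, c (some t) • v' t j = 0 := by
        refine Finset.sum_eq_zero fun t _ => ?_
        by_cases h : b t ≤ j.1 ∧ j.1 < d t
        · rw [h2 t h.1 h.2, zero_smul]
        · rw [hv'0 t j h, smul_zero]
      rw [h3, add_zero, hu j hb, ← map_smul] at hc
      have h4 := hinj j hb hd (hc.trans (map_zero _).symm)
      exact (smul_eq_zero.1 h4).resolve_right hx0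
    · exact h2 t hb hd

/-- Induction on the total rank. The interval to be split off starts at the first nonzero index s
and ends at the first i where the map from s has a kernel; its generator is a primitive vector x of
this kernel. Saturated images make the orbit of x saturated everywhere, so the quotient is again
free, and its images are again saturated. -/
theorem hasIntervalBasis_of_saturated [IsDomain R] [IsPrincipalIdealRing R] (N : ℕ) :
    ∀ (F : PersistenceModule R m) [∀ j, Module.Finite R (F.obj j)]
      [∀ j, Module.IsTorsionFree R (F.obj j)], Subsingleton (F.obj (Fin.last m)) →
      (∀ (a b : Fin (m + 1)) (h : a ≤ b), IsSaturated (LinearMap.range (structureMap F h))) →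
      ∑ j, Module.finrank R (F.obj j) ≤ N → HasIntervalBasis F := by
  induction N with
  | zero =>
    intro F _ _ _ _ hN
    have hsub : ∀ j, Subsingleton (F.obj j) := by
      intro j
      by_contra h
      rw [not_subsingleton_iff_nontrivial] at h
      have h1 := Module.finrank_pos (R := R) (M := F.obj j)
      have h2 := Finset.single_le_sum (f := fun j => Module.finrank R (F.obj j))
        (fun _ _ => Nat.zero_le _) (Finset.mem_univ j)
      omega
    exact ⟨Empty, inferInstance, Empty.elim, Empty.elim, fun t => t.elim, fun t => t.elim,
      fun t => t.elim, fun t => t.elim, fun j y => ⟨Empty.elim, Subsingleton.elim _ _⟩,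
      fun j c _ t => t.elim⟩
  | succ N ih =>
    intro F _ _ hlast hsat hN
    by_cases hall : ∀ j, Subsingleton (F.obj j)
    · exact ⟨Empty, inferInstance, Empty.elim, Empty.elim, fun t => t.elim, fun t => t.elim,
        fun t => t.elim, fun t => t.elim, fun j y => ⟨Empty.elim, Subsingleton.elim _ _⟩,
        fun j c _ t => t.elim⟩
    push Not at hall
    obtain ⟨s, hs, hsmin⟩ := WellFounded.has_min (wellFounded_lt (α := Fin (m + 1)))
      {j | Nontrivial (F.obj j)} hall
    have hs0 : ∀ j < s, Subsingleton (F.obj j) := fun j hj =>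
      not_nontrivial_iff_subsingleton.1 fun h => hsmin j h hj
    have hs' : Nontrivial (F.obj s) := hs
    -- Such an index exists because the last module is zero while the one at s is not.
    obtain ⟨i, ⟨hsi, hi⟩, himin⟩ := WellFounded.has_min (wellFounded_lt (α := Fin (m + 1)))
      {j | ∃ h : s ≤ j, LinearMap.ker (structureMap F h) ≠ ⊥} ⟨Fin.last m, Fin.le_last s, by
        rw [LinearMap.ker_eq_top.2 (LinearMap.ext fun x => Subsingleton.elim _ _)]
        exact top_ne_bot⟩
    have hinj : ∀ j (h : s ≤ j), j < i → Function.Injective (structureMap F h) := fun j h hj =>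
      LinearMap.ker_eq_bot.1 (not_not.1 fun h2 => himin j ⟨h, h2⟩ hj)
    have hsi' : s < i := by
      refine lt_of_le_of_ne hsi fun h => ?_
      subst h
      exact hi (LinearMap.ker_eq_bot'.2 fun x hx => by rwa [structureMap_self] at hx)
    obtain ⟨x, hxi, hx0, hxs⟩ := exists_primitive hi fun n y hn hy => by
      rw [LinearMap.mem_ker, map_smul] at hy
      exact LinearMap.mem_ker.2 ((smul_eq_zero_iff_right hn).1 hy)
    let u : ∀ j, F.obj j := fun j => if h : s ≤ j then structureMap F h x else 0
    have hu : ∀ j (h : s ≤ j), u j = structureMap F h x := fun j h => dif_pos h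
    have hu' : ∀ j, ¬ s ≤ j → u j = 0 := fun j h => dif_neg h
    have hmap : ∀ (j k : Fin (m + 1)) (h : j ≤ k), s ≤ j → structureMap F h (u j) = u k := by
      intro j k h hj
      rw [hu j hj, hu k (hj.trans h), structureMap_comp]
    have hL : ∀ i j (f : i ⟶ j), (R ∙ u i) ≤ (R ∙ u j).comap (F.map f).hom := by
      intro j k f
      rw [Submodule.span_singleton_le_iff_mem, Submodule.mem_comap]
      by_cases h : s ≤ j
      · have h2 : (F.map f).hom (u j) = u k := hmap j k (leOfHom f) h
        rw [h2]
        exact Submodule.mem_span_singleton_self _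
      · rw [hu' j h, map_zero]
        exact zero_mem _
    have hLs : ∀ j, IsSaturated (R ∙ u j) := by
      intro j n y hn hy
      by_cases h : s ≤ j
      · obtain ⟨c, hc⟩ := Submodule.mem_span_singleton.1 hy
        rw [hu j h, ← map_smul] at hc
        -- A vector with a multiple in the orbit of x comes from some z at index s. Before i,
        -- injectivity turns the relation into one between z and x, and x is primitive.
        obtain ⟨z, hz⟩ := hsat s j h n y hn ⟨c • x, hc⟩
        by_cases hj : j < i
        · rw [← hz, ← map_smul] at hc
          have hzx := hxs n z hn (hinj j h hj hc ▸ Submodule.smul_mem _ _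
            (Submodule.mem_span_singleton_self _))
          obtain ⟨c', rfl⟩ := Submodule.mem_span_singleton.1 hzx
          rw [← hz, map_smul, ← hu j h]
          exact Submodule.smul_mem _ _ (Submodule.mem_span_singleton_self _)
        · have hx : structureMap F h x = 0 := by
            rw [← structureMap_comp F hsi (not_lt.1 hj), hxi, map_zero]
          rw [map_smul, hx, smul_zero] at hc
          rw [(smul_eq_zero_iff_right hn).1 hc.symm]
          exact zero_mem _
      · have := hs0 j (not_le.1 h)
        rw [Subsingleton.elim y 0]
        exact zero_mem _
    have hfree : ∀ j, Module.Free R (F.obj j ⧸ (R ∙ u j)) := fun j => (free_quotient_iff _).2 (hLs j)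
    let Q := quotientModule F (fun j => R ∙ u j) hL
    have : ∀ j, Module.Finite R (Q.obj j) := fun j =>
      inferInstanceAs (Module.Finite R (F.obj j ⧸ (R ∙ u j)))
    have : ∀ j, Module.IsTorsionFree R (Q.obj j) := fun j =>
      inferInstanceAs (Module.IsTorsionFree R (F.obj j ⧸ (R ∙ u j)))
    refine hasIntervalBasis_of_quotient F hsi' hs0 hx0 hxi hinj u hu hu' hL (ih Q ?_ ?_ ?_)
    · exact inferInstanceAs (Subsingleton (F.obj (Fin.last m) ⧸ (R ∙ u (Fin.last m))))
    · rintro a b h n y hn ⟨z, hz⟩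
      obtain ⟨y, rfl⟩ := Submodule.Quotient.mk_surjective _ y
      obtain ⟨z, rfl⟩ := Submodule.Quotient.mk_surjective _ z
      have hz' : (Submodule.Quotient.mk (structureMap F h z) : F.obj b ⧸ (R ∙ u b)) =
          Submodule.Quotient.mk (n • y) := hz
      rw [Submodule.Quotient.eq] at hz'
      -- From index s on, the multiple of `u b` is the image of one of `u a` and can be absorbed in
      -- the preimage; before s, the module at a is zero and only saturation of the span of `u b` is
      -- needed.
      by_cases hsa : s ≤ a
      · obtain ⟨c, hc⟩ := Submodule.mem_span_singleton.1 hz'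
        rw [← hmap a b h hsa, ← map_smul, eq_sub_iff_add_eq, ← eq_sub_iff_add_eq', ← map_sub] at hc
        obtain ⟨z', hz'⟩ := hsat a b h n y hn ⟨_, hc.symm⟩
        refine ⟨Submodule.Quotient.mk z', ?_⟩
        rw [← hz']
        rfl
      · have := hs0 a (not_le.1 hsa)
        rw [Subsingleton.elim z 0, map_zero, zero_sub, Submodule.neg_mem_iff] at hz'
        have h0 : (Submodule.Quotient.mk y : F.obj b ⧸ (R ∙ u b)) = 0 :=
          (Submodule.Quotient.mk_eq_zero _).2 (hLs b n y hn hz')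
        exact ⟨0, by rw [map_zero]; exact h0.symm⟩
    · have hle : ∀ j, Module.finrank R (Q.obj j) ≤ Module.finrank R (F.obj j) := fun j =>
        Submodule.finrank_quotient_le _
      have hlt : Module.finrank R (Q.obj s) < Module.finrank R (F.obj s) := by
        have h1 := Submodule.finrank_quotient_add_finrank (R ∙ u s)
        have : Nontrivial (R ∙ u s) := by
          rw [Submodule.nontrivial_iff_ne_bot, Ne, Submodule.span_singleton_eq_bot, hu s le_rfl,
            structureMap_self]
          exact hx0
        have h2 := Module.finrank_pos (R := R) (M := (R ∙ u s))
        have h3 : Module.finrank R (Q.obj s) = Module.finrank R (F.obj s ⧸ (R ∙ u s)) := rfl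
        omega
      have := Finset.sum_lt_sum (fun j _ => hle j) ⟨s, Finset.mem_univ s, hlt⟩
      omega

end Intervals

/-! ### Splitting is equivalent to freeness of all cokernels -/

section Splitting

variable {R : Type} [CommRing R] {m : ℕ} {F : PersistenceModule R m}

theorem finiteDirectSum_intervalModule_map_apply {n : ℕ} (b d : Fin n → ℕ) {i j : Fin (m + 1)}
    (f : i ⟶ j) (x : (t : Fin n) → PLift (b t ≤ i.1 ∧ i.1 < d t) → R) (t : Fin n)
    (hj : PLift (b t ≤ j.1 ∧ j.1 < d t)) :
    (((finiteDirectSum fun t => intervalModule R m (b t) (d t)).map f).hom x :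
      (t : Fin n) → PLift (b t ≤ j.1 ∧ j.1 < d t) → R) t hj =
      if hi : b t ≤ i.1 ∧ i.1 < d t then x t ⟨hi⟩ else 0 := by
  change (if hi : b t ≤ i.1 ∧ i.1 < d t then LinearMap.proj (PLift.up hi) else 0 :
    (PLift (b t ≤ i.1 ∧ i.1 < d t) → R) →ₗ[R] R) (x t) = _
  split_ifs <;> rfl

theorem HasIntervalBasis.splits (h : HasIntervalBasis F) : SplitsIntoIntervals F := by
  classical
  obtain ⟨κ, _, b, d, v, hbd, hv0, hv, hspan, hind⟩ := h
  let e := (Fintype.equivFin κ).symm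
  refine ⟨Fintype.card κ, fun t => b (e t), fun t => d (e t), fun t => hbd _, ⟨Iso.symm ?_⟩⟩
  -- The coefficient of an interval that is not alive at j is set to 0; its generator is 0 there
  -- too, so sums may run over all intervals.
  let coef : ∀ j : Fin (m + 1), ∀ t, ((t : Fin (Fintype.card κ)) →
      PLift (b (e t) ≤ j.1 ∧ j.1 < d (e t)) → R) →ₗ[R] R := fun j t =>
    if h : b (e t) ≤ j.1 ∧ j.1 < d (e t) then LinearMap.proj (PLift.up h) ∘ₗ LinearMap.proj t else 0
  let Ψ : ∀ j : Fin (m + 1), ((t : Fin (Fintype.card κ)) →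
      PLift (b (e t) ≤ j.1 ∧ j.1 < d (e t)) → R) →ₗ[R] F.obj j := fun j =>
    ∑ t, (coef j t).smulRight (v (e t) j)
  have hΨ : ∀ j x, Ψ j x = ∑ t, coef j t x • v (e t) j := by
    intro j x
    simp [Ψ, LinearMap.sum_apply]
  have hbij : ∀ j, Function.Bijective (Ψ j) := by
    intro j
    constructor
    · rw [← LinearMap.ker_eq_bot, LinearMap.ker_eq_bot']
      intro x hx
      rw [hΨ, ← Equiv.sum_comp e.symm] at hx
      have h1 := hind j (fun t => coef j (e.symm t) x) (by simpa using hx)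
      funext t ⟨ht⟩
      have h2 := h1 (e t) ht.1 ht.2
      simpa [coef, ht] using h2
    · intro y
      obtain ⟨c, hc⟩ := hspan j y
      refine ⟨fun t _ => c (e t), ?_⟩
      rw [hΨ, hc, ← Equiv.sum_comp e]
      refine Finset.sum_congr rfl fun t _ => ?_
      by_cases ht : b (e t) ≤ j.1 ∧ j.1 < d (e t)
      · simp [coef, ht]
      · rw [hv0 _ j ht, smul_zero, smul_zero]
  refine NatIso.ofComponents (fun j => (LinearEquiv.ofBijective (Ψ j) (hbij j)).toModuleIso)
    fun {i j} f => ModuleCat.hom_ext (LinearMap.ext fun x => ?_)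
  change Ψ j (((finiteDirectSum fun t => intervalModule R m (b (e t)) (d (e t))).map f).hom x) =
    structureMap F (leOfHom f) (Ψ i x)
  have h2 : structureMap F (leOfHom f) (Ψ i x) =
      ∑ t, coef i t x • structureMap F (leOfHom f) (v (e t) i) := by
    refine (congrArg _ (hΨ i x)).trans ?_
    rw [map_sum]
    exact Finset.sum_congr rfl fun t _ => map_smul _ _ _
  refine (hΨ _ _).trans (Eq.trans (Finset.sum_congr rfl fun t _ => ?_) h2.symm)
  by_cases hj : b (e t) ≤ j.1 ∧ j.1 < d (e t)
  · have h1 : coef j t (((finiteDirectSum fun t =>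
        intervalModule R m (b (e t)) (d (e t))).map f).hom x) = coef i t x := by
      simp only [coef, dif_pos hj]
      refine (finiteDirectSum_intervalModule_map_apply (fun t => b (e t)) (fun t => d (e t)) f x t
        ⟨hj⟩).trans ?_
      by_cases hi : b (e t) ≤ i.1 ∧ i.1 < d (e t)
      · rw [dif_pos hi, dif_pos hi]; rfl
      · rw [dif_neg hi, dif_neg hi]; rfl
    refine (congrArg (· • v (e t) j) h1).trans ?_
    by_cases hi : b (e t) ≤ i.1 ∧ i.1 < d (e t)
    · rw [hv _ _ _ _ hi.1]
    · simp only [coef, dif_neg hi]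
      exact (zero_smul R _).trans (zero_smul R _).symm
  · rw [hv0 _ j hj, smul_zero]
    by_cases hi : b (e t) ≤ i.1 ∧ i.1 < d (e t)
    · rw [hv _ _ _ _ hi.1, hv0 _ j hj, smul_zero]
    · rw [hv0 _ i hi, map_zero, smul_zero]

/-- The image consists of all vectors supported on the intervals alive at both indices. Such a y is
its own preimage; on the other coordinates a multiple of y is 0, hence y is. -/
theorem isSaturated_range_intervals [IsDomain R] {n : ℕ} (b d : Fin n → ℕ) {i j : Fin (m + 1)}
    (h : i ≤ j) : IsSaturated (LinearMap.range
      (structureMap (finiteDirectSum fun t => intervalModule R m (b t) (d t)) h)) := by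
  classical
  rintro r y hr ⟨x, hx⟩
  let x' : (t : Fin n) → PLift (b t ≤ i.1 ∧ i.1 < d t) → R := fun t _ =>
    if hj : b t ≤ j.1 ∧ j.1 < d t then (y t : PLift (b t ≤ j.1 ∧ j.1 < d t) → R) ⟨hj⟩ else 0
  refine ⟨x', ?_⟩
  funext t
  refine funext fun hj => ?_
  refine (finiteDirectSum_intervalModule_map_apply b d (homOfLE h) x' t hj).trans ?_
  have h1 := (finiteDirectSum_intervalModule_map_apply b d (homOfLE h) x t hj).symm.trans
    (congrFun (congrFun hx t : (_ : PLift (b t ≤ j.1 ∧ j.1 < d t) → R) = _) hj)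
  by_cases hi : b t ≤ i.1 ∧ i.1 < d t
  · rw [dif_pos hi]
    exact dif_pos hj.down
  · rw [dif_neg hi] at h1 ⊢
    exact ((mul_eq_zero.1 h1.symm).resolve_left hr).symm

theorem isSaturated_range_of_splits [IsDomain R] (hF : SplitsIntoIntervals F) {i j : Fin (m + 1)}
    (h : i ≤ j) : IsSaturated (LinearMap.range (structureMap F h)) := by
  obtain ⟨n, b, d, -, ⟨φ⟩⟩ := hF
  rintro r y hr ⟨x, hx⟩
  have hnat := fun z => congrArg (fun g => g.hom z) (φ.hom.naturality (homOfLE h))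
  have hnat' := fun z => congrArg (fun g => g.hom z) (φ.inv.naturality (homOfLE h))
  obtain ⟨z, hz⟩ := isSaturated_range_intervals b d h r ((φ.hom.app j).hom y) hr
    ⟨(φ.hom.app i).hom x, by rw [← map_smul, ← hx]; exact (hnat x).symm⟩
  refine ⟨(φ.inv.app i).hom z, (hnat' z).symm.trans ?_⟩
  change (φ.inv.app j).hom (structureMap _ h z) = y
  rw [hz]
  exact congrArg (fun g => g.hom y) (φ.hom_inv_id_app j)

theorem freeCokernel_iff [IsDomain R] [IsPrincipalIdealRing R] [∀ j, Module.Finite R (F.obj j)]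
    {a b : Fin (m + 1)} (h : a ≤ b) :
    FreeCokernel F h ↔ IsSaturated (LinearMap.range (structureMap F h)) :=
  free_quotient_iff _

theorem forall_freeCokernel_iff_splits [IsDomain R] [IsPrincipalIdealRing R]
    [∀ j, Module.Finite R (F.obj j)] [∀ j, Module.IsTorsionFree R (F.obj j)]
    (hlast : Subsingleton (F.obj (Fin.last m))) :
    (∀ (a b : Fin (m + 1)) (h : a ≤ b), FreeCokernel F h) ↔ SplitsIntoIntervals F :=
  ⟨fun h => (hasIntervalBasis_of_saturated _ F hlast
      (fun a b hab => (freeCokernel_iff hab).1 (h a b hab)) le_rfl).splits,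
    fun h _ _ hab => (freeCokernel_iff hab).2 (isSaturated_range_of_splits h hab)⟩

end Splitting

/-! ### Simplicial chains and the boundary map -/

section Chains

variable {R : Type} [CommRing R] {V : Type}

theorem Chain.ext {x y : Chain R V} (h : ∀ s, x.coeff s = y.coeff s) : x = y := Finsupp.ext h

/-- The coefficient at a simplex as a linear map. -/
noncomputable def Chain.coeffHom (R : Type) [CommRing R] {V : Type} (s : Finset V) :
    Chain R V →ₗ[R] R :=
  (Finsupp.lapply s : (Finset V →₀ R) →ₗ[R] R)

theorem Chain.coeffHom_apply (s : Finset V) (x : Chain R V) : Chain.coeffHom R s x = x.coeff s := rfl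

theorem Chain.coeff_single [DecidableEq V] (s t : Finset V) :
    (Chain.single R s).coeff t = if s = t then 1 else 0 := by
  classical
  refine (Finsupp.single_apply (a := s) (a' := t) (b := (1 : R))).trans ?_
  congr

theorem mem_chains {K : PreAbstractSimplicialComplex V} {c : ℕ} {x : Chain R V} :
    x ∈ chains R K c ↔ ∀ s, x.coeff s ≠ 0 → s ∈ K.faces ∧ s.card = c := by
  refine (Finsupp.mem_supported R (p := (x : Finset V →₀ R))).trans ?_
  exact forall_congr' fun s => imp_congr_left Finsupp.mem_support_iff

theorem single_mem_chains {K : PreAbstractSimplicialComplex V} {c : ℕ} {s : Finset V}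
    (h : s ∈ K.faces) (hc : s.card = c) : Chain.single R s ∈ chains R K c :=
  Finsupp.single_mem_supported R (1 : R) ⟨h, hc⟩

theorem chains_bot (c : ℕ) : chains R (⊥ : PreAbstractSimplicialComplex V) c = ⊥ := by
  refine (Submodule.eq_bot_iff _).2 fun x hx => Chain.ext fun s => ?_
  by_contra h
  exact (mem_chains.1 hx s h).1

theorem Chain.induction {p : Chain R V → Prop} (x : Chain R V) (h0 : p 0)
    (hadd : ∀ x y, p x → p y → p (x + y)) (hs : ∀ (n : R) s, p (n • Chain.single R s)) : p x := by
  refine Finsupp.induction_linear (motive := p) x h0 hadd fun s n => ?_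
  have : (Finsupp.single s n : Finset V →₀ R) = n • Finsupp.single s 1 := by simp
  rw [this]
  exact hs n s

theorem chains_finite {K : PreAbstractSimplicialComplex V} (hK : K.faces.Finite) (c : ℕ) :
    Module.Finite R (chains R K c) := by
  have : Finite {s | s ∈ K.faces ∧ s.card = c} := hK.subset fun s hs => hs.1
  exact Module.Finite.equiv (Finsupp.supportedEquivFinsupp (M := R) (R := R)
    {s | s ∈ K.faces ∧ s.card = c}).symm

theorem smul_mem_chains [IsDomain R] {K : PreAbstractSimplicialComplex V} {n : R} (hn : n ≠ 0) {x : Chain R V} {c : ℕ} (h : n • x ∈ chains R K c) :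
    x ∈ chains R K c :=
  mem_chains.2 fun s hs => mem_chains.1 h s (mul_ne_zero hn hs)

variable [LinearOrder V]

theorem boundary_single (s : Finset V) : boundary R V (Chain.single R s) =
    ∑ v ∈ s, if (s.erase v).Nonempty then
      (-1 : R) ^ (s.filter (· < v)).card • Chain.single R (s.erase v) else 0 := by
  refine (Finsupp.linearCombination_single R (1 : R) s).trans ?_
  exact one_smul _ _

theorem boundary_mem_chains {K : PreAbstractSimplicialComplex V} {c : ℕ} {x : Chain R V}
    (hx : x ∈ chains R K (c + 1)) : boundary R V x ∈ chains R K c := by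
  have h : chains R K (c + 1) = Submodule.span R
      ((fun s => Chain.single R s) '' {s | s ∈ K.faces ∧ s.card = c + 1}) :=
    Finsupp.supported_eq_span_single R _
  rw [h] at hx
  refine (Submodule.span_le (p := (chains R K c).comap (boundary R V))).2 ?_ hx
  rintro _ ⟨s, hs, rfl⟩
  change boundary R V (Chain.single R s) ∈ chains R K c
  rw [boundary_single]
  refine Submodule.sum_mem _ fun v hv => ?_
  split_ifs with hne
  · refine Submodule.smul_mem _ _ (single_mem_chains ?_ ?_)
    · exact K.isRelLowerSet_faces.mem_of_le hs.1 (Finset.erase_subset _ _) hne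
    · rw [Finset.card_erase_of_mem hv, hs.2, Nat.add_sub_cancel]
  · exact zero_mem _

/-- Faces are nonempty, so there are no nonzero chains on simplices without vertices. This replaces
H_{-1} = 0 in degree 0. -/
theorem boundary_vertices {K : PreAbstractSimplicialComplex V} {x : Chain R V}
    (hx : x ∈ chains R K 1) : boundary R V x = 0 := by
  have h := boundary_mem_chains hx
  refine Chain.ext fun s => ?_
  by_contra hne
  obtain ⟨h1, h2⟩ := mem_chains.1 h s hne
  exact (K.isRelLowerSet_faces h1).1.ne_empty (Finset.card_eq_zero.1 h2)

theorem boundary_boundary (x : Chain R V) : boundary R V (boundary R V x) = 0 := by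
  induction x using Chain.induction with
  | h0 => simp
  | hadd x y hx hy => rw [map_add, map_add, hx, hy, add_zero]
  | hs n s =>
    rw [map_smul, map_smul, boundary_single, map_sum]
    have h1 : ∀ v ∈ s, boundary R V (if (s.erase v).Nonempty then
        (-1 : R) ^ (s.filter (· < v)).card • Chain.single R (s.erase v) else 0) =
        ∑ u ∈ s.erase v, if ((s.erase v).erase u).Nonempty then
          ((-1 : R) ^ (s.filter (· < v)).card * (-1) ^ ((s.erase v).filter (· < u)).card) •
            Chain.single R ((s.erase v).erase u) else 0 := by
      intro v hv
      split_ifs with hne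
      · rw [map_smul, boundary_single, Finset.smul_sum]
        refine Finset.sum_congr rfl fun u _ => ?_
        rw [smul_ite, smul_zero, smul_smul]
      · rw [map_zero, Finset.not_nonempty_iff_eq_empty.1 hne, Finset.sum_empty]
    rw [Finset.sum_congr rfl h1, Finset.sum_sigma']
    -- Deleting v and then u cancels against deleting u and then v: removing the smaller vertex
    -- first lowers the position of the larger one by 1, while the opposite order shifts nothing.
    rw [Finset.sum_involution (fun p _ => ⟨p.2, p.1⟩), smul_zero]
    · rintro ⟨v, u⟩ hp
      simp only [Finset.mem_sigma, Finset.mem_erase] at hp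
      obtain ⟨hv, huv, hu⟩ := hp
      simp only [Finset.erase_right_comm (a := u) (b := v)]
      split_ifs with hne
      · rw [← add_smul]
        have key : ∀ a b : V, a ∈ s → b ∈ s → a < b →
            (-1 : R) ^ (s.filter (· < a)).card * (-1) ^ ((s.erase a).filter (· < b)).card +
            (-1 : R) ^ (s.filter (· < b)).card * (-1) ^ ((s.erase b).filter (· < a)).card = 0 := by
          intro a b ha hb hab
          have h2 : (s.erase b).filter (· < a) = s.filter (· < a) := by
            rw [Finset.filter_erase, Finset.erase_eq_of_notMem]
            simp [hab.not_gt]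
          have h3 : ((s.erase a).filter (· < b)).card + 1 = (s.filter (· < b)).card := by
            rw [Finset.filter_erase, Finset.card_erase_add_one]
            simp [ha, hab]
          rw [h2, ← h3, pow_succ]
          ring
        rcases lt_or_gt_of_ne huv with h | h
        · rw [add_comm, key u v hu hv h, zero_smul]
        · rw [key v u hv hu h, zero_smul]
      · rw [add_zero]
    · rintro ⟨v, u⟩ hp _ heq
      simp only [Finset.mem_sigma, Finset.mem_erase] at hp
      simp only [Sigma.mk.injEq] at heq
      exact hp.2.1 heq.1
    · rintro ⟨v, u⟩ hp
      simp only [Finset.mem_sigma, Finset.mem_erase] at hp ⊢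
      exact ⟨hp.2.2, hp.2.1.symm, hp.1⟩
    · rintro ⟨v, u⟩ hp
      rfl

end Chains

/-! ### Relative homology and cokernels on chain level -/

section RelativeHomology

variable {R : Type} [CommRing R] {V : Type} [LinearOrder V] {K L : PreAbstractSimplicialComplex V}
  {k : ℕ}

theorem mem_relBoundaries {x : Chain R V} : x ∈ relBoundaries R K L k ↔
    ∃ w ∈ chains R K (k + 2), ∃ u ∈ chains R L (k + 1), boundary R V w + u = x := by
  rw [relBoundaries, Submodule.mem_sup]
  constructor
  · rintro ⟨_, ⟨w, hw, rfl⟩, u, hu, rfl⟩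
    exact ⟨w, hw, u, hu, rfl⟩
  · rintro ⟨w, hw, u, hu, rfl⟩
    exact ⟨_, ⟨w, hw, rfl⟩, u, hu, rfl⟩

theorem mem_relBoundaries_bot {x : Chain R V} : x ∈ relBoundaries R K ⊥ k ↔
    ∃ w ∈ chains R K (k + 2), boundary R V w = x := by
  rw [mem_relBoundaries, chains_bot]
  simp

theorem mem_relCycles_bot {x : Chain R V} : x ∈ relCycles R K ⊥ k ↔
    x ∈ chains R K (k + 1) ∧ boundary R V x = 0 := by
  rw [relCycles, chains_bot]
  rfl

theorem relCycles_finite [IsNoetherianRing R] (hK : K.faces.Finite) :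
    Module.Finite R (relCycles R K L k) := by
  have := chains_finite (R := R) hK (k + 1)
  have : IsNoetherian R (relCycles R K L k) := isNoetherian_of_le (inf_le_left : _ ≤ chains R K (k + 1))
  infer_instance

variable [IsDomain R] [IsPrincipalIdealRing R]

theorem free_subquotient_iff {M : Type} [AddCommGroup M] [Module R M] {Z B : Submodule R M}
    [Module.Finite R Z] : Module.Free R (Subquotient Z B) ↔
      ∀ (n : R), ∀ z ∈ Z, n ≠ 0 → n • z ∈ B → z ∈ B :=
  (free_quotient_iff _).trans
    ⟨fun h n z hz hn hnz => h n ⟨z, hz⟩ hn hnz, fun h n z hn hnz => h n z z.2 hn hnz⟩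

theorem homologyFree_iff (hK : K.faces.Finite) : HomologyFree R K k ↔
    ∀ (n : R), ∀ z ∈ relCycles R K ⊥ k, n ≠ 0 → n • z ∈ relBoundaries R K ⊥ k →
      z ∈ relBoundaries R K ⊥ k := by
  have := relCycles_finite (R := R) (L := ⊥) (k := k) hK
  exact free_subquotient_iff

/-- Cycles may be replaced by all chains: if n z is a relative boundary, then n ∂z lies in L, and so
does ∂z, since coefficients are in a domain. -/
theorem relHomologyFree_iff (hK : K.faces.Finite) : RelHomologyFree R K L k ↔
    ∀ (n : R), ∀ z ∈ chains R K (k + 1), n ≠ 0 → n • z ∈ relBoundaries R K L k →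
      z ∈ relBoundaries R K L k := by
  have := relCycles_finite (R := R) (L := L) (k := k) hK
  refine free_subquotient_iff.trans ⟨fun h n z hz hn hnz => ?_, fun h n z hz => h n z hz.1⟩
  refine h n z ⟨hz, smul_mem_chains hn ?_⟩ hn hnz
  obtain ⟨w, hw, u, hu, hwu⟩ := mem_relBoundaries.1 hnz
  rw [← map_smul, ← hwu, map_add, boundary_boundary, zero_add]
  exact boundary_mem_chains hu

/-- Under freeness of `H_{k-1}(L)`, freeness of `H_k(K, L)` is freeness of the cokernel of
`H_k(L) → H_k(K)`. -/
theorem relHomologyFree_iff_coker (hK : K.faces.Finite) (hL : L.faces.Finite) (hLK : L ≤ K)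
    (hfree : ∀ j, j + 1 = k → HomologyFree R L j) : RelHomologyFree R K L k ↔
      ∀ (n : R), ∀ z ∈ relCycles R K ⊥ k, n ≠ 0 →
        n • z ∈ relBoundaries R K ⊥ k ⊔ relCycles R L ⊥ k →
        z ∈ relBoundaries R K ⊥ k ⊔ relCycles R L ⊥ k := by
  rw [relHomologyFree_iff hK]
  constructor
  · intro h n z hz hn hnz
    obtain ⟨b, hb, y, hy, hby⟩ := Submodule.mem_sup.1 hnz
    obtain ⟨w, hw, rfl⟩ := mem_relBoundaries_bot.1 hb
    obtain ⟨w', hw', u, hu, rfl⟩ := mem_relBoundaries.1 (h n z hz.1 hn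
      (mem_relBoundaries.2 ⟨w, hw, y, hy.1, hby⟩))
    -- As z is an absolute cycle, the part u in L is a cycle as well.
    refine Submodule.mem_sup.2 ⟨_, mem_relBoundaries_bot.2 ⟨w', hw', rfl⟩, u,
      mem_relCycles_bot.2 ⟨hu, ?_⟩, rfl⟩
    have h1 := (mem_relCycles_bot.1 hz).2
    rwa [map_add, boundary_boundary, zero_add] at h1
  · intro h n z hz hn hnz
    obtain ⟨w, hw, u, hu, hwu⟩ := mem_relBoundaries.1 hnz
    have hbd : n • boundary R V z = boundary R V u := by
      rw [← map_smul, ← hwu, map_add, boundary_boundary, zero_add]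
    -- ∂z is a cycle of L whose n-fold is the boundary of u in L. Torsion-freeness of H_{k-1}(L)
    -- makes ∂z itself a boundary in L, and subtracting u' turns z into an absolute cycle.
    obtain ⟨u', hu', hzu⟩ : ∃ u' ∈ chains R L (k + 1), boundary R V u' = boundary R V z := by
      cases k with
      | zero => exact ⟨0, zero_mem _, by rw [map_zero, boundary_vertices hz]⟩
      | succ j =>
        have h1 : boundary R V z ∈ relCycles R L ⊥ j :=
          mem_relCycles_bot.2 ⟨smul_mem_chains hn (hbd ▸ boundary_mem_chains hu), boundary_boundary z⟩
        exact mem_relBoundaries_bot.1 ((homologyFree_iff hL).1 (hfree j rfl) n _ h1 hn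
          (mem_relBoundaries_bot.2 ⟨u, hu, hbd.symm⟩))
    have h2 : z - u' ∈ relBoundaries R K ⊥ k ⊔ relCycles R L ⊥ k := by
      refine h n _ (mem_relCycles_bot.2 ⟨sub_mem hz (chains_mono R hLK _ hu'), ?_⟩) hn ?_
      · rw [map_sub, hzu, sub_self]
      · refine Submodule.mem_sup.2 ⟨_, mem_relBoundaries_bot.2 ⟨w, hw, rfl⟩, u - n • u',
          mem_relCycles_bot.2 ⟨sub_mem hu (Submodule.smul_mem _ _ hu'), ?_⟩, ?_⟩
        · rw [map_sub, map_smul, hzu, hbd, sub_self]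
        · rw [smul_sub, ← hwu, add_sub_assoc]
    obtain ⟨b, hb, y, hy, hby⟩ := Submodule.mem_sup.1 h2
    obtain ⟨w', hw', rfl⟩ := mem_relBoundaries_bot.1 hb
    exact mem_relBoundaries.2 ⟨w', hw', y + u', add_mem hy.1 hu', by
      rw [← add_assoc, hby, sub_add_cancel]⟩

end RelativeHomology

/-! ### The splitting criteria for persistent homology -/

section PersistentHomology

variable {R : Type} [CommRing R] {V : Type} [LinearOrder V] {m : ℕ} {K : Filtration V m} {k : ℕ}

/-- Moves the image of a structure map to the chain level, where it can be compared with relative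
homology. -/
theorem mem_range_persistentHomology {a b : Fin (m + 1)} (h : a ≤ b) (hb : b.1 < m) {z : Chain R V}
    (hz : z ∈ relCycles R (K.cx ⟨b, hb⟩) ⊥ k) :
    (fun _ => Submodule.Quotient.mk ⟨z, hz⟩ : (persistentHomology R K k).obj b) ∈
      LinearMap.range (structureMap (persistentHomology R K k) h) ↔
    z ∈ relBoundaries R (K.cx ⟨b, hb⟩) ⊥ k ⊔
      relCycles R (K.cx ⟨a, lt_of_le_of_lt h hb⟩) ⊥ k := by
  have hle : K.cx ⟨a, lt_of_le_of_lt h hb⟩ ≤ K.cx ⟨b, hb⟩ := K.mono h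
  rw [Submodule.mem_sup]
  constructor
  · rintro ⟨x, hx⟩
    obtain ⟨y, hy⟩ := Submodule.Quotient.mk_surjective _ (x ⟨lt_of_le_of_lt h hb⟩)
    have h1 : homologyMap R hle k (x ⟨lt_of_le_of_lt h hb⟩) = Submodule.Quotient.mk ⟨z, hz⟩ :=
      congrFun hx ⟨hb⟩
    rw [← hy] at h1
    have h2 := (Submodule.Quotient.eq _).1 h1.symm
    exact ⟨z - y, h2, y, y.2, sub_add_cancel _ _⟩
  · rintro ⟨w, hw, y, hy, rfl⟩
    refine ⟨fun _ => Submodule.Quotient.mk ⟨y, hy⟩, ?_⟩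
    funext _
    refine Eq.symm ((Submodule.Quotient.eq _).2 ?_)
    have h3 : w + y - y ∈ relBoundaries R (K.cx ⟨b, hb⟩) ⊥ k := by rwa [add_sub_cancel_right]
    exact h3

theorem persistentHomology_last : Subsingleton ((persistentHomology R K k).obj (Fin.last m)) :=
  ⟨fun _ _ => funext fun h => absurd h.down (lt_irrefl m)⟩

instance [IsNoetherianRing R] (j : Fin (m + 1)) :
    Module.Finite R ((persistentHomology R K k).obj j) := by
  have : ∀ h : PLift (j.1 < m), Module.Finite R (homologyGroup R (K.cx ⟨j.1, h.down⟩) k) := fun h => by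
    have := relCycles_finite (R := R) (L := ⊥) (k := k) (K.finite ⟨j.1, h.down⟩)
    infer_instance
  exact Module.Finite.pi (h := this)

theorem persistentHomology_free (hfree : ∀ i, HomologyFree R (K.cx i) k) (j : Fin (m + 1)) :
    Module.Free R ((persistentHomology R K k).obj j) := by
  have : ∀ h : PLift (j.1 < m), Module.Free R (homologyGroup R (K.cx ⟨j.1, h.down⟩) k) := fun h =>
    hfree _
  exact @Module.Free.pi (PLift (j.1 < m)) R _ _ _ _ _ this

variable [IsDomain R] [IsPrincipalIdealRing R]

theorem freeCokernel_persistentHomology_iff {a b : Fin (m + 1)} (h : a ≤ b) (hb : b.1 < m) :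
    FreeCokernel (persistentHomology R K k) h ↔
      ∀ (n : R), ∀ z ∈ relCycles R (K.cx ⟨b, hb⟩) ⊥ k, n ≠ 0 →
        n • z ∈ relBoundaries R (K.cx ⟨b, hb⟩) ⊥ k ⊔ relCycles R (K.cx ⟨a, lt_of_le_of_lt h hb⟩) ⊥ k →
        z ∈ relBoundaries R (K.cx ⟨b, hb⟩) ⊥ k ⊔ relCycles R (K.cx ⟨a, lt_of_le_of_lt h hb⟩) ⊥ k := by
  rw [freeCokernel_iff]
  constructor
  · intro hs n z hz hn hnz
    exact (mem_range_persistentHomology h hb hz).1 (hs n _ hn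
      ((mem_range_persistentHomology h hb (Submodule.smul_mem _ n hz)).2 hnz))
  · intro hs n y hn hy
    obtain ⟨⟨z, hz⟩, hzy⟩ := Submodule.Quotient.mk_surjective _ (y ⟨hb⟩)
    obtain rfl : (fun _ => Submodule.Quotient.mk ⟨z, hz⟩ : (persistentHomology R K k).obj b) = y :=
      funext fun _ => hzy
    exact (mem_range_persistentHomology h hb hz).2 (hs n z hz hn
      ((mem_range_persistentHomology h hb (Submodule.smul_mem _ n hz)).1 hy))

theorem freeCokernel_persistentHomology_last {a b : Fin (m + 1)} (h : a ≤ b) (hb : ¬ b.1 < m) :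
    FreeCokernel (persistentHomology R K k) h := by
  rw [freeCokernel_iff]
  intro n y _ _
  exact ⟨0, funext fun h => absurd h.down hb⟩

theorem forall_freeCokernel_persistentHomology_iff_splits (hfree : ∀ i, HomologyFree R (K.cx i) k) :
    (∀ (a b : Fin (m + 1)) (h : a ≤ b), FreeCokernel (persistentHomology R K k) h) ↔
      SplitsIntoIntervals (persistentHomology R K k) := by
  have : ∀ j, Module.IsTorsionFree R ((persistentHomology R K k).obj j) := fun j => by
    have := persistentHomology_free hfree j
    infer_instance
  exact forall_freeCokernel_iff_splits persistentHomology_last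

theorem forall_relHomologyFree_iff_splits (hfree' : ∀ i j, j + 1 = k → HomologyFree R (K.cx i) j)
    (hfree : ∀ i, HomologyFree R (K.cx i) k) :
    (∀ a b : Fin m, a ≤ b → RelHomologyFree R (K.cx b) (K.cx a) k) ↔
      SplitsIntoIntervals (persistentHomology R K k) := by
  rw [← forall_freeCokernel_persistentHomology_iff_splits hfree]
  constructor
  · intro h a b hab
    by_cases hb : b.1 < m
    · exact (freeCokernel_persistentHomology_iff hab hb).2
        ((relHomologyFree_iff_coker (K.finite _) (K.finite _) (K.mono hab) (hfree' _)).1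
          (h ⟨a, lt_of_le_of_lt hab hb⟩ ⟨b, hb⟩ hab))
    -- The target at index m is zero, so the pairs below m suffice.
    · exact freeCokernel_persistentHomology_last hab hb
  · intro h a b hab
    exact (relHomologyFree_iff_coker (K.finite _) (K.finite _) (K.mono hab) (hfree' _)).2
      ((freeCokernel_persistentHomology_iff (a := a.castSucc) (b := b.castSucc) hab b.2).1
        (h _ _ hab))

end PersistentHomology

/-! ### Chains as coordinate vectors and boundary matrices -/

section Vectors

open Matrix

variable {R : Type} [CommRing R] {V : Type} {p q r : ℕ}

/-- The chain with given coefficients at given simplices. -/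
noncomputable def ofVec (σ : Fin q → Finset V) (y : Fin q → R) : Chain R V :=
  ∑ i, y i • Chain.single R (σ i)

/-- The coefficients of a chain at given simplices. -/
noncomputable def toVec (σ : Fin q → Finset V) : Chain R V →ₗ[R] (Fin q → R) :=
  LinearMap.pi fun i => Chain.coeffHom R (σ i)

theorem toVec_apply (σ : Fin q → Finset V) (x : Chain R V) (i : Fin q) :
    toVec σ x i = x.coeff (σ i) := rfl

theorem coeff_ofVec [DecidableEq V] (σ : Fin q → Finset V) (y : Fin q → R) (s : Finset V) :
    (ofVec σ y).coeff s = ∑ i, if σ i = s then y i else 0 := by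
  rw [← Chain.coeffHom_apply, ofVec, map_sum]
  refine Finset.sum_congr rfl fun i _ => ?_
  rw [map_smul, Chain.coeffHom_apply, Chain.coeff_single]
  simp

/-- `σ` enumerates a set of simplices. -/
structure Enumerates (σ : Fin q → Finset V) (A : Set (Finset V)) : Prop where
  injective : Function.Injective σ
  range_eq : Set.range σ = A

variable {σ : Fin q → Finset V} {A : Set (Finset V)}

theorem Enumerates.mem (hσ : Enumerates σ A) (i : Fin q) : σ i ∈ A := hσ.range_eq ▸ ⟨i, rfl⟩

theorem Enumerates.exists_eq (hσ : Enumerates σ A) {s : Finset V} (h : s ∈ A) : ∃ i, σ i = s := by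
  rwa [← hσ.range_eq] at h

theorem Enumerates.comp_posEnum (hσ : Enumerates σ A) {c : Fin q → ℤ} {p : Set (Finset V)}
    (hc : ∀ i, 0 < c i ↔ σ i ∈ p) : Enumerates (σ ∘ posEnum c) {s | s ∈ A ∧ s ∈ p} := by
  refine ⟨hσ.injective.comp (posEnum_injective c), Set.ext fun s => ⟨?_, ?_⟩⟩
  · rintro ⟨i, rfl⟩
    exact ⟨hσ.mem _, (hc _).1 (posEnum_pos c i)⟩
  · rintro ⟨h1, h2⟩
    obtain ⟨i, rfl⟩ := hσ.exists_eq h1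
    obtain ⟨j, rfl⟩ := exists_posEnum ((hc i).2 h2)
    exact ⟨j, rfl⟩

theorem toVec_ofVec (hσ : Function.Injective σ) (y : Fin q → R) : toVec σ (ofVec σ y) = y := by
  classical
  funext i
  rw [toVec_apply, coeff_ofVec]
  simp [hσ.eq_iff]

theorem ofVec_toVec (hσ : Function.Injective σ) {x : Chain R V}
    (hx : ∀ s, x.coeff s ≠ 0 → s ∈ Set.range σ) : ofVec σ (toVec σ x) = x := by
  classical
  refine Chain.ext fun s => ?_
  rw [coeff_ofVec]
  by_cases hs : s ∈ Set.range σ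
  · obtain ⟨i, rfl⟩ := hs
    simp [hσ.eq_iff, toVec_apply]
  · rw [not_not.1 (mt (hx s) hs)]
    exact Finset.sum_eq_zero fun i _ => if_neg fun h => hs ⟨i, h⟩

variable {K L : PreAbstractSimplicialComplex V} {c : ℕ}

theorem ofVec_mem_chains (hσ : ∀ i, σ i ∈ K.faces ∧ (σ i).card = c) (y : Fin q → R) :
    ofVec σ y ∈ chains R K c :=
  Submodule.sum_mem _ fun i _ => Submodule.smul_mem _ _ (single_mem_chains (hσ i).1 (hσ i).2)

theorem ofVec_toVec_of_mem (hσ : Enumerates σ {s | s ∈ K.faces ∧ s.card = c}) {x : Chain R V}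
    (hx : x ∈ chains R K c) : ofVec σ (toVec σ x) = x :=
  ofVec_toVec hσ.injective fun s hs => hσ.range_eq ▸ mem_chains.1 hx s hs

variable [LinearOrder V]

/-- The matrix of the boundary map in given lists of simplices. -/
noncomputable def bdMatrix (R : Type) [CommRing R] (lo : Fin p → Finset V) (hi : Fin q → Finset V) :
    Matrix (Fin p) (Fin q) R :=
  fun i j => (boundary R V (Chain.single R (hi j))).coeff (lo i)

theorem bdMatrix_mulVec (lo : Fin p → Finset V) (hi : Fin q → Finset V) (y : Fin q → R) :
    bdMatrix R lo hi *ᵥ y = toVec lo (boundary R V (ofVec hi y)) := by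
  rw [ofVec, map_sum, map_sum]
  funext i
  rw [Finset.sum_apply, mulVec, dotProduct]
  refine Finset.sum_congr rfl fun j _ => ?_
  rw [map_smul, map_smul, mul_comm]
  rfl

/-- Freeness of relative homology in terms of a submatrix of the boundary matrix. -/
theorem saturatedRange_bdMatrix_iff [IsDomain R] [IsPrincipalIdealRing R]
    {X : PreAbstractSimplicialComplex V} {k : ℕ} {ρ : Fin p → Finset V} {η : Fin q → Finset V}
    (hK : K.faces.Finite) (hKX : K ≤ X) (hLK : L ≤ K)
    (hρ : Enumerates ρ {s | (s ∈ X.faces ∧ s.card = k + 1) ∧ s ∉ L.faces})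
    (hη : Enumerates η {s | s ∈ K.faces ∧ s.card = k + 2}) :
    (∀ (n : R) (y : Fin p → R) (x : Fin q → R), n ≠ 0 → n • y = bdMatrix R ρ η *ᵥ x →
      ∃ x', y = bdMatrix R ρ η *ᵥ x') ↔ RelHomologyFree R K L k := by
  -- `toVec ρ` computes coordinates modulo the chains of L. Its rows may come from a larger complex
  -- X than K; such rows of the matrix are zero.
  have hL : ∀ x ∈ chains R X (k + 1), toVec ρ x = 0 → x ∈ chains R L (k + 1) := by
    intro x hx h0
    refine mem_chains.2 fun s hs => ⟨?_, (mem_chains.1 hx s hs).2⟩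
    by_contra h
    obtain ⟨i, rfl⟩ := hρ.exists_eq ⟨mem_chains.1 hx s hs, h⟩
    exact hs (congrFun h0 i)
  have hL' : ∀ x ∈ chains R L (k + 1), toVec ρ x = 0 := by
    intro x hx
    funext i
    by_contra h
    exact (hρ.mem i).2 (mem_chains.1 hx _ h).1
  have hηK : ∀ y : Fin q → R, boundary R V (ofVec η y) ∈ chains R K (k + 1) := fun y =>
    boundary_mem_chains (ofVec_mem_chains (fun i => hη.mem i) y)
  rw [relHomologyFree_iff hK]
  constructor
  · intro h n z hz hn hnz
    obtain ⟨w, hw, u, hu, hwu⟩ := mem_relBoundaries.1 hnz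
    obtain ⟨x, hx⟩ := h n (toVec ρ z) (toVec η w) hn (by
      rw [bdMatrix_mulVec, ofVec_toVec_of_mem hη hw, ← map_smul, ← hwu, map_add, hL' u hu, add_zero])
    rw [bdMatrix_mulVec] at hx
    refine mem_relBoundaries.2 ⟨ofVec η x, ofVec_mem_chains (fun i => hη.mem i) x,
      z - boundary R V (ofVec η x), hL _ ?_ ?_, add_sub_cancel _ _⟩
    · exact chains_mono R hKX _ (sub_mem hz (hηK x))
    · rw [map_sub, hx, sub_self]
  · intro h n y x hn hy
    rw [bdMatrix_mulVec] at hy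
    -- At a simplex outside K, n times the coefficient of y is a coefficient of a boundary in K,
    -- hence 0.
    have hz : ofVec ρ y ∈ chains R K (k + 1) := by
      refine mem_chains.2 fun s hs => ?_
      have h1 := mem_chains.1 (ofVec_mem_chains (fun i => (hρ.mem i).1) y) s hs
      refine ⟨?_, h1.2⟩
      by_contra hsK
      obtain ⟨i, rfl⟩ := hρ.exists_eq ⟨h1, fun h2 => hsK (hLK h2)⟩
      have h2 : n * (ofVec ρ y).coeff (ρ i) = (boundary R V (ofVec η x)).coeff (ρ i) := by
        rw [← toVec_apply, toVec_ofVec hρ.injective]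
        exact congrFun hy i
      exact hsK (mem_chains.1 (hηK x) _ (h2 ▸ mul_ne_zero hn hs)).1
    have hu := hL _ (chains_mono R hKX _ (sub_mem (Submodule.smul_mem _ n hz) (hηK x)))
      (by rw [map_sub, map_smul, toVec_ofVec hρ.injective, hy, sub_self])
    obtain ⟨w, hw, u, hu, hwu⟩ := mem_relBoundaries.1 (h n (ofVec ρ y) hz hn
      (mem_relBoundaries.2 ⟨ofVec η x, ofVec_mem_chains (fun i => hη.mem i) x, _, hu,
        add_sub_cancel _ _⟩))
    refine ⟨toVec η w, ?_⟩
    rw [bdMatrix_mulVec, ofVec_toVec_of_mem hη hw, ← toVec_ofVec hρ.injective y, ← hwu, map_add,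
      hL' u hu, add_zero]

end Vectors

/-! ### A basis of ker N / im M from Smith factorizations -/

namespace World

open Matrix

variable (w : World) {p q r : ℕ} (N : Matrix (Fin p) (Fin q) ℤ) (M : Matrix (Fin q) (Fin r) ℤ)

/-- The rank of the free part of `ker N / im M`. -/
noncomputable abbrev homRank : ℕ := w.cokerRank (N * w.cokerSec M)ᵀ

/-- Representatives of a basis of the free part of `ker N / im M`. -/
noncomputable def homRep : Matrix (Fin q) (Fin (w.homRank N M)) ℤ :=
  w.cokerSec M * (w.cokerProj (N * w.cokerSec M)ᵀ)ᵀ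

/-- Coordinates for the free part of `ker N / im M`. -/
noncomputable def homCoord : Matrix (Fin (w.homRank N M)) (Fin q) ℤ :=
  (w.cokerSec (N * w.cokerSec M)ᵀ)ᵀ * w.cokerProj M

theorem homRank_le : w.homRank N M ≤ q := (w.cokerRank_le _).trans (w.cokerRank_le _)

theorem homCoord_mul_homRep : w.homCoord N M * w.homRep N M = 1 := by
  rw [homCoord, homRep, Matrix.mul_assoc, ← Matrix.mul_assoc (w.cokerProj M),
    cokerProj_mul_cokerSec, Matrix.one_mul, ← transpose_mul, cokerProj_mul_cokerSec, transpose_one]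

theorem mul_homRep : N * w.homRep N M = 0 := by
  rw [homRep, ← Matrix.mul_assoc]
  refine transpose_injective ((transpose_mul _ _).trans ?_)
  exact w.cokerProj_mul (N * w.cokerSec M)ᵀ

theorem homCoord_mul : w.homCoord N M * M = 0 := by
  rw [homCoord, Matrix.mul_assoc, cokerProj_mul, Matrix.mul_zero]

/-- As the range of M is saturated, x agrees modulo it with the section of its projection to the
cokernel. This projection is killed by `N * w.cokerSec M`, and the kernel of that matrix is the left
kernel of its transpose, for which `eq_of_vecMul_eq_zero` supplies basis and coordinates. -/
theorem exists_eq_homRep_add (hM : SaturatedRange M) (hNM : ∀ y, N *ᵥ (M *ᵥ y) = 0)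
    {x : Fin q → ℤ} (hx : N *ᵥ x = 0) :
    ∃ y, x = w.homRep N M *ᵥ (w.homCoord N M *ᵥ x) + M *ᵥ y := by
  obtain ⟨y, hy⟩ := w.exists_mulVec_of_cokerProj M hM
    (y := x - w.cokerSec M *ᵥ (w.cokerProj M *ᵥ x)) (by
      rw [mulVec_sub, mulVec_mulVec, cokerProj_mul_cokerSec, one_mulVec, sub_self])
  have h0 : w.cokerSec M *ᵥ (w.cokerProj M *ᵥ x) = x - M *ᵥ y := by rw [← hy, sub_sub_cancel]
  have h1 : (w.cokerProj M *ᵥ x) ᵥ* (N * w.cokerSec M)ᵀ = 0 := by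
    rw [vecMul_transpose, ← mulVec_mulVec, h0, mulVec_sub, hNM, hx, sub_zero]
  refine ⟨y, ?_⟩
  rw [homRep, homCoord, ← mulVec_mulVec, ← mulVec_mulVec, mulVec_transpose, mulVec_transpose,
    ← w.eq_of_vecMul_eq_zero _ h1, h0, sub_add_cancel]

end World

theorem toVec_comp {V : Type} {q q' : ℕ} (σ : Fin q → Finset V) (τ : Fin q' → Fin q) (x : Chain ℤ V) :
    toVec (σ ∘ τ) x = ((1 : Matrix (Fin q) (Fin q) ℤ).submatrix τ id).mulVec (toVec σ x) := by
  funext i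
  simp [Matrix.mulVec, dotProduct, Matrix.one_apply, toVec_apply]

/-! ### Coordinates for the homology of one complex -/

section HomologyBasis

open Matrix

variable {V : Type} [LinearOrder V] {L : PreAbstractSimplicialComplex V} {k p q r : ℕ}
  {lo : Fin p → Finset V} {σ : Fin q → Finset V} {η : Fin r → Finset V}

theorem boundary_ofVec_eq_zero (hσ : Enumerates σ {s | s ∈ L.faces ∧ s.card = k + 1})
    (hlo : ∀ s ∈ L.faces, s.card = k → s ∈ Set.range lo) {y : Fin q → ℤ}
    (hy : bdMatrix ℤ lo σ *ᵥ y = 0) : boundary ℤ V (ofVec σ y) = 0 := by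
  rw [bdMatrix_mulVec] at hy
  have h1 := boundary_mem_chains (R := ℤ) (ofVec_mem_chains (fun i => hσ.mem i) y)
  refine Chain.ext fun s => ?_
  by_contra h
  obtain ⟨h2, h3⟩ := mem_chains.1 h1 s h
  obtain ⟨i, rfl⟩ := hlo s h2 h3
  exact h (congrFun hy i)

theorem saturatedRange_of_homologyFree (hL : L.faces.Finite)
    (hσ : Enumerates σ {s | s ∈ L.faces ∧ s.card = k + 1})
    (hη : Enumerates η {s | s ∈ L.faces ∧ s.card = k + 2}) (hfree : HomologyFree ℤ L k) :
    SaturatedRange (bdMatrix ℤ σ η) :=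
  (saturatedRange_bdMatrix_iff (L := ⊥) hL le_rfl bot_le
    ⟨hσ.injective, hσ.range_eq.trans (Set.ext fun _ => (and_iff_left id).symm)⟩ hη).2 hfree

theorem boundary_ofVec (hσ : Enumerates σ {s | s ∈ L.faces ∧ s.card = k + 1})
    (hη : Enumerates η {s | s ∈ L.faces ∧ s.card = k + 2}) (y : Fin r → ℤ) :
    boundary ℤ V (ofVec η y) = ofVec σ (bdMatrix ℤ σ η *ᵥ y) := by
  rw [bdMatrix_mulVec, ofVec_toVec_of_mem hσ
    (boundary_mem_chains (ofVec_mem_chains (fun i => hη.mem i) y))]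

theorem ofVec_homRep_mem (w : World) (hσ : Enumerates σ {s | s ∈ L.faces ∧ s.card = k + 1})
    (hlo : ∀ s ∈ L.faces, s.card = k → s ∈ Set.range lo) (M : Matrix (Fin q) (Fin r) ℤ)
    (c : Fin (w.homRank (bdMatrix ℤ lo σ) M) → ℤ) :
    ofVec σ (w.homRep (bdMatrix ℤ lo σ) M *ᵥ c) ∈ relCycles ℤ L ⊥ k :=
  mem_relCycles_bot.2 ⟨ofVec_mem_chains (fun i => hσ.mem i) _, boundary_ofVec_eq_zero hσ hlo (by
    rw [mulVec_mulVec, w.mul_homRep, zero_mulVec])⟩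

theorem exists_subquotientEquiv {R M N : Type} [CommRing R] [AddCommGroup M] [Module R M]
    [AddCommGroup N] [Module R N] {Z B : Submodule R M} (f : Z →ₗ[R] N)
    (hf : ∀ z : Z, f z = 0 ↔ z.1 ∈ B) (hs : Function.Surjective f) :
    ∃ e : Subquotient Z B ≃ₗ[R] N, ∀ z hz, e (Submodule.Quotient.mk ⟨z, hz⟩) = f ⟨z, hz⟩ := by
  refine ⟨LinearEquiv.ofBijective (Submodule.liftQ _ f fun z hz => (hf z).2 hz)
    ⟨(injective_iff_map_eq_zero _).2 fun x hx => ?_, fun y => ?_⟩, fun z hz => rfl⟩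
  · obtain ⟨z, rfl⟩ := Submodule.Quotient.mk_surjective _ x
    exact (Submodule.Quotient.mk_eq_zero _).2 ((hf z).1 hx)
  · obtain ⟨z, rfl⟩ := hs y
    exact ⟨Submodule.Quotient.mk z, rfl⟩

/-- On cycles, `homCoord` vanishes exactly on boundaries, by the decomposition in
`exists_eq_homRep_add`; it is onto because `homRep` is a right inverse with values in cycles. -/
theorem exists_homologyEquiv (w : World) (hL : L.faces.Finite)
    (hσ : Enumerates σ {s | s ∈ L.faces ∧ s.card = k + 1})
    (hη : Enumerates η {s | s ∈ L.faces ∧ s.card = k + 2})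
    (hlo : ∀ s ∈ L.faces, s.card = k → s ∈ Set.range lo) (hfree : HomologyFree ℤ L k) :
    ∃ e : homologyGroup ℤ L k ≃ₗ[ℤ] (Fin (w.homRank (bdMatrix ℤ lo σ) (bdMatrix ℤ σ η)) → ℤ),
      ∀ z (hz : z ∈ relCycles ℤ L ⊥ k), e (Submodule.Quotient.mk ⟨z, hz⟩) =
        w.homCoord (bdMatrix ℤ lo σ) (bdMatrix ℤ σ η) *ᵥ toVec σ z := by
  set N := bdMatrix ℤ lo σ
  set M := bdMatrix ℤ σ η
  refine exists_subquotientEquiv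
    ((w.homCoord N M).mulVecLin ∘ₗ toVec σ ∘ₗ (relCycles ℤ L ⊥ k).subtype) ?_ fun c => ?_
  · rintro ⟨z, hz⟩
    change w.homCoord N M *ᵥ toVec σ z = 0 ↔ z ∈ relBoundaries ℤ L ⊥ k
    constructor
    · intro hx
      obtain ⟨hz1, hz2⟩ := mem_relCycles_bot.1 hz
      have hNz : N *ᵥ toVec σ z = 0 := by
        rw [bdMatrix_mulVec, ofVec_toVec_of_mem hσ hz1, hz2, map_zero]
      obtain ⟨y, hy⟩ := w.exists_eq_homRep_add N M (saturatedRange_of_homologyFree hL hσ hη hfree)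
        (fun y => by rw [bdMatrix_mulVec, ← boundary_ofVec hσ hη, boundary_boundary, map_zero]) hNz
      rw [hx, mulVec_zero, zero_add] at hy
      refine mem_relBoundaries_bot.2 ⟨ofVec η y, ofVec_mem_chains (fun i => hη.mem i) y, ?_⟩
      rw [boundary_ofVec hσ hη, ← hy, ofVec_toVec_of_mem hσ hz1]
    · intro hb
      obtain ⟨b, hb', rfl⟩ := mem_relBoundaries_bot.1 hb
      have hb2 : ofVec η (toVec η b) = b := ofVec_toVec_of_mem hη hb'
      rw [← hb2, ← bdMatrix_mulVec, mulVec_mulVec, w.homCoord_mul, zero_mulVec]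
  · refine ⟨⟨_, ofVec_homRep_mem w hσ hlo M c⟩, ?_⟩
    change w.homCoord N M *ᵥ toVec σ (ofVec σ (w.homRep N M *ᵥ c)) = c
    rw [toVec_ofVec hσ.injective, mulVec_mulVec, w.homCoord_mul_homRep, one_mulVec]

theorem ofVec_comp {q' : ℕ} (τ : Fin q' → Fin q) (y : Fin q' → ℤ) :
    ofVec (σ ∘ τ) y = ofVec σ ((1 : Matrix (Fin q) (Fin q) ℤ).submatrix id τ *ᵥ y) := by
  have h : ∀ i, ((1 : Matrix (Fin q) (Fin q) ℤ).submatrix id τ *ᵥ y) i =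
      ∑ j, if i = τ j then y j else 0 := fun i => by
    change (∑ j, (1 : Matrix (Fin q) (Fin q) ℤ) i (τ j) * y j) = _
    refine Finset.sum_congr rfl fun j _ => ?_
    rw [one_apply, ite_mul, one_mul, zero_mul]
  refine Chain.ext fun s => ?_
  rw [coeff_ofVec, coeff_ofVec]
  simp only [h, Function.comp_apply]
  calc (∑ j, if σ (τ j) = s then y j else 0)
      = ∑ j, ∑ i, if i = τ j then (if σ i = s then y j else 0) else 0 := by simp
    _ = ∑ i, ∑ j, if i = τ j then (if σ i = s then y j else 0) else 0 := Finset.sum_comm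
    _ = _ := Finset.sum_congr rfl fun i _ => by split_ifs <;> simp

end HomologyBasis

/-! ### Stages of a filtration and the matrices of the structure maps -/

namespace Filtration

open Matrix

variable {V : Type} {m : ℕ} (K : Filtration V m)

/-- The complex at an index of the persistence module (empty at the last index). -/
def stage (i : ℕ) : PreAbstractSimplicialComplex V := if h : i < m then K.cx ⟨i, h⟩ else ⊥

theorem stage_of_lt {i : ℕ} (h : i < m) : K.stage i = K.cx ⟨i, h⟩ := dif_pos h

theorem mem_simplices_of_mem {i : Fin m} {s : Finset V} (h : s ∈ (K.cx i).faces) :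
    s ∈ K.simplices s.card := ⟨rfl, i, h⟩

theorem birth_le_iff {c : ℕ} {s : Finset V} (hs : s ∈ K.simplices c) (i : Fin m) :
    K.birth s ≤ i ↔ s ∈ (K.cx i).faces := by
  obtain ⟨-, j, hj⟩ := hs
  constructor
  · intro h
    obtain ⟨hb, hm⟩ := Nat.sInf_mem (s := {i : ℕ | ∃ h : i < m, s ∈ (K.cx ⟨i, h⟩).faces}) ⟨j, j.2, hj⟩
    exact K.mono (show (⟨_, hb⟩ : Fin m) ≤ i from h) hm
  · intro h
    exact Nat.sInf_le ⟨i.2, h⟩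

/-- Positive exactly at the simplices that are present at index `i` of the persistence module. -/
noncomputable def presence (i : ℕ) (s : Finset V) : ℤ :=
  if 0 < (m : ℤ) - i then (i : ℤ) - K.birth s + 1 else 0

theorem presence_pos_iff {c : ℕ} {s : Finset V} (hs : s ∈ K.simplices c) (i : ℕ) :
    0 < K.presence i s ↔ s ∈ (K.stage i).faces := by
  by_cases h : i < m
  · rw [K.stage_of_lt h, ← K.birth_le_iff hs ⟨i, h⟩, presence, if_pos (by omega)]
    simp only
    omega
  · rw [presence, if_neg (by omega), stage, dif_neg h]
    exact iff_of_false (lt_irrefl _) fun h => h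

theorem enumerates_simplices {c q : ℕ} (σ : Fin q ≃ K.simplices c) :
    Enumerates (fun j => (σ j : Finset V)) (K.simplices c) :=
  ⟨Subtype.val_injective.comp σ.injective, by
    refine Set.ext fun s => ⟨?_, fun h => ⟨σ.symm ⟨s, h⟩, by simp⟩⟩
    rintro ⟨j, rfl⟩
    exact (σ j).2⟩

theorem mem_stage {i : ℕ} {s : Finset V} (h : s ∈ (K.stage i).faces) : s ∈ K.simplices s.card := by
  by_cases hi : i < m
  · rw [K.stage_of_lt hi] at h
    exact K.mem_simplices_of_mem h
  · rw [stage, dif_neg hi] at h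
    exact h.elim

/-- The simplices present at index `i`, as positions in an enumeration. -/
noncomputable def stageEnum {c q : ℕ} (σ : Fin q ≃ K.simplices c) (i : ℕ) :
    Fin (posCount fun j => K.presence i (σ j)) → Fin q :=
  posEnum fun j => K.presence i (σ j)

theorem enumerates_stage {c q : ℕ} (σ : Fin q ≃ K.simplices c) (i : ℕ) :
    Enumerates ((fun j => (σ j : Finset V)) ∘ K.stageEnum σ i)
      {s | s ∈ (K.stage i).faces ∧ s.card = c} := by
  have h := (K.enumerates_simplices σ).comp_posEnum (p := (K.stage i).faces)
    (c := fun j => K.presence i (σ j)) fun j => K.presence_pos_iff (σ j).2 i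
  refine ⟨h.injective, h.range_eq.trans (Set.ext fun s => ⟨fun h => ⟨h.2, h.1.1⟩, ?_⟩)⟩
  rintro ⟨h1, rfl⟩
  exact ⟨K.mem_stage h1, h1⟩

variable [LinearOrder V] {k p q r : ℕ} (lo : Fin p ≃ K.simplices k)
  (mid : Fin q ≃ K.simplices (k + 1)) (hi : Fin r ≃ K.simplices (k + 2))

/-- The columns of the lower boundary matrix that are present at index `i`. -/
noncomputable def lowerMatrix (i : ℕ) :
    Matrix (Fin p) (Fin (posCount fun j => K.presence i (mid j))) ℤ :=
  (boundaryMatrix K lo mid).submatrix id (K.stageEnum mid i)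

/-- The part of the upper boundary matrix that is present at index `i`. -/
noncomputable def upperMatrix (i : ℕ) : Matrix (Fin (posCount fun j => K.presence i (mid j)))
    (Fin (posCount fun j => K.presence i (hi j))) ℤ :=
  (boundaryMatrix K mid hi).submatrix (K.stageEnum mid i) (K.stageEnum hi i)

/-- The rank of the homology at index `i`. -/
noncomputable abbrev stageRank (w : World) (i : ℕ) : ℕ :=
  w.homRank (K.lowerMatrix lo mid i) (K.upperMatrix mid hi i)

/-- Representatives of a basis of the homology at index `i`. -/
noncomputable def stageRep (w : World) (i : ℕ) : Matrix (Fin q) (Fin (K.stageRank lo mid hi w i)) ℤ :=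
  (1 : Matrix (Fin q) (Fin q) ℤ).submatrix id (K.stageEnum mid i) *
    w.homRep (K.lowerMatrix lo mid i) (K.upperMatrix mid hi i)

/-- Coordinates for the homology at index `i`. -/
noncomputable def stageCoord (w : World) (i : ℕ) :
    Matrix (Fin (K.stageRank lo mid hi w i)) (Fin q) ℤ :=
  w.homCoord (K.lowerMatrix lo mid i) (K.upperMatrix mid hi i) *
    (1 : Matrix (Fin q) (Fin q) ℤ).submatrix (K.stageEnum mid i) id

theorem stageRank_le (w : World) (i : ℕ) : K.stageRank lo mid hi w i ≤ q :=
  (w.homRank_le _ _).trans (posCount_le _)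

theorem stageRank_last (w : World) {i : ℕ} (h : ¬ i < m) : K.stageRank lo mid hi w i = 0 := by
  refine Nat.le_zero.1 ((w.homRank_le _ _).trans ?_)
  by_contra hne
  have h1 := posEnum_pos _ (⟨0, by omega⟩ : Fin (posCount fun j => K.presence i (mid j)))
  rw [presence, if_neg (by omega)] at h1
  exact lt_irrefl _ h1

/-- Both directions of the isomorphism are recorded on chains, the coordinates of a class and the
representative of a vector, since the matrix of a structure map combines the one at i+1 with the
other at i. -/
theorem exists_stageEquiv (w : World) (hfree : ∀ i, HomologyFree ℤ (K.cx i) k) (i : Fin (m + 1)) :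
    ∃ e : (persistentHomology ℤ K k).obj i ≃ₗ[ℤ] (Fin (K.stageRank lo mid hi w i) → ℤ),
      (∀ (h : i.1 < m) z (hz : z ∈ relCycles ℤ (K.cx ⟨i, h⟩) ⊥ k),
        e (fun _ => Submodule.Quotient.mk ⟨z, hz⟩) =
          w.homCoord (K.lowerMatrix lo mid i) (K.upperMatrix mid hi i) *ᵥ
            toVec ((fun j => (mid j : Finset V)) ∘ K.stageEnum mid i) z) ∧
      ∀ (h : i.1 < m) c, ∃ hz : ofVec ((fun j => (mid j : Finset V)) ∘ K.stageEnum mid i)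
          (w.homRep (K.lowerMatrix lo mid i) (K.upperMatrix mid hi i) *ᵥ c) ∈
            relCycles ℤ (K.cx ⟨i, h⟩) ⊥ k, e.symm c = fun _ => Submodule.Quotient.mk
        ⟨ofVec ((fun j => (mid j : Finset V)) ∘ K.stageEnum mid i)
          (w.homRep (K.lowerMatrix lo mid i) (K.upperMatrix mid hi i) *ᵥ c), hz⟩ := by
  by_cases h : i.1 < m
  · have hσ := K.enumerates_stage mid i
    have hη := K.enumerates_stage hi i
    rw [K.stage_of_lt h] at hσ hη
    have hlo : ∀ s ∈ (K.cx ⟨i, h⟩).faces, s.card = k → s ∈ Set.range fun j => (lo j : Finset V) :=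
      fun s hs hc => (K.enumerates_simplices lo).exists_eq (hc ▸ K.mem_simplices_of_mem hs)
    obtain ⟨e, he⟩ := exists_homologyEquiv w (K.finite _) hσ hη hlo (hfree ⟨i, h⟩)
    let φ : (persistentHomology ℤ K k).obj i →ₗ[ℤ] homologyGroup ℤ (K.cx ⟨i, h⟩) k :=
      { toFun := fun x => x ⟨h⟩, map_add' := fun _ _ => rfl, map_smul' := fun _ _ => rfl }
    refine ⟨(LinearEquiv.ofBijective φ ⟨fun x y hxy => funext fun _ => hxy,
      fun x => ⟨fun _ => x, rfl⟩⟩).trans e, fun _ z hz => he z hz, fun _ c =>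
      ⟨ofVec_homRep_mem w hσ hlo _ c, ?_⟩⟩
    refine (LinearEquiv.symm_apply_eq _).2 (Eq.symm ((he _ _).trans ?_))
    rw [toVec_ofVec hσ.injective]
    exact (mulVec_mulVec _ _ _).trans
      ((congrArg (· *ᵥ c) (w.homCoord_mul_homRep _ _)).trans (one_mulVec c))
  · have h1 : Subsingleton ((persistentHomology ℤ K k).obj i) :=
      ⟨fun _ _ => funext fun h' => absurd h'.down h⟩
    have h2 : Subsingleton (Fin (K.stageRank lo mid hi w i) → ℤ) := by
      rw [K.stageRank_last lo mid hi w h]; infer_instance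
    exact ⟨{ (0 : (persistentHomology ℤ K k).obj i →ₗ[ℤ] (Fin (K.stageRank lo mid hi w i) → ℤ)) with
      invFun := 0
      left_inv := fun _ => Subsingleton.elim _ _
      right_inv := fun _ => Subsingleton.elim _ _ }, fun h' => absurd h' h, fun h' => absurd h' h⟩

/-- A representing cycle at index i is also one at i+1, so the matrix applies the coordinates there
to it. Vectors indexed by all k-simplices of the filtration mediate between the different stages. -/
theorem exists_bases (w : World) (hfree : ∀ i, HomologyFree ℤ (K.cx i) k) :
    ∃ β : Bases (persistentHomology ℤ K k), encodeBases β = _root_.vec fun i : Fin m =>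
      encodeMatrix (K.stageCoord lo mid hi w (i + 1) * K.stageRep lo mid hi w i) := by
  choose e he he' using K.exists_stageEquiv lo mid hi w hfree
  let β : Bases (persistentHomology ℤ K k) :=
    ⟨fun i => K.stageRank lo mid hi w i, fun i => Module.Basis.ofEquivFun (e i)⟩
  refine ⟨β, ?_⟩
  have key : ∀ i : Fin m, β.stepMatrix i =
      K.stageCoord lo mid hi w (i + 1) * K.stageRep lo mid hi w i := by
    intro i
    ext a c
    by_cases h : i.1 + 1 < m
    · obtain ⟨hz, h1⟩ := he' i.castSucc i.2 (Pi.single c 1)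
      have h2 : β.stepMatrix i a c = e i.succ (fun _ => Submodule.Quotient.mk ⟨_,
          relCycles_mono ℤ (K.mono (show (⟨i, i.2⟩ : Fin m) ≤ ⟨i + 1, h⟩ from Nat.le_succ _)) ⊥ k
            hz⟩) a := by
        have h3 : β.basis i.castSucc c = _ :=
          (congrFun (Module.Basis.coe_ofEquivFun (e i.castSucc)) c).trans h1
        rw [Bases.stepMatrix, LinearMap.toMatrix_apply, h3]
        rfl
      rw [h2, he i.succ h, ofVec_comp, toVec_comp,
        toVec_ofVec (K.enumerates_simplices mid).injective]
      simp only [mulVec_mulVec, mulVec_single_one, stageCoord, stageRep]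
      rw [← Matrix.mul_assoc, ← Matrix.mul_assoc]
      rfl
    -- The target is the zero module at index m: the matrix has no rows.
    · have := K.stageRank_last lo mid hi w h
      exact absurd a.2 (by change ¬ a.1 < K.stageRank lo mid hi w (i + 1); omega)
  exact congrArg (fun f => encodeList (List.ofFn f)) (funext fun i => congrArg encodeMatrix (key i))

end Filtration

theorem Dom.mul_mul_succ {ι : Type*} (n c : ι → ℕ) :
    Dom (fun i => n i * (n i * (c i + 1) + 1)) (fun i => n i ^ 2 * (c i + 1)) :=
  ⟨2, fun i => by
    rcases Nat.eq_zero_or_pos (n i) with h | h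
    · simp [h]
    · nlinarith [mul_pos h h, Nat.zero_le (n i * n i * c i), Nat.le_mul_self (n i)]⟩

/-! ### Tables of tests, and from `Computes` to `RunsIn` -/

namespace Computes

variable {ι : Type*} {w : ι → World} {x y z : ι → Val} {T E : ι → ℕ} {a b n : ι → ℕ}
  {A : ∀ i, Matrix (Fin (a i)) (Fin (b i)) ℤ}

theorem selectCols {c : ∀ i, Fin (b i) → ℤ} (ha : ∀ i, a i ≤ E i) (hb : ∀ i, b i ≤ E i)
    (hc : Computes w x (fun i => rowVal (c i)) T) (hA : Computes w x (fun i => encodeMatrix (A i)) T)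
    (hT : Dom (fun i => E i ^ 2) T) :
    Computes w x (fun i => encodeMatrix ((A i).submatrix _root_.id (posEnum (c i)))) T :=
  transpose (A := fun i => (A i).transpose.submatrix (posEnum (c i)) _root_.id)
    (fun i => (posCount_le _).trans (hb i)) ha
    (selectRows hb hc (transpose ha hb hA hT) ((Dom.le_square fun _ => le_rfl).trans hT)) hT

/-- Tabulation of a function of two indices. -/
theorem table {f : ∀ i, Fin (n i) → Fin (n i) → ℤ} {c : ι → ℕ}
    (hn : Computes w x (fun i => .int (n i)) (fun _ => 0))
    (hf : Computes (fun j : Idx fun j : Idx n => n j.1 => w j.1.1)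
      (fun j => .pair (.int (j.2 : ℕ)) (.pair (.int (j.1.2 : ℕ)) (x j.1.1)))
      (fun j => .int (f j.1.1 j.1.2 j.2)) (fun j => c j.1.1))
    (hc : Dom (fun i => n i ^ 2 * (c i + 1)) T) :
    Computes w x (fun i => encodeMatrix (r := n i) (c := n i) (f i)) T := by
  have hd := (Dom.mul_mul_succ n c).trans hc
  have hn' := hn.mono (.zero T)
  refine ofRows (A := fun i => (f i : Matrix _ _ ℤ)) hn' hn' ?_
  refine map (b := fun i => n i * (c i + 1)) (range hn' (.left_of_mul hd)) ?_ hd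
  have hn'' := (hn.restrict fun j : Idx n => j.1).mono (.zero fun j => n j.1 * (c j.1 + 1))
  exact map (b := fun j => c j.1) (range (n := fun j : Idx n => n j.1) hn''.tail
    (.of_le fun j => Nat.le_mul_of_pos_right _ (Nat.succ_pos _))) hf (.refl _)

/-- A table of single tests is completed by the verdict. -/
theorem encodeTests {P : ∀ i (a b : Fin (n i)), a ≤ b → Prop}
    (h : Computes w x (fun i => encodeMatrix fun a b => bit (∀ h : a ≤ b, P i a b h)) T)
    (hT : Dom (fun i => n i ^ 2) T) : Computes w x (fun i => encodeTests (P i)) T :=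
  pair (allEntries (A := fun i a b => bit (∀ h : a ≤ b, P i a b h)) (fun _ => le_rfl)
    (fun _ => le_rfl) (f := fun i a b => 1 - bit (∀ h : a ≤ b, P i a b h))
    (sub (const _ _ _ 1) (id _ _ _)) (fun i k l => by
      rw [bit]
      split_ifs with h' <;> simp [h']) h hT) h

/-- Every larger constant is admitted, so that several programs can share one. Input size and steps
are each bounded by a multiple of T + 1, hence of 2T. -/
theorem exists_runsIn (h : Computes w x y T) (hx : Dom (fun i => (x i).size) T)
    (hT : ∀ i, 1 ≤ T i) : ∃ C, ∀ C' ≥ C, ∀ s, ∃ P, ∀ i, (w i).snf = s →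
      RunsIn (w i).ops P (x i) (y i) (C' * T i) := by
  obtain ⟨C, P, h⟩ := h
  obtain ⟨D, hD⟩ := hx
  refine ⟨2 * D + 2 * C, fun C' hC s => ⟨P s, ?_⟩⟩
  rintro i rfl
  obtain ⟨t, ht, he⟩ := h i
  refine ⟨t, he, le_trans ?_ (Nat.mul_le_mul_right _ hC)⟩
  nlinarith [hD i, hT i, Nat.mul_le_mul_left D (hT i), Nat.mul_le_mul_left C (hT i)]

end Computes

/-! ### The programs whose input is a filtration -/

/-- A filtration together with enumerations of its simplices and a machine. -/
structure FiltrationInput where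
  world : World
  V : Type
  [order : LinearOrder V]
  m : ℕ
  K : Filtration V m
  k : ℕ
  p : ℕ
  q : ℕ
  r : ℕ
  lo : Fin p ≃ K.simplices k
  mid : Fin q ≃ K.simplices (k + 1)
  hi : Fin r ≃ K.simplices (k + 2)

attribute [instance] FiltrationInput.order

namespace FiltrationInput

/-- The largest of the numbers of simplices. -/
def e (I : FiltrationInput) : ℕ := max I.p (max I.q I.r)

theorem p_le (I : FiltrationInput) : I.p ≤ I.e := le_max_left _ _

theorem q_le (I : FiltrationInput) : I.q ≤ I.e := (le_max_left _ _).trans (le_max_right _ _)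

theorem r_le (I : FiltrationInput) : I.r ≤ I.e := (le_max_right _ _).trans (le_max_right _ _)

/-- The encoded filtration. -/
noncomputable def val (I : FiltrationInput) : Val := encodeFiltration I.K I.lo I.mid I.hi

theorem val_size (I : FiltrationInput) : I.val.size ≤ 100 * (I.e ^ 2 + 1) := by
  have hb : ∀ {c n} (σ : Fin n ≃ I.K.simplices c), (encodeBirths I.K σ).size = n * 2 + 1 :=
    fun σ => vec_size_const (s := 1) fun _ => rfl
  have h1 := I.p_le
  have h2 := I.q_le
  have h3 := I.r_le
  simp only [val, encodeFiltration, Val.size, hb, encodeMatrix_size]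
  nlinarith [Nat.mul_le_mul h1 h2, Nat.mul_le_mul h2 h3, Nat.le_mul_self I.e]

/-- The birth indices of the enumerated simplices. -/
noncomputable def births (I : FiltrationInput) {c n : ℕ} (σ : Fin n ≃ I.K.simplices c) (t : Fin n) : ℤ :=
  I.K.birth (σ t : Finset I.V)

theorem val_eq (I : FiltrationInput) : I.val = .pair (.int I.m) (.pair
    (.pair (rowVal (I.births I.lo)) (.pair (rowVal (I.births I.mid)) (rowVal (I.births I.hi))))
    (.pair (encodeMatrix (boundaryMatrix I.K I.lo I.mid))
      (encodeMatrix (boundaryMatrix I.K I.mid I.hi)))) := rfl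

/-- The part of the upper boundary matrix that belongs to a relative homology group. -/
noncomputable def relMatrix (I : FiltrationInput) (a b : ℕ) :=
  (boundaryMatrix I.K I.mid I.hi).submatrix (posEnum fun t => I.births I.mid t - a)
    (posEnum fun t => b - I.births I.hi t + 1)

/-- The rows kept belong to simplices born after a, the columns to those born up to b. The last
complex of the filtration serves as the ambient one for the rows. -/
theorem saturatedRange_relMatrix (I : FiltrationInput) {a b : Fin I.m} (h : a ≤ b) :
    SaturatedRange (I.relMatrix a b) ↔ RelHomologyFree ℤ (I.K.cx b) (I.K.cx a) I.k := by
  have hX : ∀ i : Fin I.m, i ≤ (⟨I.m - 1, by have := a.2; omega⟩ : Fin I.m) := fun i => by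
    change i.1 ≤ I.m - 1
    have := i.2
    omega
  refine saturatedRange_bdMatrix_iff (R := ℤ) (X := I.K.cx ⟨I.m - 1, by have := a.2; omega⟩)
    (ρ := (fun j => (I.mid j : Finset I.V)) ∘ posEnum fun t => I.births I.mid t - a)
    (η := (fun j => (I.hi j : Finset I.V)) ∘ posEnum fun t => b - I.births I.hi t + 1)
    (I.K.finite _) (I.K.mono (hX b)) (I.K.mono h) ?_ ?_
  · have h1 := (I.K.enumerates_simplices I.mid).comp_posEnum (p := {s | s ∉ (I.K.cx a).faces})
      (c := fun t => I.births I.mid t - a) fun t => by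
        rw [Set.mem_ofPred_eq, ← I.K.birth_le_iff (I.mid t).2 a, births]
        omega
    refine ⟨h1.injective, h1.range_eq.trans (Set.ext fun s => ?_)⟩
    refine and_congr_left fun _ => ⟨fun ⟨h2, i, h3⟩ => ⟨I.K.mono (hX i) h3, h2⟩,
      fun ⟨h2, h3⟩ => ⟨h3, _, h2⟩⟩
  · have h1 := (I.K.enumerates_simplices I.hi).comp_posEnum (p := (I.K.cx b).faces)
      (c := fun t => b - I.births I.hi t + 1) fun t => by
        rw [← I.K.birth_le_iff (I.hi t).2 b, births]
        omega
    exact ⟨h1.injective, h1.range_eq.trans (Set.ext fun s =>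
      ⟨fun ⟨h2, h3⟩ => ⟨h3, h2.1⟩, fun ⟨h2, h3⟩ => ⟨⟨h3, b, h2⟩, h2⟩⟩)⟩

open Computes

theorem computes_relMatrix : Computes
    (fun j : Idx fun j : Idx m => j.1.m => j.1.1.world)
    (fun j => .pair (.int (j.2 : ℕ)) (.pair (.int (j.1.2 : ℕ)) j.1.1.val))
    (fun j => encodeMatrix (j.1.1.relMatrix j.1.2 j.2)) (fun j => j.1.1.e ^ 2) := by
  simp only [val_eq]
  have hE : Dom (fun j : Idx fun j : Idx m => j.1.m => j.1.1.e) (fun j => j.1.1.e ^ 2) :=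
    .le_square fun _ => le_rfl
  refine selectCols (E := fun j => j.1.1.e) (A := fun j : Idx fun j : Idx m => j.1.m =>
    (boundaryMatrix j.1.1.K j.1.1.mid j.1.1.hi).submatrix
      (posEnum fun t => j.1.1.births j.1.1.mid t - (j.1.2 : ℕ)) _root_.id)
    (fun j => (posCount_le _).trans j.1.1.q_le) (fun j => j.1.1.r_le)
    ?_ (selectRows (fun j => j.1.1.q_le) ?_ (id _ _ _).snd.snd.snd.snd.snd hE) (.refl _)
  · exact map (b := fun _ => 0) (id _ _ _).snd.snd.snd.fst.snd.snd
      (add (sub (id _ _ _).snd.fst (id _ _ _).fst) (const _ _ _ 1))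
      ((Dom.linear fun j => j.1.1.r_le).trans hE)
  · exact map (b := fun _ => 0) (id _ _ _).snd.snd.snd.fst.snd.fst
      (sub (id _ _ _).fst (id _ _ _).snd.snd.fst) ((Dom.linear fun j => j.1.1.q_le).trans hE)

theorem computes_relEntry : Computes
    (fun j : Idx fun j : Idx m => j.1.m => j.1.1.world)
    (fun j => .pair (.int (j.2 : ℕ)) (.pair (.int (j.1.2 : ℕ)) j.1.1.val))
    (fun j => .int (bit (∀ _ : j.1.2 ≤ j.2,
      RelHomologyFree ℤ (j.1.1.K.cx j.2) (j.1.1.K.cx j.1.2) j.1.1.k)))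
    (fun j => j.1.1.world.S j.1.1.e) := by
  have h := saturated (E := fun j => j.1.1.e) (fun j => (posCount_le _).trans j.1.1.q_le)
    (fun j => (posCount_le _).trans j.1.1.r_le) (computes_relMatrix.mono (.sq_S _ _)) (.refl _)
  -- Below the diagonal the condition is vacuous and the entry is 1.
  refine (ite' (add (sub (id _ _ _).fst (id _ _ _).snd.fst) (const _ _ _ 1)) h
    (const _ _ _ 1)).congr (fun _ => rfl) fun j => ?_
  by_cases hj : j.1.2 ≤ j.2
  · rw [if_pos (by have : j.1.2.1 ≤ j.2.1 := hj; omega)]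
    congr 2
    exact propext ((forall_prop_of_true hj).trans (saturatedRange_relMatrix _ hj).symm)
  · rw [if_neg (by have : ¬ j.1.2.1 ≤ j.2.1 := hj; omega), bit, if_pos fun h => absurd h hj]

theorem computes_relTest : Computes world val
    (fun I => _root_.encodeTests fun (a b : Fin I.m) (_ : a ≤ b) =>
      RelHomologyFree ℤ (I.K.cx b) (I.K.cx a) I.k) (fun I => I.m ^ 2 * I.world.S I.e) := by
  have hS : ∀ I : FiltrationInput, 1 ≤ I.world.S I.e := fun I => by
    have := I.world.sq_le_S I.e; omega
  refine Computes.encodeTests (table (c := fun I => I.world.S I.e) ?_ computes_relEntry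
    ⟨2, fun I => ?_⟩) (.of_le fun I => Nat.le_mul_of_pos_right _ (hS I))
  · exact (id world val _).fst
  · nlinarith [Nat.mul_le_mul_left (I.m ^ 2) (hS I)]

end FiltrationInput

namespace Computes

variable {ι : Type*} {w : ι → World} {x y z : ι → Val} {T E : ι → ℕ} {a b c : ι → ℕ}
  {A : ∀ i, Matrix (Fin (a i)) (Fin (b i)) ℤ} {B : ∀ i, Matrix (Fin (b i)) (Fin (c i)) ℤ}

/-- Four Smith runs, two for each of the two cokernel splittings, and a bounded number of quadratic
operations. -/
theorem homSplitting (ha : ∀ i, a i ≤ E i) (hb : ∀ i, b i ≤ E i) (hc : ∀ i, c i ≤ E i)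
    (hA : Computes w x (fun i => encodeMatrix (A i)) T)
    (hB : Computes w x (fun i => encodeMatrix (B i)) T) (hT : Dom (fun i => (w i).S (E i)) T) :
    Computes w x (fun i => .pair (encodeMatrix ((w i).homCoord (A i) (B i)))
      (encodeMatrix ((w i).homRep (A i) (B i)))) T := by
  have hsq := (Dom.sq_S w E).trans hT
  have hr : ∀ i, (w i).cokerRank (B i) ≤ E i := fun i => ((w i).cokerRank_le _).trans (hb i)
  have hr' : ∀ i, (w i).homRank (A i) (B i) ≤ E i := fun i => ((w i).homRank_le _ _).trans (hb i)
  refine bind (cokerSplitting hb hc hB hT) ?_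
  refine bind (cokerSplitting (A := fun i => (A i * (w i).cokerSec (B i)).transpose) hr ha
    (transpose ha hr (matMul ha hb hr hA.tail (id _ _ _).fst.snd hsq) hsq) hT) ?_
  exact (matMul (A := fun i => ((w i).cokerSec (A i * (w i).cokerSec (B i)).transpose).transpose)
    (B := fun i => (w i).cokerProj (B i)) hr' hr hb
    (transpose hr hr' (id _ _ _).fst.snd hsq) (id _ _ _).snd.fst.fst hsq).pair
    (matMul (A := fun i => (w i).cokerSec (B i))
      (B := fun i => ((w i).cokerProj (A i * (w i).cokerSec (B i)).transpose).transpose) hb hr hr'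
      (id _ _ _).snd.fst.snd (transpose hr' hr (id _ _ _).fst.fst hsq) hsq)

end Computes

namespace FiltrationInput

open Computes

/-- The presence flags at index `i` of the persistence module. -/
noncomputable def flags (I : FiltrationInput) {c n : ℕ} (σ : Fin n ≃ I.K.simplices c) (i : ℕ)
    (t : Fin n) : ℤ := I.K.presence i (σ t)

theorem computes_flags {ι : Type*} {I : ι → FiltrationInput} {x : ι → Val} {E T n c : ι → ℕ}
    {w : ι → World} {i : ι → ℕ} {σ : ∀ j, Fin (n j) ≃ (I j).K.simplices (c j)}
    (hn : ∀ j, n j ≤ E j) (hm : Computes w x (fun j => .int ((I j).m : ℕ)) T)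
    (hi : Computes w x (fun j => .int (i j : ℕ)) T)
    (hb : Computes w x (fun j => rowVal ((I j).births (σ j))) T) (hT : Dom E T) :
    Computes w x (fun j => rowVal ((I j).flags (σ j) (i j))) T := by
  refine comp (T' := E) ?_ (hm.pair (hi.pair hb)) hT
  refine map (b := fun _ => 0) (id _ _ _).snd.snd ?_ (.linear hn)
  refine (ite' (sub (id _ _ _).snd.fst (id _ _ _).snd.snd.fst)
    (add (sub (id _ _ _).snd.snd.fst (id _ _ _).fst) (const _ _ _ 1)) (const _ _ _ 0)).congr
    (fun _ => rfl) fun j => ?_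
  rw [flags, Filtration.presence]
  split_ifs <;> rfl

/-- Coordinates for and representatives of the homology at index `i`. -/
noncomputable def stageVal (I : FiltrationInput) (i : ℕ) : Val :=
  .pair (encodeMatrix (I.K.stageCoord I.lo I.mid I.hi I.world i))
    (encodeMatrix (I.K.stageRep I.lo I.mid I.hi I.world i))

theorem computes_stageVal : Computes (fun j : Idx fun I : FiltrationInput => I.m + 1 => j.1.world)
    (fun j => .pair (.int (j.2 : ℕ)) j.1.val) (fun j => j.1.stageVal j.2)
    (fun j => j.1.world.S j.1.e) := by
  simp only [val_eq]
  have hsq := Dom.sq_S (fun j : Idx fun I : FiltrationInput => I.m + 1 => j.1.world) fun j => j.1.e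
  have hE := (Dom.le_square fun _ => le_rfl).trans hsq
  refine bind (computes_flags (I := fun j => j.1) (i := fun j => j.2) (σ := fun j => j.1.hi)
    (fun j => j.1.r_le) (id _ _ _).snd.fst (id _ _ _).fst (id _ _ _).snd.snd.fst.snd.snd hE) ?_
  refine bind (computes_flags (I := fun j => j.1) (i := fun j => j.2) (σ := fun j => j.1.mid)
    (fun j => j.1.q_le) (id _ _ _).snd.snd.fst (id _ _ _).snd.fst
    (id _ _ _).snd.snd.snd.fst.snd.fst hE) ?_
  have hp := fun j : Idx fun I : FiltrationInput => I.m + 1 => j.1.p_le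
  have hq := fun j : Idx fun I : FiltrationInput => I.m + 1 => j.1.q_le
  have hr := fun j : Idx fun I : FiltrationInput => I.m + 1 => j.1.r_le
  have hq' := fun j : Idx fun I : FiltrationInput => I.m + 1 =>
    (posCount_le fun t => j.1.K.presence j.2 (j.1.mid t)).trans j.1.q_le
  have hr' := fun j : Idx fun I : FiltrationInput => I.m + 1 =>
    (posCount_le fun t => j.1.K.presence j.2 (j.1.hi t)).trans j.1.r_le
  have hs := fun j : Idx fun I : FiltrationInput => I.m + 1 =>
    (j.1.K.stageRank_le j.1.lo j.1.mid j.1.hi j.1.world j.2).trans j.1.q_le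
  refine bind (selectRows (a := fun j => j.1.q) (b := fun j => j.1.q)
    (A := fun j => (1 : Matrix (Fin j.1.q) (Fin j.1.q) ℤ)) hq (id _ _ _).fst
    (identity hq (numCols (A := fun j => boundaryMatrix j.1.K j.1.lo j.1.mid)
      (id _ _ _).snd.snd.snd.snd.snd.fst) hsq) hE) ?_
  refine bind (homSplitting (A := fun j => j.1.K.lowerMatrix j.1.lo j.1.mid j.2)
    (B := fun j => j.1.K.upperMatrix j.1.mid j.1.hi j.2) hp hq' hr'
    (selectCols (c := fun j => j.1.flags j.1.mid j.2) hp hq (id _ _ _).snd.fst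
      (id _ _ _).snd.snd.snd.snd.snd.snd.fst hsq)
    (selectRows (c := fun j => j.1.flags j.1.mid j.2) hq (id _ _ _).snd.fst
      (selectCols (c := fun j => j.1.flags j.1.hi j.2) hq hr (id _ _ _).snd.snd.fst
        (id _ _ _).snd.snd.snd.snd.snd.snd.snd hsq) hE) (.refl _)) ?_
  refine pair (matMul hs hq' hq (id _ _ _).fst.fst (id _ _ _).snd.fst hsq)
    (matMul hq hq' hs ?_ (id _ _ _).fst.snd hsq)
  refine (transpose (b := fun j => j.1.q) (A := fun j => (1 : Matrix (Fin j.1.q) (Fin j.1.q) ℤ).submatrix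
    (posEnum (j.1.flags j.1.mid j.2)) _root_.id) hq' hq (id _ _ _).snd.fst hsq).congr
    (fun _ => rfl) fun j => ?_
  rw [Matrix.transpose_submatrix, Matrix.transpose_one]
  rfl

/-- The data of each of the m + 1 stages are computed once and listed; a second traversal multiplies
those of neighbouring stages. In this way the number of Smith runs stays linear in m. -/
theorem computes_build : Computes world val (fun I => _root_.vec fun i : Fin I.m =>
    encodeMatrix (I.K.stageCoord I.lo I.mid I.hi I.world (i + 1) *
      I.K.stageRep I.lo I.mid I.hi I.world i)) (fun I => (I.m + 1) * I.world.S I.e) := by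
  have hS : ∀ I : FiltrationInput, 1 ≤ I.world.S I.e := fun I => by
    have := I.world.sq_le_S I.e; omega
  have hm : Computes world val (fun I => .int (I.m : ℕ)) (fun I => (I.m + 1) * I.world.S I.e) :=
    (id world val _).fst
  have hdom : Dom (fun I : FiltrationInput => (I.m + 1) * (I.world.S I.e + 1))
    (fun I => (I.m + 1) * I.world.S I.e) :=
    ⟨2, fun I => by nlinarith [Nat.mul_le_mul_left (I.m + 1) (hS I)]⟩
  have hle : ∀ I : FiltrationInput, I.m + 1 ≤ (I.m + 1) * I.world.S I.e := fun I =>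
    Nat.le_mul_of_pos_right _ (hS I)
  have h1 := map (f := fun I i => I.stageVal (i : ℕ)) (b := fun I => I.world.S I.e)
    (range (n := fun I : FiltrationInput => I.m + 1)
      ((add hm (const _ _ _ 1)).congr (fun _ => rfl) fun _ => by simp) (.of_le hle))
    computes_stageVal hdom
  refine mapAccum (b := fun I => I.world.S I.e)
    (st := fun I n => encodeList ((List.ofFn fun i : Fin (I.m + 1) => I.stageVal (i : ℕ)).drop n))
    (range hm (.of_le fun I => (Nat.le_succ _).trans (hle I))) (h1.congr (fun _ => rfl) fun _ => rfl)
    ?_ ((Dom.of_le fun I => Nat.mul_le_mul_right _ (Nat.le_succ _)).trans hdom)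
  have hd : ∀ (I : FiltrationInput) (n : ℕ), n < I.m + 1 →
      encodeList ((List.ofFn fun i : Fin (I.m + 1) => I.stageVal (i : ℕ)).drop n) =
        .pair (I.stageVal n)
          (encodeList ((List.ofFn fun i : Fin (I.m + 1) => I.stageVal (i : ℕ)).drop (n + 1))) := by
    intro I n hn
    rw [List.drop_eq_getElem_cons (by simpa using hn), List.getElem_ofFn]
    rfl
  have hd1 := fun j : Idx m => hd j.1 j.2 (by have := j.2.2; omega)
  have hd2 := fun j : Idx m => hd j.1 (j.2 + 1) (by have := j.2.2; omega)
  simp only [hd1, hd2]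
  have hs := fun (j : Idx m) (i : ℕ) =>
    (j.1.K.stageRank_le j.1.lo j.1.mid j.1.hi j.1.world i).trans j.1.q_le
  exact pair (matMul (fun j => hs j _) (fun j => j.1.q_le) (fun j => hs j _)
    (id _ _ _).snd.fst.snd.fst.fst (id _ _ _).snd.fst.fst.snd (.sq_S _ _)) (id _ _ _).snd.fst.snd

end FiltrationInput

/-! ### The cokernel test in given bases -/

section Bases

variable {m : ℕ} {f : PersistenceModule ℤ m} (β : Bases f)

/-- The matrix of a structure map in given bases. -/
noncomputable def Bases.matrix {a b : Fin (m + 1)} (h : a ≤ b) :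
    Matrix (Fin (β.rank b)) (Fin (β.rank a)) ℤ :=
  LinearMap.toMatrix (β.basis a) (β.basis b) (structureMap f h)

theorem Bases.stepMatrix_mul_matrix {a : Fin (m + 1)} {n : Fin m} (h : a ≤ n.castSucc) :
    β.stepMatrix n * β.matrix h = β.matrix (h.trans n.castSucc_le_succ) := by
  rw [Bases.stepMatrix, Bases.matrix, Bases.matrix, ← LinearMap.toMatrix_comp]
  congr 1
  exact LinearMap.ext fun x => structureMap_comp f h n.castSucc_le_succ x

theorem isSaturated_range_iff {R M N : Type} [CommRing R] [AddCommGroup M] [Module R M]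
    [AddCommGroup N] [Module R N] {p q : ℕ} (bM : Module.Basis (Fin p) R M)
    (bN : Module.Basis (Fin q) R N) (g : M →ₗ[R] N) : IsSaturated (LinearMap.range g) ↔
      ∀ (n : R) (y : Fin q → R) (x : Fin p → R), n ≠ 0 →
        n • y = (LinearMap.toMatrix bM bN g).mulVec x →
        ∃ x', y = (LinearMap.toMatrix bM bN g).mulVec x' := by
  have hr : ∀ x, (LinearMap.toMatrix bM bN g).mulVec x =
      bN.equivFun (g (bM.equivFun.symm x)) := fun x => by
    have := LinearMap.toMatrix_mulVec_repr bM bN g (bM.equivFun.symm x)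
    refine Eq.trans ?_ this
    exact congrArg _ (bM.equivFun.apply_symm_apply x).symm
  constructor
  · intro hs n y x hn hy
    rw [hr] at hy
    obtain ⟨x', hx'⟩ := hs n (bN.equivFun.symm y) hn ⟨bM.equivFun.symm x, by
      rw [← map_smul, hy, LinearEquiv.symm_apply_apply]⟩
    refine ⟨bM.equivFun x', ?_⟩
    rw [hr, LinearEquiv.symm_apply_apply, hx', LinearEquiv.apply_symm_apply]
  · rintro hs n y hn ⟨x, hx⟩
    obtain ⟨x', hx'⟩ := hs n (bN.equivFun y) (bM.equivFun x) hn (by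
      rw [hr, LinearEquiv.symm_apply_apply, hx, map_smul])
    rw [hr] at hx'
    exact ⟨_, bN.equivFun.injective hx'.symm⟩

theorem Bases.freeCokernel_iff {a b : Fin (m + 1)} (h : a ≤ b) :
    FreeCokernel f h ↔ SaturatedRange (β.matrix h) := by
  have : ∀ j, Module.Finite ℤ (f.obj j) := fun j => .of_basis (β.basis j)
  exact (_root_.freeCokernel_iff h).trans (isSaturated_range_iff (β.basis a) (β.basis b) _)

theorem Bases.rank_le (i : Fin (m + 1)) : β.rank i ≤ maxRank f := by
  refine le_trans (le_of_eq ?_) (Finset.le_sup (f := fun i => Module.finrank ℤ (f.obj i))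
    (Finset.mem_univ i))
  rw [Module.finrank_eq_card_basis (β.basis i), Fintype.card_fin]

theorem freeCokernel_self (h : ∀ j, Module.Finite ℤ (f.obj j)) {a : Fin (m + 1)} (ha : a ≤ a) :
    FreeCokernel f ha :=
  (_root_.freeCokernel_iff ha).2 fun _ y _ _ => ⟨y, structureMap_self f ha y⟩

end Bases

/-- A persistence module in bases together with a machine. -/
structure ModuleInput where
  world : World
  m : ℕ
  f : PersistenceModule ℤ m
  β : Bases f

namespace ModuleInput

open Computes

/-- The encoded persistence module. -/
noncomputable def val (I : ModuleInput) : Val := encodeBases I.β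

/-- The largest rank. -/
noncomputable def d (I : ModuleInput) : ℕ := maxRank I.f

/-- The encoded matrix of a structure map, with default `0` at the indices up to `a`. -/
noncomputable def mapVal (I : ModuleInput) (a : Fin (I.m + 1)) (n : ℕ) : Val :=
  if h : n < I.m + 1 then
    if h' : a < ⟨n, h⟩ then encodeMatrix (I.β.matrix (a := a) (b := ⟨n, h⟩) h'.le) else .int 0
  else .int 0

theorem mapVal_of_lt (I : ModuleInput) {a b : Fin (I.m + 1)} (h : a < b) :
    I.mapVal a b = encodeMatrix (I.β.matrix h.le) :=
  (dif_pos b.2).trans (dif_pos h)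

theorem mapVal_of_le (I : ModuleInput) {a b : Fin (I.m + 1)} (h : b ≤ a) :
    I.mapVal a b = .int 0 :=
  (dif_pos b.2).trans (dif_neg h.not_gt)

theorem mapVal_succ (I : ModuleInput) {a : Fin (I.m + 1)} {n : Fin I.m} (h : (a : ℕ) = n) :
    I.mapVal a (n + 1) = encodeMatrix (I.β.stepMatrix n) := by
  obtain rfl : a = n.castSucc := Fin.ext h
  exact I.mapVal_of_lt n.castSucc_lt_succ

/-- An entry of the table of tests. -/
noncomputable def entry (I : ModuleInput) (a b : Fin (I.m + 1)) : ℤ :=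
  bit (∀ h : a ≤ b, FreeCokernel I.f h)

theorem entry_of_le (I : ModuleInput) {a b : Fin (I.m + 1)} (h : b ≤ a) : I.entry a b = 1 := by
  refine if_pos fun h' => ?_
  obtain rfl := le_antisymm h h'
  exact freeCokernel_self (fun j => .of_basis (I.β.basis j)) h'

theorem entry_of_lt (I : ModuleInput) {a b : Fin (I.m + 1)} (h : a < b) :
    I.entry a b = bit (SaturatedRange (I.β.matrix h.le)) := by
  rw [entry]
  congr 1
  exact propext ((forall_prop_of_true h.le).trans (I.β.freeCokernel_iff _))

/-- A row index of the table. -/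
abbrev Row := Idx fun I : ModuleInput => I.m + 1

/-- A row index of the table and a step of the persistence module. -/
abbrev Step := Idx fun j : Row => j.1.m

/-- The input of a step of the test. -/
noncomputable def stepVal (j : Step) : Val :=
  .pair (encodeMatrix (j.1.1.β.stepMatrix j.2)) (.pair
    (.pair (.int (j.2 : ℕ)) (j.1.1.mapVal j.1.2 j.2)) (.pair (.int (j.1.2 : ℕ)) j.1.1.val))

theorem computes_step : Computes (fun j : Step => j.1.1.world) stepVal
    (fun j => .int (j.2 : ℕ)) (fun j => j.1.1.world.S j.1.1.d) := (id _ stepVal _).snd.fst.fst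

theorem computes_rowIndex : Computes (fun j : Step => j.1.1.world) stepVal
    (fun j => .int (j.1.2 : ℕ)) (fun j => j.1.1.world.S j.1.1.d) := (id _ stepVal _).snd.snd.fst

/-- One step of the running product in row a: below a nothing is stored, at a the step matrix itself
starts the product, and above a it is multiplied from the left. Thus no identity matrix is needed.
-/
theorem computes_mapVal : Computes (fun j : Step => j.1.1.world) stepVal
    (fun j => j.1.1.mapVal j.1.2 (j.2 + 1)) (fun j => j.1.1.world.S j.1.1.d) := by
  have hr := fun (j : Step) i => j.1.1.β.rank_le i
  have hn := computes_step
  have ha := computes_rowIndex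
  refine ite (sub hn ha) ?_ (ite (sub (add (hn.restrict Subtype.val) (const _ _ _ 1))
    (ha.restrict Subtype.val)) ?_ ?_)
  · have h (j : {j : Step // 0 < ((j.2 : ℕ) - (j.1.2 : ℕ) : ℤ)}) : j.1.1.2 < j.1.2.castSucc :=
      show (j.1.1.2 : ℕ) < j.1.2 by have := j.2; omega
    have h1 := matMul (w := fun j : {j : Step // 0 < ((j.2 : ℕ) - (j.1.2 : ℕ) : ℤ)} => j.1.1.1.world)
      (x := fun j => .pair (encodeMatrix (j.1.1.1.β.stepMatrix j.1.2)) (.pair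
        (.pair (.int (j.1.2 : ℕ)) (encodeMatrix (j.1.1.1.β.matrix (h j).le)))
        (.pair (.int (j.1.1.2 : ℕ)) j.1.1.1.val)))
      (T := fun j => j.1.1.1.world.S j.1.1.1.d)
      (A := fun j => j.1.1.1.β.stepMatrix j.1.2) (B := fun j => j.1.1.1.β.matrix (h j).le)
      (fun j => hr j.1 _) (fun j => hr j.1 _) (fun j => hr j.1 _) (id _ _ _).fst
      (id _ _ _).snd.fst.snd (.sq_S _ _)
    refine h1.congr (fun j => ?_) fun j => ?_
    · exact congrArg (fun v => Val.pair _ (Val.pair (Val.pair _ v) _))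
        (j.1.1.1.mapVal_of_lt (h j))
    · rw [Bases.stepMatrix_mul_matrix]
      exact j.1.1.1.mapVal_of_lt ((h j).trans j.1.2.castSucc_lt_succ)
  · refine (id _ (fun j => stepVal j.1.1) _).fst.congr (fun _ => rfl) fun j => ?_
    exact mapVal_succ _ (by have := j.2; have := j.1.2; omega)
  · refine (const _ _ _ 0).congr (fun _ => rfl) fun j => ?_
    refine j.1.1.1.1.mapVal_of_le (b := j.1.1.2.succ) ?_
    have h3 := j.2
    change (j.1.1.2 : ℕ) + 1 ≤ j.1.1.1.2
    omega

theorem computes_entry : Computes (fun j : Step => j.1.1.world)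
    (fun j => .pair (j.1.1.mapVal j.1.2 (j.2 + 1)) (stepVal j))
    (fun j => .int (j.1.1.entry j.1.2 j.2.succ)) (fun j => j.1.1.world.S j.1.1.d) := by
  refine ite (sub (add computes_step.tail (const _ _ _ 1)) computes_rowIndex.tail) ?_ ?_
  · have h (j : {j : Step // 0 < ((j.2 : ℕ) + 1 - (j.1.2 : ℕ) : ℤ)}) : j.1.1.2 < j.1.2.succ :=
      show (j.1.1.2 : ℕ) < j.1.2 + 1 by have := j.2; omega
    have h1 := saturated (x := fun j : {j : Step // 0 < ((j.2 : ℕ) + 1 - (j.1.2 : ℕ) : ℤ)} =>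
        .pair (encodeMatrix (j.1.1.1.β.matrix (h j).le)) (stepVal j.1))
      (w := fun j => j.1.1.1.world)
      (fun j => j.1.1.1.β.rank_le _) (fun j => j.1.1.1.β.rank_le _) (id _ _ _).fst (.refl _)
    refine h1.congr (fun j => ?_) fun j => ?_
    · exact congrArg (fun v => Val.pair v _) (j.1.1.1.mapVal_of_lt (h j))
    · rw [entry_of_lt _ (h j)]
  · refine (const _ _ _ 1).congr (fun _ => rfl) fun j => ?_
    rw [entry_of_le]
    show (j.1.2 : ℕ) + 1 ≤ j.1.1.2
    have := j.2
    omega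

/-- A single sweep through the steps gives all maps out of index a, at the price of one product and
one Smith run per step; computing each composite from scratch would cost another factor m. -/
theorem computes_row : Computes (fun j : Row => j.1.world)
    (fun j => .pair (.int (j.2 : ℕ)) j.1.val) (fun j => rowVal (j.1.entry j.2))
    (fun j => j.1.m * (j.1.world.S j.1.d + 1)) := by
  have h1 := mapAccum (b := fun j : Row => j.1.world.S j.1.d)
    (f := fun j (n : Fin j.1.m) => .int (j.1.entry j.2 n.succ))
    (st := fun j n => .pair (.int (n : ℕ)) (j.1.mapVal j.2 n))
    (id (fun j : Row => j.1.world)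
      (fun j => .pair (.int (j.2 : ℕ)) j.1.val) (fun j => j.1.m * (j.1.world.S j.1.d + 1))).snd
    (((const _ _ _ 0).pair (const _ _ _ 0)).congr (fun _ => rfl) fun j => congrArg _
      (j.1.mapVal_of_le (Fin.zero_le _)))
    ((bind computes_mapVal (computes_entry.pair ((add computes_step.tail
      (const _ _ _ 1)).pair (id _ _ _).fst))).congr (fun _ => rfl) fun j => by push_cast; rfl)
    (.refl _)
  -- The sweep yields the columns from 1 on. Column 0 is 1 in every row: it is on the diagonal or
  -- below it.
  refine ((const _ _ _ 1).pair h1).congr (fun _ => rfl) fun j => ?_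
  rw [rowVal, _root_.vec, List.ofFn_succ, entry_of_le _ (Fin.zero_le _)]
  rfl

theorem computes_cokerTest : Computes world val (fun I => _root_.encodeTests
    fun (a b : Fin (I.m + 1)) (h : a ≤ b) => FreeCokernel I.f h)
    (fun I => (I.m + 1) ^ 2 * I.world.S I.d) := by
  have hS : ∀ I : ModuleInput, 1 ≤ I.world.S I.d := fun I => by
    have := I.world.sq_le_S I.d; omega
  have hle : ∀ I : ModuleInput, (I.m + 1) ^ 2 ≤ (I.m + 1) ^ 2 * I.world.S I.d := fun I =>
    Nat.le_mul_of_pos_right _ (hS I)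
  -- The input does not contain m, which is the length of the list of matrices.
  have hn : Computes world val (fun I => .int (I.m + 1 : ℕ)) (fun I => (I.m + 1) ^ 2 * I.world.S I.d) :=
    (add (length (N := fun I : ModuleInput => I.m) (id world val _)
      (.of_le fun I => le_trans (by nlinarith) (hle I))) (const _ _ _ 1)).congr (fun _ => rfl)
        fun I => by push_cast; rfl
  refine Computes.encodeTests (ofRows (A := fun I => I.entry) hn hn
    (map (b := fun I => I.m * (I.world.S I.d + 1)) (range hn
      (.of_le fun I => le_trans (by nlinarith) (hle I))) computes_row ⟨3, fun I => ?_⟩)) (.of_le hle)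
  nlinarith [hS I, hle I, Nat.mul_le_mul_left (I.m * (I.m + 1)) (hS I)]

end ModuleInput

/-! ### Input sizes and the main theorem -/

theorem encodeList_size_le {l : List Val} {s : ℕ} (h : ∀ v ∈ l, v.size ≤ s) :
    (encodeList l).size ≤ l.length * (s + 1) + 1 := by
  induction l with
  | nil => simp [encodeList, Val.size]
  | cons v l ih =>
    have h1 := ih fun v hv => h v (List.mem_cons_of_mem _ hv)
    have h2 := h v List.mem_cons_self
    rw [encodeList, Val.size, List.length_cons, add_mul]
    omega

theorem ModuleInput.val_size (I : ModuleInput) : I.val.size ≤ I.m * (10 * I.world.S I.d) + 1 := by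
  refine (encodeList_size_le (s := 9 * I.world.S I.d) fun v hv => ?_).trans ?_
  · obtain ⟨i, rfl⟩ := List.mem_ofFn.1 hv
    rw [encodeMatrix_size]
    have h1 : I.β.rank i.succ ≤ I.d := I.β.rank_le _
    have h2 : I.β.rank i.castSucc ≤ I.d := I.β.rank_le _
    nlinarith [I.world.sq_le_S I.d, Nat.mul_le_mul h1 h2, Nat.le_mul_self I.d]
  · rw [List.length_ofFn]
    have := I.world.sq_le_S I.d
    gcongr
    omega

theorem RunsIn.mono {ops : ℕ → ℤ → ℤ → ℤ} {P : Prog} {x y : Val} {T T' : ℕ}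
    (h : RunsIn ops P x y T) (hT : T ≤ T') : RunsIn ops P x y T' :=
  h.imp fun _ h => ⟨h.1, h.2.trans hT⟩

theorem mainTheorem10 :
    ∃ C : ℕ, ∀ snf : Prog, ∃ relTest buildMatrices cokerTest : Prog,
      ∀ (ops : ℕ → ℤ → ℤ → ℤ) (S : ℕ → ℕ), ComputesSmith ops snf S →
      ∀ (V : Type) [LinearOrder V] (m : ℕ) (_ : 1 ≤ m) (K : Filtration V m) (k p q r : ℕ)
        (lo : Fin p ≃ K.simplices k) (mid : Fin q ≃ K.simplices (k + 1))
        (hi : Fin r ≃ K.simplices (k + 2)) (e : ℕ) (_ : e = max p (max q r)),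
        -- first method: test the freeness of all relative homology groups
        (RunsIn ops relTest (encodeFiltration K lo mid hi)
            (encodeTests fun (a b : Fin m) (_ : a ≤ b) =>
              RelHomologyFree ℤ (K.cx b) (K.cx a) k)
            (C * (m ^ 2 * S e)) ∧
          ((∀ i j, j + 1 = k → HomologyFree ℤ (K.cx i) j) →
            (∀ i, HomologyFree ℤ (K.cx i) k) →
            ((∀ a b : Fin m, a ≤ b → RelHomologyFree ℤ (K.cx b) (K.cx a) k) ↔
              SplitsIntoIntervals (persistentHomology ℤ K k)))) ∧
        -- second method: build a matrix representation, then test all cokernels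
        ((∀ i, HomologyFree ℤ (K.cx i) k) →
          (∃ β : Bases (persistentHomology ℤ K k),
            RunsIn ops buildMatrices (encodeFiltration K lo mid hi) (encodeBases β)
              (C * (m * S e))) ∧
          (∀ β : Bases (persistentHomology ℤ K k),
            RunsIn ops cokerTest (encodeBases β)
              (encodeTests fun (a b : Fin (m + 1)) (h : a ≤ b) =>
                FreeCokernel (persistentHomology ℤ K k) h)
              (C * (m ^ 2 * S (maxRank (persistentHomology ℤ K k))))) ∧
          ((∀ (a b : Fin (m + 1)) (h : a ≤ b), FreeCokernel (persistentHomology ℤ K k) h) ↔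
            SplitsIntoIntervals (persistentHomology ℤ K k))) := by
  have hS : ∀ (w : World) n, 1 ≤ w.S n := fun w n => by have := w.sq_le_S n; omega
  have hval : ∀ I : FiltrationInput, I.val.size ≤ 100 * (I.world.S I.e + 1) := fun I =>
    I.val_size.trans (by have := I.world.sq_le_S I.e; omega)
  have hpos : ∀ (w : World) n M, 1 ≤ (M + 1) * w.S n := fun w n M =>
    Nat.mul_pos M.succ_pos (hS w n)
  have hpos' : ∀ (w : World) n M, 1 ≤ (M + 1) ^ 2 * w.S n := fun w n M =>
    Nat.mul_pos (pow_pos M.succ_pos 2) (hS w n)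
  -- The factor m + 1 in place of m keeps the bounds positive also for m = 0, which the families of
  -- inputs include.
  obtain ⟨C₁, h₁⟩ := (FiltrationInput.computes_relTest.mono
    (T' := fun I : FiltrationInput => (I.m + 1) ^ 2 * I.world.S I.e)
    (.of_le fun I => by gcongr; omega)).exists_runsIn
    ⟨100, fun I => (hval I).trans (by gcongr; exact Nat.le_mul_of_pos_left _ (by positivity))⟩
    fun I => hpos' _ _ _
  obtain ⟨C₂, h₂⟩ := FiltrationInput.computes_build.exists_runsIn
    ⟨100, fun I => (hval I).trans (by gcongr; exact Nat.le_mul_of_pos_left _ (by positivity))⟩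
    fun I => hpos _ _ _
  obtain ⟨C₃, h₃⟩ := ModuleInput.computes_cokerTest.exists_runsIn
    ⟨10, fun I => I.val_size.trans (by
      have h : I.m * I.world.S I.d ≤ (I.m + 1) ^ 2 * I.world.S I.d := by gcongr; nlinarith
      change _ ≤ 10 * ((I.m + 1) ^ 2 * I.world.S I.d + 1)
      rw [mul_left_comm]
      omega)⟩ fun I => hpos' _ _ _
  refine ⟨4 * (C₁ + C₂ + C₃), fun snf => ?_⟩
  -- The programs are fixed from `snf` alone, before the machine and the bound S are introduced.
  obtain ⟨P₁, h₁⟩ := h₁ (C₁ + C₂ + C₃) (by omega) snf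
  obtain ⟨P₂, h₂⟩ := h₂ (C₁ + C₂ + C₃) (by omega) snf
  obtain ⟨P₃, h₃⟩ := h₃ (C₁ + C₂ + C₃) (by omega) snf
  refine ⟨P₁, P₂, P₃, ?_⟩
  rintro ops S hsmith V _ m hm K k p q r lo mid hi e rfl
  -- The factor 4 returns from m + 1 to m: for m ≥ 1, (m + 1)² ≤ 4m² and m + 1 ≤ 4m.
  have hsq : ∀ s, (C₁ + C₂ + C₃) * ((m + 1) ^ 2 * s) ≤ 4 * (C₁ + C₂ + C₃) * (m ^ 2 * s) := fun s => by
    have : (m + 1) ^ 2 ≤ 4 * m ^ 2 := by nlinarith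
    calc _ ≤ (C₁ + C₂ + C₃) * (4 * m ^ 2 * s) := by gcongr
      _ = _ := by ring
  have hlin : ∀ s, (C₁ + C₂ + C₃) * ((m + 1) * s) ≤ 4 * (C₁ + C₂ + C₃) * (m * s) := fun s => by
    calc _ ≤ (C₁ + C₂ + C₃) * (4 * m * s) := by gcongr; omega
      _ = _ := by ring
  let w : World := ⟨snf, ops, S, hsmith⟩
  let I : FiltrationInput := ⟨w, V, m, K, k, p, q, r, lo, mid, hi⟩
  refine ⟨⟨(h₁ I rfl).mono (hsq _), forall_relHomologyFree_iff_splits⟩, fun hfree => ⟨?_, fun β =>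
    (h₃ ⟨w, m, _, β⟩ rfl).mono (hsq _), forall_freeCokernel_persistentHomology_iff_splits hfree⟩⟩
  obtain ⟨β, hβ⟩ := K.exists_bases lo mid hi w hfree
  exact ⟨β, hβ ▸ (h₂ I rfl).mono (hlin _)⟩
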